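/- Let $K$ be a field, let $E$ be a bialgebra over $K$ with comultiplication $\Delta$, and let $H$ be a subbialgebra of $E$ (a subalgebra with $\Delta(H)\subseteq H\otimes H$). All tensor products without index are over $K$. For subspaces $C,D\subseteq E$ let $C\wedge_E D$ be the kernel of the composite $E\xrightarrow{\Delta}E\otimes E\to E/C\otimes E/D$; put $H^{\wedge_E 0}=0$ and $H^{\wedge_E n}=H^{\wedge_E n-1}\wedge_E H$ for $n\ge 1$ (so $H^{\wedge_E 1}=H$ and $H^{\wedge_E 2}=H\wedge_E H$). Then $\bigoplus_{n\ge0}H^{\wedge_E n+1}$ is a graded algebra with the multiplication of $E$. Let $$gr_H E=\bigoplus_{n\ge 0}gr^n_HE,\qquad gr^n_HE=H^{\wedge_E n+1}/H^{\wedge_E n},$$ be the associated graded object, with multiplication and comultiplication induced by those of $E$: $[x][y]=[xy]$ for $[x]\in gr_H^aE$, $[y]\in gr_H^bE$, and the component $gr_H^{a+b}E\to gr_H^aE\otimes gr_H^bE$ of the comultiplication is the map whose composite with the injection into $E/H^{\wedge_E a}\otimes E/H^{\wedge_E b}$ is induced by $\Delta$; the counit is that of $H$ on $gr^0_HE=H$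 and zero in positive degrees. A graded algebra $A=\bigoplus_n A_n$ is called strongly $\mathbb N$-graded if the multiplications $A_i\otimes A_j\to A_{i+j}$ are surjective for all $i,j\ge 0$. The space $M=(H\wedge_E H)/H=gr_H^1E$ is an $H$-Hopf bimodule, with the actions and coactions of $H$ induced by the multiplication and the comultiplication of $E$. For an $H$-Hopf bimodule $M$, let $T_H(M)=H\oplus M\oplus (M\otimes_HM)\oplus\cdots$ be the relative tensor algebra, and let $T_H^c(M)=H\oplus M\oplus(M\,\square_H M)\oplus\cdots$ be the cotensor coalgebra, which is a bialgebra with the multiplication that is the unique coalgebra homomorphism $x\otimes y\mapsto xy$ with $(xy)_0=x_0y_0$ and $(xy)_1=x_0y_1+x_1y_0$ (indices denote the projections to the components $H$ and $M$) and with unit $1_H$. The bialgebra of type one $H[M]$ associated to $H$ and $M$ is the subbialgebra of $T^c_H(M)$ which is the image of the algebra homomorphism $T_H(M)\to T_H^c(M)$ that restricts to the canonical inclusions of $H$ and $M$. Then the following assertions are equivalent. 1. $gr_HE$ is the bialgebra of type one associated to $H$ and $\frac{H\wedge_EH}{H}$; that is, there is an isomorphism of bialgebras $gr_HE\cong H\big[\frac{H\wedge_EH}{H}\big]$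 which is compatible with the canonical inclusions of $H=gr_H^0E$ and of $\frac{H\wedge_EH}{H}=gr_H^1E$. 2. $gr_HE$ is strongly $\mathbb N$-graded as an algebra. 3. $gr_HE$ is generated as a $K$-algebra by $H=gr_H^0E$ and $\frac{H\wedge_EH}{H}=gr_H^1E$. 4. $\bigoplus_{n\in\mathbb N}H^{\wedge_E n+1}$ is strongly $\mathbb N$-graded as an algebra. 5. $H^{\wedge_E n+1}=(H\wedge_EH)^{n}$ for every $n\ge2$, where the right-hand side is the $n$-th power of the subspace $H\wedge_EH$ with respect to the multiplication of $E$. -/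

import Mathlib

open scoped TensorProduct DirectSum

universe v u

namespace TypeOne

section TensorLemmas

variable {K : Type*} [Field K] {A B V W V' W' : Type*}
  [AddCommGroup A] [Module K A] [AddCommGroup B] [Module K B]
  [AddCommGroup V] [Module K V] [AddCommGroup W] [Module K W]
  [AddCommGroup V'] [Module K V'] [AddCommGroup W'] [Module K W']

theorem map_injective {f : V →ₗ[K] V'} {g : W →ₗ[K] W'} (hf : Function.Injective f)
    (hg : Function.Injective g) : Function.Injective (TensorProduct.map f g) :=
  TensorProduct.map_injective_of_flat_flat f g hf hg

theorem map_map_apply {f : A →ₗ[K] V} {g : B →ₗ[K] W} {f' : V →ₗ[K] V'} {g' : W →ₗ[K] W'}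
    (z : A ⊗[K] B) : TensorProduct.map f' g' (TensorProduct.map f g z) =
      TensorProduct.map (f' ∘ₗ f) (g' ∘ₗ g) z := by
  rw [TensorProduct.map_comp]; rfl

/-- Inside `V ⊗ W`, the intersection of `A ⊗ W` and `V ⊗ B` is `A ⊗ B`. -/
theorem mem_range_map {i : A →ₗ[K] V} {j : B →ₗ[K] W} {f : V →ₗ[K] V'} {g : W →ₗ[K] W'}
    (hi : Function.Exact i f) (hj : Function.Exact j g) (hj' : Function.Injective j)
    {z : V ⊗[K] W} (h1 : TensorProduct.map f LinearMap.id z = 0)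
    (h2 : TensorProduct.map LinearMap.id g z = 0) :
    z ∈ LinearMap.range (TensorProduct.map i j) := by
  obtain ⟨y, rfl⟩ := (Module.Flat.lTensor_exact V hj z).1 h2
  have h3 : TensorProduct.map f LinearMap.id y = 0 := by
    apply map_injective (f := LinearMap.id (M := V')) Function.injective_id hj'
    simp only [LinearMap.lTensor, map_map_apply, LinearMap.comp_id, LinearMap.id_comp,
      map_zero] at h1 ⊢
    exact h1
  obtain ⟨x, rfl⟩ := (Module.Flat.rTensor_exact B hi y).1 h3
  exact ⟨x, by simp [LinearMap.lTensor, LinearMap.rTensor, map_map_apply]⟩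

/-- Factor a linear map through an injective one. -/
noncomputable def factor (J : A →ₗ[K] V) (hJ : Function.Injective J) (f : B →ₗ[K] V)
    (hf : ∀ b, f b ∈ LinearMap.range J) : B →ₗ[K] A :=
  (LinearEquiv.ofInjective J hJ).symm.toLinearMap ∘ₗ f.codRestrict (LinearMap.range J) hf

@[simp]
theorem factor_spec (J : A →ₗ[K] V) (hJ : Function.Injective J) (f : B →ₗ[K] V)
    (hf : ∀ b, f b ∈ LinearMap.range J) (b : B) : J (factor J hJ f hf b) = f b := by
  have := (LinearEquiv.ofInjective J hJ).apply_symm_apply (f.codRestrict (LinearMap.range J) hf b)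
  exact congrArg Subtype.val this

end TensorLemmas

section Subbialgebra

variable {K : Type v} [Field K]

/-- The coalgebra structure on `A` which makes the injective linear map `i : A → E` into a
coalgebra `E` a coalgebra homomorphism; it exists when `Δ(A) ⊆ A ⊗ A`. -/
@[reducible]
noncomputable def subCoalgebra {A E : Type*} [AddCommGroup A] [Module K A]
    [AddCommGroup E] [Module K E] [Coalgebra K E]
    (i : A →ₗ[K] E) (hi : Function.Injective i)
    (hA : ∀ x, Coalgebra.comul (R := K) (i x) ∈ LinearMap.range (TensorProduct.map i i)) :
    Coalgebra K A where
  comul := factor (TensorProduct.map i i) (map_injective hi hi) (Coalgebra.comul ∘ₗ i) hA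
  counit := Coalgebra.counit ∘ₗ i
  coassoc := by
    set c := factor (TensorProduct.map i i) (map_injective hi hi) (Coalgebra.comul ∘ₗ i) hA
    have hc : TensorProduct.map i i ∘ₗ c = Coalgebra.comul ∘ₗ i := by ext x; simp [c]
    have e : ∀ z : (A ⊗[K] A) ⊗[K] A, TensorProduct.map i (TensorProduct.map i i)
        (TensorProduct.assoc K A A A z) = TensorProduct.assoc K E E E
          (TensorProduct.map (TensorProduct.map i i) i z) := fun z =>
      LinearMap.congr_fun (TensorProduct.map_map_comp_assoc_eq i i i) z
    ext x
    apply map_injective hi (map_injective hi hi)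
    simp only [LinearMap.comp_apply, LinearMap.rTensor, LinearMap.lTensor,
      LinearEquiv.coe_coe, e, map_map_apply, hc, LinearMap.comp_id]
    have hx : TensorProduct.map i i (c x) = Coalgebra.comul (i x) := LinearMap.congr_fun hc x
    have h1 := map_map_apply (f := i) (g := i) (f' := Coalgebra.comul (R := K))
      (g' := LinearMap.id) (c x)
    have h2 := map_map_apply (f := i) (g := i) (g' := Coalgebra.comul (R := K))
      (f' := LinearMap.id) (c x)
    simp only [LinearMap.id_comp] at h1 h2
    rw [← h1, ← h2, hx]
    exact Coalgebra.coassoc_apply (i x)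
  rTensor_counit_comp_comul := by
    ext x
    apply map_injective (f := LinearMap.id (M := K)) Function.injective_id hi
    have h1 := map_map_apply (f := i) (g := i) (f' := Coalgebra.counit (R := K))
      (g' := LinearMap.id)
      (factor (TensorProduct.map i i) (map_injective hi hi) (Coalgebra.comul ∘ₗ i) hA x)
    simp only [factor_spec, LinearMap.comp_apply, LinearMap.id_comp] at h1
    simp only [LinearMap.comp_apply, LinearMap.rTensor, map_map_apply, LinearMap.comp_id,
      LinearMap.id_comp, ← h1]
    exact Coalgebra.rTensor_counit_comul (i x)
  lTensor_counit_comp_comul := by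
    ext x
    apply map_injective (g := LinearMap.id (M := K)) hi Function.injective_id
    have h1 := map_map_apply (f := i) (g := i) (g' := Coalgebra.counit (R := K))
      (f' := LinearMap.id)
      (factor (TensorProduct.map i i) (map_injective hi hi) (Coalgebra.comul ∘ₗ i) hA x)
    simp only [factor_spec, LinearMap.comp_apply, LinearMap.id_comp] at h1
    simp only [LinearMap.comp_apply, LinearMap.lTensor, map_map_apply, LinearMap.comp_id,
      LinearMap.id_comp, ← h1]
    exact Coalgebra.lTensor_counit_comul (i x)

/-- A subbialgebra of a bialgebra over a field: a subalgebra `A` with `Δ(A) ⊆ A ⊗ A`. -/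
structure Subbialgebra (K : Type v) [Field K] (E : Type u) [Ring E] [Bialgebra K E] extends
    Subalgebra K E where
  comul_mem' : ∀ x ∈ carrier, Coalgebra.comul (R := K) x ∈
    LinearMap.range (TensorProduct.map toSubalgebra.val.toLinearMap toSubalgebra.val.toLinearMap)

variable {E : Type u} [Ring E] [Bialgebra K E]

noncomputable instance Subbialgebra.instCoalgebra (H : Subbialgebra K E) : Coalgebra K H.toSubalgebra :=
  subCoalgebra H.toSubalgebra.val.toLinearMap Subtype.val_injective
    (fun x => H.comul_mem' x x.2)

theorem Subbialgebra.comul_spec (H : Subbialgebra K E) (h : H.toSubalgebra) :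
    TensorProduct.map H.toSubalgebra.val.toLinearMap H.toSubalgebra.val.toLinearMap
      (Coalgebra.comul (R := K) h) =
      Coalgebra.comul (R := K) (h : E) :=
  factor_spec _ _ _ _ _

theorem Subbialgebra.comul_spec' (H : Subbialgebra K E) (h : H.toSubalgebra) :
    Algebra.TensorProduct.map H.toSubalgebra.val H.toSubalgebra.val (Coalgebra.comul (R := K) h) =
      Coalgebra.comul (R := K) (h : E) :=
  H.comul_spec h

theorem Subbialgebra.val_injective (H : Subbialgebra K E) : Function.Injective
    (Algebra.TensorProduct.map H.toSubalgebra.val H.toSubalgebra.val) :=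
  map_injective Subtype.val_injective Subtype.val_injective

noncomputable instance Subbialgebra.instBialgebra (H : Subbialgebra K E) : Bialgebra K H.toSubalgebra :=
  Bialgebra.mk' K H.toSubalgebra
    (Bialgebra.counit_one (R := K) (A := E))
    (fun {a b} => Bialgebra.counit_mul (R := K) (a : E) (b : E))
    (by
      apply H.val_injective
      rw [H.comul_spec', map_one]; exact Bialgebra.comul_one)
    (fun {a b} => by
      apply H.val_injective
      rw [H.comul_spec', map_mul, H.comul_spec', H.comul_spec']
      exact Bialgebra.comul_mul _ _)

end Subbialgebra

section Wedge

variable {K : Type v} [Field K]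

theorem map_mkQ_ker_left {V V' W W' : Type*} [AddCommGroup V] [Module K V] [AddCommGroup V']
    [Module K V'] [AddCommGroup W] [Module K W] [AddCommGroup W'] [Module K W']
    (g : V →ₗ[K] V') (h : W →ₗ[K] W') (z : V ⊗[K] W) :
    TensorProduct.map (LinearMap.ker g).mkQ h z = 0 ↔ TensorProduct.map g h z = 0 := by
  have e : g = (LinearMap.ker g).liftQ g le_rfl ∘ₗ (LinearMap.ker g).mkQ :=
    ((LinearMap.ker g).liftQ_mkQ g le_rfl).symm
  have hi : Function.Injective ((LinearMap.ker g).liftQ g le_rfl) :=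
    LinearMap.ker_eq_bot.1 (Submodule.ker_liftQ_eq_bot _ _ _ le_rfl)
  have := map_map_apply (f := (LinearMap.ker g).mkQ) (g := h)
    (f' := (LinearMap.ker g).liftQ g le_rfl) (g' := LinearMap.id) z
  rw [← e, LinearMap.id_comp] at this
  rw [← this]
  exact ((map_eq_zero_iff _ (map_injective hi Function.injective_id))).symm

theorem map_mkQ_ker_right {V V' W W' : Type*} [AddCommGroup V] [Module K V] [AddCommGroup V']
    [Module K V'] [AddCommGroup W] [Module K W] [AddCommGroup W'] [Module K W']
    (g : V →ₗ[K] V') (h : W →ₗ[K] W') (z : W ⊗[K] V) :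
    TensorProduct.map h (LinearMap.ker g).mkQ z = 0 ↔ TensorProduct.map h g z = 0 := by
  have e : g = (LinearMap.ker g).liftQ g le_rfl ∘ₗ (LinearMap.ker g).mkQ :=
    ((LinearMap.ker g).liftQ_mkQ g le_rfl).symm
  have hi : Function.Injective ((LinearMap.ker g).liftQ g le_rfl) :=
    LinearMap.ker_eq_bot.1 (Submodule.ker_liftQ_eq_bot _ _ _ le_rfl)
  have := map_map_apply (g := (LinearMap.ker g).mkQ) (f := h)
    (g' := (LinearMap.ker g).liftQ g le_rfl) (f' := LinearMap.id) z
  rw [← e, LinearMap.id_comp] at this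
  rw [← this]
  exact ((map_eq_zero_iff _ (map_injective Function.injective_id hi))).symm

variable {E : Type u} [AddCommGroup E] [Module K E] [Coalgebra K E]

/-- The wedge product `C ∧_E D`, the kernel of `E → E ⊗ E → E/C ⊗ E/D`. -/
noncomputable def wedge (C D : Submodule K E) : Submodule K E :=
  LinearMap.ker (TensorProduct.map C.mkQ D.mkQ ∘ₗ Coalgebra.comul)

/-- The wedge powers: `C^{∧0} = 0` and `C^{∧(n+1)} = C^{∧n} ∧ C`. -/
noncomputable def wedgePow (C : Submodule K E) : ℕ → Submodule K E
  | 0 => ⊥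
  | n + 1 => wedge (wedgePow C n) C

theorem mem_wedge {C D : Submodule K E} {x : E} :
    x ∈ wedge C D ↔ TensorProduct.map C.mkQ D.mkQ (Coalgebra.comul (R := K) x) = 0 := Iff.rfl

theorem wedge_assoc (C D F : Submodule K E) :
    wedge (wedge C D) F = wedge C (wedge D F) := by
  ext x
  rw [mem_wedge, mem_wedge]
  unfold wedge
  rw [map_mkQ_ker_left, map_mkQ_ker_right]
  have h1 := map_map_apply (f := Coalgebra.comul (R := K)) (g := LinearMap.id)
    (f' := TensorProduct.map C.mkQ D.mkQ) (g' := F.mkQ) (Coalgebra.comul (R := K) x)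
  have h2 := map_map_apply (g := Coalgebra.comul (R := K)) (f := LinearMap.id)
    (g' := TensorProduct.map D.mkQ F.mkQ) (f' := C.mkQ) (Coalgebra.comul (R := K) x)
  rw [LinearMap.comp_id] at h1 h2
  rw [← h1, ← h2]
  have h3 := Coalgebra.coassoc_apply (R := K) x
  simp only [LinearMap.lTensor, LinearMap.rTensor] at h3
  rw [← h3]
  have h4 := fun z => LinearMap.congr_fun
    (TensorProduct.map_map_comp_assoc_eq C.mkQ D.mkQ F.mkQ) z
  simp only [LinearMap.comp_apply, LinearEquiv.coe_coe] at h4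
  rw [h4, LinearEquiv.map_eq_zero_iff]

/-- `Δ(C) ⊆ C ⊗ C`. -/
def IsSubcoalg (C : Submodule K E) : Prop :=
  ∀ x ∈ C, Coalgebra.comul (R := K) x ∈ LinearMap.range (TensorProduct.map C.subtype C.subtype)

theorem IsSubcoalg.right {C : Submodule K E} (hC : IsSubcoalg C) {x : E} (hx : x ∈ C) :
    TensorProduct.map C.mkQ LinearMap.id (Coalgebra.comul (R := K) x) = 0 := by
  obtain ⟨y, hy⟩ := hC x hx
  rw [← hy, map_map_apply]
  have : C.mkQ ∘ₗ C.subtype = 0 := by ext; simp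
  rw [this, TensorProduct.map_zero_left, LinearMap.zero_apply]

theorem IsSubcoalg.left {C : Submodule K E} (hC : IsSubcoalg C) {x : E} (hx : x ∈ C) :
    TensorProduct.map LinearMap.id C.mkQ (Coalgebra.comul (R := K) x) = 0 := by
  obtain ⟨y, hy⟩ := hC x hx
  rw [← hy, map_map_apply]
  have : C.mkQ ∘ₗ C.subtype = 0 := by ext; simp
  rw [this, TensorProduct.map_zero_right, LinearMap.zero_apply]

/-- If `Δ(D) ⊆ D ⊗ E`, then `Δ(C ∧ D) ⊆ (C ∧ D) ⊗ E`. -/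
theorem wedge_right {C D : Submodule K E}
    (hD : ∀ x ∈ D, TensorProduct.map D.mkQ LinearMap.id (Coalgebra.comul (R := K) x) = 0)
    {x : E} (hx : x ∈ wedge C D) :
    TensorProduct.map (wedge C D).mkQ LinearMap.id (Coalgebra.comul (R := K) x) = 0 := by
  unfold wedge
  rw [map_mkQ_ker_left]
  have h1 := map_map_apply (f := Coalgebra.comul (R := K)) (g := LinearMap.id)
    (f' := TensorProduct.map C.mkQ D.mkQ) (g' := LinearMap.id (M := E))
    (Coalgebra.comul (R := K) x)
  rw [LinearMap.comp_id] at h1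
  rw [← h1]
  have h3 := Coalgebra.coassoc_apply (R := K) x
  simp only [LinearMap.lTensor, LinearMap.rTensor] at h3
  have h4 := fun z => LinearMap.congr_fun
    (TensorProduct.map_map_comp_assoc_eq C.mkQ D.mkQ (LinearMap.id (M := E))) z
  simp only [LinearMap.comp_apply, LinearEquiv.coe_coe] at h4
  rw [← LinearEquiv.map_eq_zero_iff (TensorProduct.assoc K _ _ _), ← h4, h3, map_map_apply]
  have h5 : TensorProduct.map D.mkQ (LinearMap.id (M := E)) ∘ₗ Coalgebra.comul =
      D.liftQ (TensorProduct.map D.mkQ LinearMap.id ∘ₗ Coalgebra.comul (R := K)) hD ∘ₗ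
        D.mkQ := (Submodule.liftQ_mkQ D (TensorProduct.map D.mkQ LinearMap.id ∘ₗ Coalgebra.comul (R := K))
      hD).symm
  have h6 := map_map_apply (f := C.mkQ) (g := D.mkQ) (f' := LinearMap.id)
    (g' := D.liftQ (TensorProduct.map D.mkQ LinearMap.id ∘ₗ Coalgebra.comul (R := K)) hD)
    (Coalgebra.comul (R := K) x)
  rw [h5, LinearMap.comp_id, ← LinearMap.id_comp C.mkQ, ← h6, mem_wedge.1 hx, map_zero]

theorem wedge_bot {C : Submodule K E}
    (hC : ∀ x ∈ C, TensorProduct.map C.mkQ LinearMap.id (Coalgebra.comul (R := K) x) = 0) :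
    wedge C ⊥ = C := by
  ext x
  have h6 := map_map_apply (f := C.mkQ) (g := LinearMap.id (M := E)) (f' := LinearMap.id)
    (g' := (⊥ : Submodule K E).mkQ) (Coalgebra.comul (R := K) x)
  rw [LinearMap.id_comp, LinearMap.comp_id] at h6
  rw [mem_wedge, ← h6]
  refine ⟨fun h => ?_, fun h => by rw [hC x h, map_zero]⟩
  rw [map_eq_zero_iff _ (map_injective Function.injective_id
    (LinearMap.ker_eq_bot.1 (Submodule.ker_mkQ _)))] at h
  have h7 := map_map_apply (f := C.mkQ) (g := LinearMap.id (M := E)) (f' := LinearMap.id)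
    (g' := Coalgebra.counit (R := K)) (Coalgebra.comul (R := K) x)
  have h8 := map_map_apply (f := LinearMap.id) (g := Coalgebra.counit (R := K) (A := E))
    (f' := C.mkQ) (g' := LinearMap.id) (Coalgebra.comul (R := K) x)
  have h9 := Coalgebra.lTensor_counit_comul (R := K) x
  simp only [LinearMap.lTensor] at h9
  simp only [LinearMap.id_comp, LinearMap.comp_id] at h7 h8
  rw [h, map_zero, ← h8, h9, TensorProduct.map_tmul] at h7
  have h10 := congrArg (TensorProduct.rid K _) h7
  simpa using h10.symm

theorem wedgePow_right {C : Submodule K E} (hC : IsSubcoalg C) (n : ℕ) {x : E} (hx : x ∈ wedgePow C n) :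
    TensorProduct.map (wedgePow C n).mkQ LinearMap.id (Coalgebra.comul (R := K) x) = 0 := by
  cases n with
  | zero => rw [(Submodule.mem_bot K).1 hx, map_zero, map_zero]
  | succ n => exact wedge_right (fun x hx => hC.right hx) hx

theorem wedgePow_add {C : Submodule K E} (hC : IsSubcoalg C) (a b : ℕ) :
    wedgePow C (a + b) = wedge (wedgePow C a) (wedgePow C b) := by
  induction b with
  | zero => exact (wedge_bot fun x hx => wedgePow_right hC a hx).symm
  | succ b ih =>
    change wedge (wedgePow C (a + b)) C = wedge (wedgePow C a) (wedge (wedgePow C b) C)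
    rw [ih, wedge_assoc]

theorem wedgePow_left {C : Submodule K E} (hC : IsSubcoalg C) (n : ℕ) {x : E} (hx : x ∈ wedgePow C n) :
    TensorProduct.map LinearMap.id (wedgePow C n).mkQ (Coalgebra.comul (R := K) x) = 0 := by
  have h : x ∈ wedgePow C (0 + n) := by rwa [zero_add]
  rw [wedgePow_add hC, mem_wedge] at h
  have h6 := map_map_apply (g := (wedgePow C n).mkQ) (f := LinearMap.id (M := E))
    (g' := LinearMap.id) (f' := (⊥ : Submodule K E).mkQ) (Coalgebra.comul (R := K) x)
  rw [LinearMap.id_comp, LinearMap.comp_id] at h6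
  apply map_injective (f := (⊥ : Submodule K E).mkQ) (g := LinearMap.id)
    (LinearMap.ker_eq_bot.1 (Submodule.ker_mkQ _)) Function.injective_id
  rw [h6, map_zero]
  exact h

theorem wedgePow_one {C : Submodule K E} (hC : IsSubcoalg C) : wedgePow C 1 = C := by
  refine le_antisymm (fun x hx => ?_) (fun x hx => ?_)
  · have h9 := wedgePow_left hC 1 hx
    have hx' : TensorProduct.map (⊥ : Submodule K E).mkQ C.mkQ (Coalgebra.comul (R := K) x) = 0 :=
      hx
    have h6 := map_map_apply (g := C.mkQ) (f := LinearMap.id (M := E))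
      (g' := LinearMap.id) (f' := (⊥ : Submodule K E).mkQ) (Coalgebra.comul (R := K) x)
    rw [LinearMap.id_comp, LinearMap.comp_id, hx', map_eq_zero_iff _
      (map_injective (g := LinearMap.id) (LinearMap.ker_eq_bot.1 (Submodule.ker_mkQ _))
        Function.injective_id)] at h6
    have h7 := map_map_apply (g := C.mkQ) (f := LinearMap.id (M := E)) (g' := LinearMap.id)
      (f' := Coalgebra.counit (R := K)) (Coalgebra.comul (R := K) x)
    have h8 := map_map_apply (g := LinearMap.id) (f := Coalgebra.counit (R := K) (A := E))
      (g' := C.mkQ) (f' := LinearMap.id) (Coalgebra.comul (R := K) x)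
    have h9 := Coalgebra.rTensor_counit_comul (R := K) x
    simp only [LinearMap.rTensor] at h9
    simp only [LinearMap.id_comp, LinearMap.comp_id] at h7 h8
    rw [h6, map_zero, ← h8, h9, TensorProduct.map_tmul] at h7
    have h10 := congrArg (TensorProduct.lid K _) h7
    simpa using h10.symm
  · have h6 := map_map_apply (g := C.mkQ) (f := LinearMap.id (M := E))
      (g' := LinearMap.id) (f' := (⊥ : Submodule K E).mkQ) (Coalgebra.comul (R := K) x)
    rw [hC.left hx, map_zero, LinearMap.id_comp, LinearMap.comp_id] at h6
    exact h6.symm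

theorem wedgePow_le_succ {C : Submodule K E} (hC : IsSubcoalg C) (n : ℕ) : wedgePow C n ≤ wedgePow C (n + 1) := by
  intro x hx
  have h6 := map_map_apply (f := (wedgePow C n).mkQ) (g := LinearMap.id (M := E))
    (f' := LinearMap.id) (g' := C.mkQ) (Coalgebra.comul (R := K) x)
  rw [wedgePow_right hC n hx, map_zero, LinearMap.id_comp, LinearMap.comp_id] at h6
  exact h6.symm

theorem wedgePow_mono {C : Submodule K E} (hC : IsSubcoalg C) : Monotone (wedgePow C) :=
  monotone_nat_of_le_succ (wedgePow_le_succ hC)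

end Wedge

section AssociatedGraded

variable {K : Type v} [Field K] {E : Type u} [Ring E] [Bialgebra K E]

/-- The wedge powers `H^{∧_E n}` of a subbialgebra `H` of `E`. -/
noncomputable def Subbialgebra.wp (H : Subbialgebra K E) (n : ℕ) : Submodule K E :=
  wedgePow (Subalgebra.toSubmodule H.toSubalgebra) n

theorem Subbialgebra.isSubcoalg (H : Subbialgebra K E) :
    IsSubcoalg (Subalgebra.toSubmodule H.toSubalgebra) := H.comul_mem'

theorem Subbialgebra.wp_mono (H : Subbialgebra K E) : Monotone H.wp := wedgePow_mono H.isSubcoalg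

theorem Subbialgebra.wp_one (H : Subbialgebra K E) :
    H.wp 1 = Subalgebra.toSubmodule H.toSubalgebra := wedgePow_one H.isSubcoalg

theorem Subbialgebra.mem_wp_one (H : Subbialgebra K E) {x : E} :
    x ∈ H.wp 1 ↔ x ∈ H.toSubalgebra := by rw [H.wp_one]; rfl

theorem Subbialgebra.wp_add (H : Subbialgebra K E) (a b : ℕ) :
    H.wp (a + b) = wedge (H.wp a) (H.wp b) := wedgePow_add H.isSubcoalg a b

theorem map_mul_eq_zero_left {A B C : Submodule K E} (h : ∀ a ∈ A, ∀ b ∈ B, a * b ∈ C)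
    {V : Type*} [AddCommGroup V] [Module K V] (g : E →ₗ[K] V) {z w : E ⊗[K] E}
    (hz : z ∈ LinearMap.range (TensorProduct.map A.subtype (LinearMap.id (M := E))))
    (hw : w ∈ LinearMap.range (TensorProduct.map B.subtype (LinearMap.id (M := E)))) :
    TensorProduct.map C.mkQ g (z * w) = 0 := by
  obtain ⟨z, rfl⟩ := hz
  obtain ⟨w, rfl⟩ := hw
  induction z using TensorProduct.induction_on with
  | zero => simp
  | add z z' h1 h2 => simp [add_mul, h1, h2]
  | tmul a e =>
    induction w using TensorProduct.induction_on with
    | zero => simp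
    | add z z' h1 h2 => simp only [map_add, mul_add, h1, h2, add_zero]
    | tmul b f =>
      have : C.mkQ ((a : E) * b) = 0 := by
        simpa using h a a.2 b b.2
      simp [-Submodule.mkQ_apply, this]

theorem map_mul_eq_zero_right {A B C : Submodule K E} (h : ∀ a ∈ A, ∀ b ∈ B, a * b ∈ C)
    {V : Type*} [AddCommGroup V] [Module K V] (g : E →ₗ[K] V) {z w : E ⊗[K] E}
    (hz : z ∈ LinearMap.range (TensorProduct.map (LinearMap.id (M := E)) A.subtype))
    (hw : w ∈ LinearMap.range (TensorProduct.map (LinearMap.id (M := E)) B.subtype)) :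
    TensorProduct.map g C.mkQ (z * w) = 0 := by
  obtain ⟨z, rfl⟩ := hz
  obtain ⟨w, rfl⟩ := hw
  induction z using TensorProduct.induction_on with
  | zero => simp
  | add z z' h1 h2 => simp [add_mul, h1, h2]
  | tmul e a =>
    induction w using TensorProduct.induction_on with
    | zero => simp
    | add z z' h1 h2 => simp only [map_add, mul_add, h1, h2, add_zero]
    | tmul f b =>
      have : C.mkQ ((a : E) * b) = 0 := by
        simpa using h a a.2 b b.2
      simp [-Submodule.mkQ_apply, this]

theorem Subbialgebra.comul_mem_right (H : Subbialgebra K E) (n : ℕ) {x : E} (hx : x ∈ H.wp n) :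
    Coalgebra.comul (R := K) x ∈
      LinearMap.range (TensorProduct.map (H.wp n).subtype (LinearMap.id (M := E))) :=
  (Module.Flat.rTensor_exact E (LinearMap.exact_subtype_mkQ (H.wp n)) _).1
    (wedgePow_right H.isSubcoalg n hx)

/-- If `x ∈ H^{∧(a+1)}` then `Δ x ∈ H^{∧a} ⊗ E + H^{∧(a+1)} ⊗ H`. -/
theorem Subbialgebra.comul_decomp (H : Subbialgebra K E) (a : ℕ) {x : E}
    (hx : x ∈ H.wp (a + 1)) :
    ∃ u v, Coalgebra.comul (R := K) x = u + v ∧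
      u ∈ LinearMap.range (TensorProduct.map (H.wp a).subtype (LinearMap.id (M := E))) ∧
      v ∈ LinearMap.range (TensorProduct.map (H.wp (a + 1)).subtype (LinearMap.id (M := E))) ∧
      v ∈ LinearMap.range (TensorProduct.map (LinearMap.id (M := E))
        (Subalgebra.toSubmodule H.toSubalgebra).subtype) := by
  set S := H.wp (a + 1)
  set D := Subalgebra.toSubmodule H.toSubalgebra
  obtain ⟨y, hy⟩ := H.comul_mem_right _ hx
  have hle : H.wp a ≤ S := H.wp_mono (Nat.le_succ a)
  let i : H.wp a →ₗ[K] S := Submodule.inclusion hle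
  have hex : Function.Exact i ((H.wp a).mkQ ∘ₗ S.subtype) := by
    intro s
    simp only [LinearMap.comp_apply, Submodule.mkQ_apply, Submodule.Quotient.mk_eq_zero,
      Submodule.subtype_apply]
    exact ⟨fun h => ⟨⟨s, h⟩, rfl⟩, by rintro ⟨t, rfl⟩; exact t.2⟩
  have h0 : TensorProduct.map ((H.wp a).mkQ ∘ₗ S.subtype) LinearMap.id
      (TensorProduct.map LinearMap.id D.mkQ y) = 0 := by
    have h1 : TensorProduct.map (H.wp a).mkQ D.mkQ (Coalgebra.comul (R := K) x) = 0 := hx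
    rw [← hy, map_map_apply] at h1
    rw [map_map_apply]
    exact h1
  obtain ⟨w, hw⟩ := (Module.Flat.rTensor_exact (E ⧸ D) hex _).1 h0
  obtain ⟨w', rfl⟩ := LinearMap.lTensor_surjective (H.wp a) D.mkQ_surjective w
  have h2 : TensorProduct.map LinearMap.id D.mkQ (y - TensorProduct.map i LinearMap.id w') = 0 := by
    rw [map_sub, map_map_apply, sub_eq_zero, ← hw]
    simp only [LinearMap.rTensor, LinearMap.lTensor, map_map_apply, LinearMap.comp_id,
      LinearMap.id_comp]
  obtain ⟨t, ht⟩ := (Module.Flat.lTensor_exact S (LinearMap.exact_subtype_mkQ D) _).1 h2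
  refine ⟨TensorProduct.map (H.wp a).subtype LinearMap.id w',
    TensorProduct.map S.subtype LinearMap.id (y - TensorProduct.map i LinearMap.id w'),
    ?_, ⟨_, rfl⟩, ⟨_, rfl⟩, ?_⟩
  · rw [map_sub, map_map_apply, hy]
    have : S.subtype ∘ₗ i = (H.wp a).subtype := rfl
    rw [this, LinearMap.comp_id]; abel
  · rw [← ht, LinearMap.lTensor, map_map_apply]
    refine ⟨TensorProduct.map S.subtype LinearMap.id t, ?_⟩
    rw [map_map_apply]; rfl

theorem Subbialgebra.wp_mul_mem (H : Subbialgebra K E) : ∀ (n a b : ℕ), a + b = n →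
    ∀ x ∈ H.wp (a + 1), ∀ y ∈ H.wp (b + 1), x * y ∈ H.wp (a + b + 1) := by
  intro n
  induction n with
  | zero =>
    rintro a b h x hx y hy
    obtain ⟨rfl, rfl⟩ : a = 0 ∧ b = 0 := by omega
    rw [zero_add, H.mem_wp_one] at hx hy
    simp only [add_zero, zero_add]
    rw [H.mem_wp_one]
    exact mul_mem hx hy
  | succ n ih =>
    rintro a b h x hx y hy
    have h1 : ∀ s ∈ H.wp a, ∀ t ∈ H.wp (b + 1), s * t ∈ H.wp (a + b) := by
      cases a with
      | zero => intro s hs t _; rw [(Submodule.mem_bot K).1 hs, zero_mul]; exact zero_mem _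
      | succ a => intro s hs t ht; rw [Nat.add_right_comm]; exact ih a b (by omega) s hs t ht
    have h2 : ∀ s ∈ H.wp (a + 1), ∀ t ∈ H.wp b, s * t ∈ H.wp (a + b) := by
      cases b with
      | zero => intro s _ t ht; rw [(Submodule.mem_bot K).1 ht, mul_zero]; exact zero_mem _
      | succ b => intro s hs t ht; exact ih a b (by omega) s hs t ht
    obtain ⟨u, v, hx0, hu, hv, hv'⟩ := H.comul_decomp a hx
    obtain ⟨u', v', hy0, hu', hw, hw'⟩ := H.comul_decomp b hy
    have hy1 := H.comul_mem_right _ hy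
    change TensorProduct.map (H.wp (a + b)).mkQ (Subalgebra.toSubmodule H.toSubalgebra).mkQ
      (Coalgebra.comul (R := K) (x * y)) = 0
    rw [Bialgebra.comul_mul, hx0, add_mul]
    nth_rewrite 2 [hy0]
    rw [mul_add, map_add, map_add, map_mul_eq_zero_left h1 _ hu hy1,
      map_mul_eq_zero_left h2 _ hv hu', map_mul_eq_zero_right _ _ hv' hw']
    · simp
    · exact fun s hs t ht => mul_mem (S := Subalgebra K E) (s := H.toSubalgebra) hs ht

theorem Subbialgebra.mul_mem_wp (H : Subbialgebra K E) {a b : ℕ} {x y : E}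
    (hx : x ∈ H.wp (a + 1)) (hy : y ∈ H.wp (b + 1)) : x * y ∈ H.wp (a + b + 1) :=
  H.wp_mul_mem _ a b rfl x hx y hy

theorem Subbialgebra.mul_mem_wp_left (H : Subbialgebra K E) {a b : ℕ} {x y : E}
    (hx : x ∈ H.wp a) (hy : y ∈ H.wp (b + 1)) : x * y ∈ H.wp (a + b) := by
  cases a with
  | zero => rw [(Submodule.mem_bot K).1 hx, zero_mul]; exact zero_mem _
  | succ a => rw [Nat.add_right_comm]; exact H.mul_mem_wp hx hy

theorem Subbialgebra.mul_mem_wp_right (H : Subbialgebra K E) {a b : ℕ} {x y : E}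
    (hx : x ∈ H.wp (a + 1)) (hy : y ∈ H.wp b) : x * y ∈ H.wp (a + b) := by
  cases b with
  | zero => rw [(Submodule.mem_bot K).1 hy, mul_zero]; exact zero_mem _
  | succ b => exact H.mul_mem_wp hx hy

end AssociatedGraded

section Graded

variable {K : Type v} [Field K] {E : Type u} [Ring E] [Bialgebra K E]

/-- A graded algebra `⊕ A_n` is strongly `ℕ`-graded if all multiplications
`A_i ⊗ A_j → A_{i+j}` are surjective. -/
def IsStronglyGraded (K : Type*) [Field K] (A : ℕ → Type*) [∀ n, AddCommGroup (A n)]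
    [∀ n, Module K (A n)] [DirectSum.GSemiring A] [DirectSum.GAlgebra K A] : Prop :=
  ∀ i j : ℕ, Function.Surjective
    (TensorProduct.lift (DirectSum.gMulLHom K A : A i →ₗ[K] A j →ₗ[K] A (i + j)))

/-- `⊕_n H^{∧(n+1)}` is a graded algebra, with the multiplication of `E`. -/
instance Subbialgebra.wpGradedMonoid (H : Subbialgebra K E) : SetLike.GradedMonoid (fun n => H.wp (n + 1)) where
  one_mem := by rw [zero_add, H.mem_wp_one]; exact one_mem _
  mul_mem _ _ _ _ hx hy := H.mul_mem_wp hx hy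

/-- `gr^n_H E = H^{∧(n+1)} / H^{∧n}`. -/
abbrev Subbialgebra.gr (H : Subbialgebra K E) (n : ℕ) : Type u :=
  ↥(H.wp (n + 1)) ⧸ (H.wp n).submoduleOf (H.wp (n + 1))

/-- The class in `gr^n_H E` of an element of `H^{∧(n+1)}`. -/
noncomputable abbrev Subbialgebra.cls (H : Subbialgebra K E) (n : ℕ) :
    H.wp (n + 1) →ₗ[K] H.gr n := ((H.wp n).submoduleOf (H.wp (n + 1))).mkQ

theorem Subbialgebra.cls_eq_zero (H : Subbialgebra K E) {n : ℕ} {x : H.wp (n + 1)} :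
    H.cls n x = 0 ↔ (x : E) ∈ H.wp n := by
  rw [Submodule.mkQ_apply, Submodule.Quotient.mk_eq_zero]; rfl

/-- The multiplication `gr^a ⊗ gr^b → gr^{a+b}`, `[x] ⊗ [y] ↦ [x y]`. -/
noncomputable def Subbialgebra.grMul (H : Subbialgebra K E) (a b : ℕ) :
    H.gr a →ₗ[K] H.gr b →ₗ[K] H.gr (a + b) :=
  LinearMap.liftQ₂ _ _
    (LinearMap.mk₂ K (fun (x : H.wp (a + 1)) (y : H.wp (b + 1)) =>
        H.cls (a + b) ⟨(x : E) * y, H.mul_mem_wp x.2 y.2⟩)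
      (fun x x' y => by rw [← map_add]; congr 1; ext; simp [add_mul])
      (fun c x y => by rw [← map_smul]; congr 1; ext; simp)
      (fun x y y' => by rw [← map_add]; congr 1; ext; simp [mul_add])
      (fun c x y => by rw [← map_smul]; congr 1; ext; simp))
    (fun x hx => by
      ext y
      exact H.cls_eq_zero.2 (H.mul_mem_wp_left hx y.2))
    (fun y hy => by
      ext x
      exact H.cls_eq_zero.2 (H.mul_mem_wp_right x.2 hy))

@[simp]
theorem Subbialgebra.grMul_cls (H : Subbialgebra K E) (a b : ℕ) (x : H.wp (a + 1))
    (y : H.wp (b + 1)) : H.grMul a b (H.cls a x) (H.cls b y) =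
      H.cls (a + b) ⟨(x : E) * y, H.mul_mem_wp x.2 y.2⟩ := rfl

theorem Subbialgebra.gr_ext (H : Subbialgebra K E) {n m : ℕ} (h : n = m) (x : H.wp (n + 1))
    (y : H.wp (m + 1)) (hxy : (x : E) = y) :
    (GradedMonoid.mk n (H.cls n x) : GradedMonoid H.gr) = GradedMonoid.mk m (H.cls m y) := by
  subst h
  obtain rfl : x = y := Subtype.ext hxy
  rfl

theorem Subbialgebra.algebraMap_mem (H : Subbialgebra K E) (r : K) :
    algebraMap K E r ∈ H.wp (0 + 1) := by
  rw [zero_add, H.mem_wp_one]; exact H.toSubalgebra.algebraMap_mem r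

theorem Subbialgebra.one_mem_wp (H : Subbialgebra K E) : (1 : E) ∈ H.wp (0 + 1) := by
  rw [zero_add, H.mem_wp_one]; exact one_mem _

noncomputable instance Subbialgebra.grGMul (H : Subbialgebra K E) : GradedMonoid.GMul H.gr where
  mul {i j} a b := H.grMul i j a b

noncomputable instance Subbialgebra.grGOne (H : Subbialgebra K E) : GradedMonoid.GOne H.gr where
  one := H.cls 0 ⟨1, H.one_mem_wp⟩

noncomputable instance Subbialgebra.grGSemiring (H : Subbialgebra K E) : DirectSum.GSemiring H.gr where
  mul_zero a := map_zero _
  zero_mul {i j} b := LinearMap.map_zero₂ (H.grMul i j) b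
  mul_add a b c := map_add _ _ _
  add_mul {i j} a b c := LinearMap.map_add₂ (H.grMul i j) a b c
  one_mul := by
    rintro ⟨n, a⟩
    obtain ⟨x, rfl⟩ := Submodule.mkQ_surjective _ a
    exact H.gr_ext (zero_add n) _ _ (one_mul _)
  mul_one := by
    rintro ⟨n, a⟩
    obtain ⟨x, rfl⟩ := Submodule.mkQ_surjective _ a
    exact H.gr_ext (add_zero n) _ _ (mul_one _)
  mul_assoc := by
    rintro ⟨n, a⟩ ⟨m, b⟩ ⟨l, c⟩
    obtain ⟨x, rfl⟩ := Submodule.mkQ_surjective _ a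
    obtain ⟨y, rfl⟩ := Submodule.mkQ_surjective _ b
    obtain ⟨z, rfl⟩ := Submodule.mkQ_surjective _ c
    exact H.gr_ext (add_assoc n m l) _ _ (mul_assoc _ _ _)
  natCast n := n • H.cls 0 ⟨1, H.one_mem_wp⟩
  natCast_zero := zero_smul _ _
  natCast_succ n := succ_nsmul _ n

noncomputable instance Subbialgebra.grGAlgebra (H : Subbialgebra K E) : DirectSum.GAlgebra K H.gr where
  toFun := (H.cls 0 ∘ₗ (Algebra.linearMap K E).codRestrict _ H.algebraMap_mem).toAddMonoidHom
  map_one := congrArg (H.cls 0) (Subtype.ext (map_one (algebraMap K E)))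
  map_mul r s := H.gr_ext rfl _ _ (map_mul (algebraMap K E) r s)
  commutes := by
    rintro r ⟨n, a⟩
    obtain ⟨x, rfl⟩ := Submodule.mkQ_surjective _ a
    exact H.gr_ext (Nat.add_comm 0 n) _ _ (Algebra.commutes r (x : E))
  smul_def := by
    rintro r ⟨n, a⟩
    obtain ⟨x, rfl⟩ := Submodule.mkQ_surjective _ a
    exact H.gr_ext (zero_add n).symm (r • x) _ (Algebra.smul_def r (x : E))

/-- The inclusion `gr^n = H^{∧(n+1)} / H^{∧n} → E / H^{∧n}`. -/
noncomputable def Subbialgebra.grIncl (H : Subbialgebra K E) (n : ℕ) :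
    H.gr n →ₗ[K] E ⧸ H.wp n :=
  Submodule.mapQ _ _ (H.wp (n + 1)).subtype le_rfl

@[simp]
theorem Subbialgebra.grIncl_cls (H : Subbialgebra K E) (n : ℕ) (x : H.wp (n + 1)) :
    H.grIncl n (H.cls n x) = (H.wp n).mkQ x := rfl

theorem Subbialgebra.grIncl_injective (H : Subbialgebra K E) (n : ℕ) :
    Function.Injective (H.grIncl n) := by
  rw [injective_iff_map_eq_zero]
  intro a ha
  obtain ⟨x, rfl⟩ := Submodule.mkQ_surjective _ a
  rw [H.grIncl_cls, Submodule.mkQ_apply, Submodule.Quotient.mk_eq_zero] at ha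
  exact H.cls_eq_zero.2 ha

theorem Subbialgebra.grIncl_exact (H : Subbialgebra K E) (n : ℕ) :
    Function.Exact (H.grIncl n)
      (Submodule.factor (H.wp_mono (Nat.le_succ n)) : E ⧸ H.wp n →ₗ[K] E ⧸ H.wp (n + 1)) := by
  intro q
  obtain ⟨x, rfl⟩ := Submodule.mkQ_surjective _ q
  change (Submodule.Quotient.mk x : E ⧸ H.wp (n + 1)) = 0 ↔ _
  rw [Submodule.Quotient.mk_eq_zero]
  constructor
  · intro hx
    exact ⟨H.cls n ⟨x, hx⟩, rfl⟩
  · rintro ⟨a, ha⟩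
    obtain ⟨y, rfl⟩ := Submodule.mkQ_surjective _ a
    rw [H.grIncl_cls] at ha
    have h := (Submodule.Quotient.eq _).1 ha
    have := sub_mem y.2 (H.wp_mono (Nat.le_succ n) h)
    simpa using this

theorem Subbialgebra.comul_mem_gr (H : Subbialgebra K E) {n a b : ℕ} (h : a + b = n)
    (x : H.wp (n + 1)) :
    TensorProduct.map (H.wp a).mkQ (H.wp b).mkQ (Coalgebra.comul (R := K) (x : E)) ∈
      LinearMap.range (TensorProduct.map (H.grIncl a) (H.grIncl b)) := by
  subst h
  refine mem_range_map (H.grIncl_exact a) (H.grIncl_exact b) (H.grIncl_injective b) ?_ ?_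
  · rw [map_map_apply]
    have hx : (x : E) ∈ H.wp (a + 1 + b) := by rw [Nat.add_right_comm]; exact x.2
    rw [H.wp_add] at hx
    exact hx
  · rw [map_map_apply]
    have hx : (x : E) ∈ H.wp (a + (b + 1)) := x.2
    rw [H.wp_add] at hx
    exact hx

/-- The component `Δ_{a,b} : gr^{a+b} → gr^a ⊗ gr^b` of the comultiplication of `gr_H E`: the
unique map whose composite with `gr^a ⊗ gr^b → E/H^{∧a} ⊗ E/H^{∧b}` is induced by the
comultiplication of `E`. -/
noncomputable def Subbialgebra.grComul (H : Subbialgebra K E) (n a b : ℕ) (h : a + b = n) :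
    H.gr n →ₗ[K] H.gr a ⊗[K] H.gr b :=
  Submodule.liftQ _
    (factor (TensorProduct.map (H.grIncl a) (H.grIncl b))
      (map_injective (H.grIncl_injective a) (H.grIncl_injective b))
      (TensorProduct.map (H.wp a).mkQ (H.wp b).mkQ ∘ₗ Coalgebra.comul ∘ₗ (H.wp (n + 1)).subtype)
      (fun x => H.comul_mem_gr h x))
    (fun x hx => by
      apply map_injective (H.grIncl_injective a) (H.grIncl_injective b)
      refine (factor_spec _ _ _ (fun x => H.comul_mem_gr h x) _).trans ?_
      rw [map_zero]
      have hx' : (x : E) ∈ wedge (H.wp a) (H.wp b) := by rw [← H.wp_add, h]; exact hx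
      exact hx')

theorem Subbialgebra.grComul_spec (H : Subbialgebra K E) (n a b : ℕ) (h : a + b = n)
    (x : H.wp (n + 1)) :
    TensorProduct.map (H.grIncl a) (H.grIncl b) (H.grComul n a b h (H.cls n x)) =
      TensorProduct.map (H.wp a).mkQ (H.wp b).mkQ (Coalgebra.comul (R := K) (x : E)) :=
  factor_spec _ (map_injective (H.grIncl_injective a) (H.grIncl_injective b)) _
    (fun x => H.comul_mem_gr h x) x

/-- The counit of `gr_H E`: the counit of `H` on `gr^0 = H`, and zero in positive degrees. -/
noncomputable def Subbialgebra.grCounit (H : Subbialgebra K E) : (n : ℕ) → H.gr n →ₗ[K] K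
  | 0 => Submodule.liftQ _ (Coalgebra.counit ∘ₗ (H.wp (0 + 1)).subtype) (fun x hx => by
      have hx' : (x : E) = 0 := hx
      simp [hx'])
  | _ + 1 => 0

/-- The associated graded `gr_H E = ⊕_n H^{∧(n+1)} / H^{∧n}`; it is an algebra as the direct sum
of a graded algebra. -/
abbrev Subbialgebra.Gr (H : Subbialgebra K E) : Type u := ⨁ n, H.gr n

noncomputable instance Subbialgebra.grCoalgebraStruct (H : Subbialgebra K E) : CoalgebraStruct K H.Gr where
  comul := DirectSum.toModule K ℕ _ fun n => ∑ p : Finset.HasAntidiagonal.antidiagonal n,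
    TensorProduct.map (DirectSum.lof K ℕ H.gr p.1.1) (DirectSum.lof K ℕ H.gr p.1.2) ∘ₗ
      H.grComul n p.1.1 p.1.2 (Finset.HasAntidiagonal.mem_antidiagonal.1 p.2)
  counit := DirectSum.toModule K ℕ _ H.grCounit

end Graded

/-- A Hopf bimodule over a bialgebra `H`: an `H`-bimodule and `H`-bicomodule `M` whose two
coactions are morphisms of `H`-bimodules, for the diagonal actions on `H ⊗ M` and `M ⊗ H`. -/
structure HopfBimodule (K : Type*) [Field K] (H : Type*) [Ring H] [Bialgebra K H]
    (M : Type*) [AddCommGroup M] [Module K M] where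
  /-- the left action -/
  lact : H →ₗ[K] M →ₗ[K] M
  /-- the right action -/
  ract : M →ₗ[K] H →ₗ[K] M
  /-- the left coaction -/
  lcoact : M →ₗ[K] H ⊗[K] M
  /-- the right coaction -/
  rcoact : M →ₗ[K] M ⊗[K] H
  one_lact : ∀ m, lact 1 m = m
  mul_lact : ∀ h k m, lact (h * k) m = lact h (lact k m)
  ract_one : ∀ m, ract m 1 = m
  ract_mul : ∀ m h k, ract m (h * k) = ract (ract m h) k
  lact_ract : ∀ h m k, ract (lact h m) k = lact h (ract m k)
  lcoassoc : ∀ m, TensorProduct.assoc K H H M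
    (TensorProduct.map Coalgebra.comul LinearMap.id (lcoact m)) =
      TensorProduct.map LinearMap.id lcoact (lcoact m)
  lcounit : ∀ m, TensorProduct.lid K M
    (TensorProduct.map Coalgebra.counit LinearMap.id (lcoact m)) = m
  rcoassoc : ∀ m, TensorProduct.assoc K M H H
    (TensorProduct.map rcoact LinearMap.id (rcoact m)) =
      TensorProduct.map LinearMap.id Coalgebra.comul (rcoact m)
  rcounit : ∀ m, TensorProduct.rid K M
    (TensorProduct.map LinearMap.id Coalgebra.counit (rcoact m)) = m
  bicoassoc : ∀ m, TensorProduct.assoc K H M H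
    (TensorProduct.map lcoact LinearMap.id (rcoact m)) =
      TensorProduct.map LinearMap.id rcoact (lcoact m)
  lcoact_lact : ∀ h m, lcoact (lact h m) =
    TensorProduct.map₂ (LinearMap.mul K H) lact (Coalgebra.comul h) (lcoact m)
  lcoact_ract : ∀ m h, lcoact (ract m h) =
    TensorProduct.map₂ (LinearMap.mul K H) ract (lcoact m) (Coalgebra.comul h)
  rcoact_lact : ∀ h m, rcoact (lact h m) =
    TensorProduct.map₂ lact (LinearMap.mul K H) (Coalgebra.comul h) (rcoact m)
  rcoact_ract : ∀ m h, rcoact (ract m h) =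
    TensorProduct.map₂ ract (LinearMap.mul K H) (rcoact m) (Coalgebra.comul h)

section GrOne

variable {K : Type v} [Field K] {E : Type u} [Ring E] [Bialgebra K E]

/-- The inclusion of `H` as a linear map. -/
abbrev Subbialgebra.incl (H : Subbialgebra K E) : H.toSubalgebra →ₗ[K] E :=
  H.toSubalgebra.val.toLinearMap

theorem Subbialgebra.incl_injective (H : Subbialgebra K E) : Function.Injective H.incl :=
  Subtype.val_injective

theorem Subbialgebra.incl_exact (H : Subbialgebra K E) :
    Function.Exact H.incl (H.wp 1).mkQ := by
  intro x
  rw [Submodule.mkQ_apply, Submodule.Quotient.mk_eq_zero, H.mem_wp_one]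
  exact ⟨fun h => ⟨⟨x, h⟩, rfl⟩, by rintro ⟨y, rfl⟩; exact y.2⟩

/-- The left coaction of `E` on `E / H`. -/
noncomputable def Subbialgebra.lcoQ (H : Subbialgebra K E) :
    E ⧸ H.wp 1 →ₗ[K] E ⊗[K] (E ⧸ H.wp 1) :=
  Submodule.liftQ _ (TensorProduct.map LinearMap.id (H.wp 1).mkQ ∘ₗ Coalgebra.comul)
    (fun _ hx => wedgePow_left H.isSubcoalg 1 hx)

/-- The right coaction of `E` on `E / H`. -/
noncomputable def Subbialgebra.rcoQ (H : Subbialgebra K E) :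
    E ⧸ H.wp 1 →ₗ[K] (E ⧸ H.wp 1) ⊗[K] E :=
  Submodule.liftQ _ (TensorProduct.map (H.wp 1).mkQ LinearMap.id ∘ₗ Coalgebra.comul)
    (fun _ hx => wedgePow_right H.isSubcoalg 1 hx)

theorem Subbialgebra.lcoQ_mem (H : Subbialgebra K E) (m : H.gr 1) :
    H.lcoQ (H.grIncl 1 m) ∈ LinearMap.range (TensorProduct.map H.incl (H.grIncl 1)) := by
  obtain ⟨x, rfl⟩ := Submodule.mkQ_surjective _ m
  refine mem_range_map H.incl_exact (H.grIncl_exact 1) (H.grIncl_injective 1) ?_ ?_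
  · change TensorProduct.map _ _ (TensorProduct.map _ _ _) = 0
    rw [map_map_apply]
    have hx : (x : E) ∈ wedge (H.wp 1) (H.wp 1) := by rw [← H.wp_add]; exact x.2
    exact hx
  · change TensorProduct.map _ _ (TensorProduct.map _ _ _) = 0
    rw [map_map_apply]
    exact wedgePow_left H.isSubcoalg _ x.2

theorem Subbialgebra.rcoQ_mem (H : Subbialgebra K E) (m : H.gr 1) :
    H.rcoQ (H.grIncl 1 m) ∈ LinearMap.range (TensorProduct.map (H.grIncl 1) H.incl) := by
  obtain ⟨x, rfl⟩ := Submodule.mkQ_surjective _ m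
  refine mem_range_map (H.grIncl_exact 1) H.incl_exact H.incl_injective ?_ ?_
  · change TensorProduct.map _ _ (TensorProduct.map _ _ _) = 0
    rw [map_map_apply]
    exact wedgePow_right H.isSubcoalg _ x.2
  · change TensorProduct.map _ _ (TensorProduct.map _ _ _) = 0
    rw [map_map_apply]
    have hx : (x : E) ∈ wedge (H.wp 1) (H.wp 1) := by rw [← H.wp_add]; exact x.2
    exact hx

/-- The left coaction `(H ∧ H)/H → H ⊗ (H ∧ H)/H`, induced by the comultiplication of `E`. -/
noncomputable def Subbialgebra.grLco (H : Subbialgebra K E) :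
    H.gr 1 →ₗ[K] H.toSubalgebra ⊗[K] H.gr 1 :=
  factor (TensorProduct.map H.incl (H.grIncl 1))
    (map_injective H.incl_injective (H.grIncl_injective 1)) (H.lcoQ ∘ₗ H.grIncl 1)
    (fun m => H.lcoQ_mem m)

/-- The right coaction `(H ∧ H)/H → (H ∧ H)/H ⊗ H`, induced by the comultiplication of `E`. -/
noncomputable def Subbialgebra.grRco (H : Subbialgebra K E) :
    H.gr 1 →ₗ[K] H.gr 1 ⊗[K] H.toSubalgebra :=
  factor (TensorProduct.map (H.grIncl 1) H.incl)
    (map_injective (H.grIncl_injective 1) H.incl_injective) (H.rcoQ ∘ₗ H.grIncl 1)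
    (fun m => H.rcoQ_mem m)

theorem Subbialgebra.grLco_spec (H : Subbialgebra K E) (m : H.gr 1) :
    TensorProduct.map H.incl (H.grIncl 1) (H.grLco m) = H.lcoQ (H.grIncl 1 m) :=
  factor_spec _ (map_injective H.incl_injective (H.grIncl_injective 1)) _
    (fun m => H.lcoQ_mem m) m

theorem Subbialgebra.grRco_spec (H : Subbialgebra K E) (m : H.gr 1) :
    TensorProduct.map (H.grIncl 1) H.incl (H.grRco m) = H.rcoQ (H.grIncl 1 m) :=
  factor_spec _ (map_injective (H.grIncl_injective 1) H.incl_injective) _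
    (fun m => H.rcoQ_mem m) m

theorem Subbialgebra.mul_mem_left (H : Subbialgebra K E) (h : H.toSubalgebra) {n : ℕ} {x : E}
    (hx : x ∈ H.wp (n + 1)) : (h : E) * x ∈ H.wp (n + 1) := by
  have hh : (h : E) ∈ H.wp (0 + 1) := by rw [zero_add, H.mem_wp_one]; exact h.2
  have := H.mul_mem_wp hh hx
  rwa [zero_add] at this

theorem Subbialgebra.mul_mem_right (H : Subbialgebra K E) (h : H.toSubalgebra) {n : ℕ} {x : E}
    (hx : x ∈ H.wp (n + 1)) : x * (h : E) ∈ H.wp (n + 1) := by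
  have hh : (h : E) ∈ H.wp (0 + 1) := by rw [zero_add, H.mem_wp_one]; exact h.2
  have := H.mul_mem_wp hx hh
  rwa [add_zero] at this

/-- The left action `h · [x] = [h x]` of `H` on `(H ∧ H)/H`. -/
noncomputable def Subbialgebra.grLact (H : Subbialgebra K E) :
    H.toSubalgebra →ₗ[K] H.gr 1 →ₗ[K] H.gr 1 :=
  LinearMap.flip (Submodule.liftQ _
    (LinearMap.mk₂ K (fun (x : H.wp (1 + 1)) (h : H.toSubalgebra) =>
        H.cls 1 ⟨(h : E) * x, H.mul_mem_left h x.2⟩)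
      (fun x y h => by rw [← map_add]; congr 1; ext; simp [mul_add])
      (fun c x h => by rw [← map_smul]; congr 1; ext; simp)
      (fun x h k => by rw [← map_add]; congr 1; ext; simp [add_mul])
      (fun c x h => by rw [← map_smul]; congr 1; ext; simp))
    (fun x hx => by
      ext h
      exact H.cls_eq_zero.2 (H.mul_mem_left (n := 0) h hx)))

/-- The right action `[x] · h = [x h]` of `H` on `(H ∧ H)/H`. -/
noncomputable def Subbialgebra.grRact (H : Subbialgebra K E) :
    H.gr 1 →ₗ[K] H.toSubalgebra →ₗ[K] H.gr 1 :=
  Submodule.liftQ _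
    (LinearMap.mk₂ K (fun (x : H.wp (1 + 1)) (h : H.toSubalgebra) =>
        H.cls 1 ⟨(x : E) * h, H.mul_mem_right h x.2⟩)
      (fun x y h => by rw [← map_add]; congr 1; ext; simp [add_mul])
      (fun c x h => by rw [← map_smul]; congr 1; ext; simp)
      (fun x h k => by rw [← map_add]; congr 1; ext; simp [mul_add])
      (fun c x h => by rw [← map_smul]; congr 1; ext; simp))
    (fun x hx => by
      ext h
      exact H.cls_eq_zero.2 (H.mul_mem_right (n := 0) h hx))

@[simp]
theorem Subbialgebra.grLact_cls (H : Subbialgebra K E) (h : H.toSubalgebra) (x : H.wp (1 + 1)) :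
    H.grLact h (H.cls 1 x) = H.cls 1 ⟨(h : E) * x, H.mul_mem_left h x.2⟩ := rfl

@[simp]
theorem Subbialgebra.grRact_cls (H : Subbialgebra K E) (h : H.toSubalgebra) (x : H.wp (1 + 1)) :
    H.grRact (H.cls 1 x) h = H.cls 1 ⟨(x : E) * h, H.mul_mem_right h x.2⟩ := rfl

/-- Left multiplication by an element of `H` on `E / H`. -/
noncomputable def Subbialgebra.lmulQ (H : Subbialgebra K E) (h : H.toSubalgebra) :
    E ⧸ H.wp 1 →ₗ[K] E ⧸ H.wp 1 :=
  Submodule.mapQ _ _ (LinearMap.mulLeft K (h : E)) (fun _ hx => H.mul_mem_left (n := 0) h hx)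

/-- Right multiplication by an element of `H` on `E / H`. -/
noncomputable def Subbialgebra.rmulQ (H : Subbialgebra K E) (h : H.toSubalgebra) :
    E ⧸ H.wp 1 →ₗ[K] E ⧸ H.wp 1 :=
  Submodule.mapQ _ _ (LinearMap.mulRight K (h : E)) (fun _ hx => H.mul_mem_right (n := 0) h hx)

theorem Subbialgebra.grIncl_lact (H : Subbialgebra K E) (h : H.toSubalgebra) :
    H.grIncl 1 ∘ₗ H.grLact h = H.lmulQ h ∘ₗ H.grIncl 1 := by
  ext x; rfl

theorem Subbialgebra.grIncl_ract (H : Subbialgebra K E) (h : H.toSubalgebra) :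
    H.grIncl 1 ∘ₗ H.grRact.flip h = H.rmulQ h ∘ₗ H.grIncl 1 := by
  ext x; rfl

theorem map₂_tmul_left {A B C A' B' C' : Type*} [AddCommGroup A] [Module K A]
    [AddCommGroup B] [Module K B] [AddCommGroup C] [Module K C] [AddCommGroup A'] [Module K A']
    [AddCommGroup B'] [Module K B'] [AddCommGroup C'] [Module K C']
    (f : A →ₗ[K] B →ₗ[K] C) (g : A' →ₗ[K] B' →ₗ[K] C') (a : A) (a' : A') :
    TensorProduct.map₂ f g (a ⊗ₜ a') = TensorProduct.map (f a) (g a') := by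
  ext; simp

theorem map₂_tmul_right {A B C A' B' C' : Type*} [AddCommGroup A] [Module K A]
    [AddCommGroup B] [Module K B] [AddCommGroup C] [Module K C] [AddCommGroup A'] [Module K A']
    [AddCommGroup B'] [Module K B'] [AddCommGroup C'] [Module K C']
    (f : A →ₗ[K] B →ₗ[K] C) (g : A' →ₗ[K] B' →ₗ[K] C') (b : B) (b' : B') (t : A ⊗[K] A') :
    TensorProduct.map₂ f g t (b ⊗ₜ b') = TensorProduct.map (f.flip b) (g.flip b') t := by
  induction t using TensorProduct.induction_on with
  | zero => simp
  | add x y hx hy => simp [hx, hy]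
  | tmul a a' => simp

theorem tmul_mul_eq (a b : E) (z : E ⊗[K] E) :
    (a ⊗ₜ[K] b) * z = TensorProduct.map (LinearMap.mulLeft K a) (LinearMap.mulLeft K b) z := by
  induction z using TensorProduct.induction_on with
  | zero => simp
  | add x y hx hy => rw [mul_add, hx, hy, map_add]
  | tmul x y => simp

theorem mul_tmul_eq (a b : E) (z : E ⊗[K] E) :
    z * (a ⊗ₜ[K] b) = TensorProduct.map (LinearMap.mulRight K a) (LinearMap.mulRight K b) z := by
  induction z using TensorProduct.induction_on with
  | zero => simp
  | add x y hx hy => rw [add_mul, hx, hy, map_add]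
  | tmul x y => simp

theorem map₂_flip {A B C A' B' C' : Type*} [AddCommGroup A] [Module K A]
    [AddCommGroup B] [Module K B] [AddCommGroup C] [Module K C] [AddCommGroup A'] [Module K A']
    [AddCommGroup B'] [Module K B'] [AddCommGroup C'] [Module K C']
    (f : A →ₗ[K] B →ₗ[K] C) (g : A' →ₗ[K] B' →ₗ[K] C') (t : A ⊗[K] A') (s : B ⊗[K] B') :
    TensorProduct.map₂ f.flip g.flip s t = TensorProduct.map₂ f g t s := by
  induction s using TensorProduct.induction_on with
  | zero => simp
  | add x y hx hy => simp only [map_add, LinearMap.add_apply, hx, hy]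
  | tmul x y => rw [map₂_tmul_left, map₂_tmul_right]

/-- Compatibility of diagonal actions along linear maps `i`, `j`. -/
theorem map_map₂ {A A' B B' V V' Q Q' : Type*} [AddCommGroup A] [Module K A]
    [AddCommGroup A'] [Module K A'] [AddCommGroup B] [Module K B] [AddCommGroup B'] [Module K B']
    [AddCommGroup Q] [Module K Q] [AddCommGroup Q'] [Module K Q']
    [AddCommGroup V] [Module K V] [AddCommGroup V'] [Module K V']
    (f : A →ₗ[K] B →ₗ[K] B) (f' : A' →ₗ[K] B' →ₗ[K] B') (i : B →ₗ[K] Q) (j : B' →ₗ[K] Q')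
    (p : V →ₗ[K] Q) (q : V' →ₗ[K] Q')
    (F : A →ₗ[K] V →ₗ[K] V) (F' : A' →ₗ[K] V' →ₗ[K] V')
    (G : A → Q →ₗ[K] Q) (G' : A' → Q' →ₗ[K] Q')
    (h1 : ∀ a, i ∘ₗ f a = G a ∘ₗ i) (h2 : ∀ a, j ∘ₗ f' a = G' a ∘ₗ j)
    (h3 : ∀ a, G a ∘ₗ p = p ∘ₗ F a) (h4 : ∀ a, G' a ∘ₗ q = q ∘ₗ F' a)
    (t : A ⊗[K] A') (w : B ⊗[K] B') (z : V ⊗[K] V')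
    (hw : TensorProduct.map i j w = TensorProduct.map p q z) :
    TensorProduct.map i j (TensorProduct.map₂ f f' t w) =
      TensorProduct.map p q (TensorProduct.map₂ F F' t z) := by
  induction t using TensorProduct.induction_on with
  | zero => simp
  | add x y hx hy => simp only [map_add, LinearMap.add_apply, hx, hy]
  | tmul a b =>
    rw [map₂_tmul_left, map₂_tmul_left, map_map_apply, map_map_apply, h1, h2, ← h3, ← h4,
      ← map_map_apply, hw, map_map_apply]

theorem map₂_mul_left (H : Subbialgebra K E) (t : H.toSubalgebra ⊗[K] H.toSubalgebra)
    (z : E ⊗[K] E) : TensorProduct.map₂ ((LinearMap.mul K E) ∘ₗ H.incl)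
      ((LinearMap.mul K E) ∘ₗ H.incl) t z = TensorProduct.map H.incl H.incl t * z := by
  induction t using TensorProduct.induction_on with
  | zero => simp
  | add x y hx hy => simp only [map_add, LinearMap.add_apply, hx, hy, add_mul]
  | tmul a b => rw [map₂_tmul_left, TensorProduct.map_tmul, tmul_mul_eq]; rfl

theorem map₂_mul_right (H : Subbialgebra K E) (t : H.toSubalgebra ⊗[K] H.toSubalgebra)
    (z : E ⊗[K] E) : TensorProduct.map₂ ((LinearMap.mul K E).flip ∘ₗ H.incl)
      ((LinearMap.mul K E).flip ∘ₗ H.incl) t z = z * TensorProduct.map H.incl H.incl t := by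
  induction t using TensorProduct.induction_on with
  | zero => simp
  | add x y hx hy => simp only [map_add, LinearMap.add_apply, hx, hy, mul_add]
  | tmul a b => rw [map₂_tmul_left, TensorProduct.map_tmul, mul_tmul_eq]; rfl

theorem Subbialgebra.lcoQ_comp_mkQ (H : Subbialgebra K E) :
    H.lcoQ ∘ₗ (H.wp 1).mkQ = TensorProduct.map LinearMap.id (H.wp 1).mkQ ∘ₗ Coalgebra.comul :=
  rfl

theorem Subbialgebra.rcoQ_comp_mkQ (H : Subbialgebra K E) :
    H.rcoQ ∘ₗ (H.wp 1).mkQ = TensorProduct.map (H.wp 1).mkQ LinearMap.id ∘ₗ Coalgebra.comul :=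
  rfl

theorem Subbialgebra.grLco_cls (H : Subbialgebra K E) (x : H.wp (1 + 1)) :
    TensorProduct.map H.incl (H.grIncl 1) (H.grLco (H.cls 1 x)) =
      TensorProduct.map LinearMap.id (H.wp 1).mkQ (Coalgebra.comul (R := K) (x : E)) :=
  H.grLco_spec _

theorem Subbialgebra.grRco_cls (H : Subbialgebra K E) (x : H.wp (1 + 1)) :
    TensorProduct.map (H.grIncl 1) H.incl (H.grRco (H.cls 1 x)) =
      TensorProduct.map (H.wp 1).mkQ LinearMap.id (Coalgebra.comul (R := K) (x : E)) :=
  H.grRco_spec _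

theorem Subbialgebra.incl_lmul (H : Subbialgebra K E) (h : H.toSubalgebra) :
    H.incl ∘ₗ (LinearMap.mul K H.toSubalgebra) h =
      ((LinearMap.mul K E) ∘ₗ H.incl) h ∘ₗ H.incl := rfl

theorem Subbialgebra.incl_rmul (H : Subbialgebra K E) (h : H.toSubalgebra) :
    H.incl ∘ₗ (LinearMap.mul K H.toSubalgebra).flip h =
      ((LinearMap.mul K E).flip ∘ₗ H.incl) h ∘ₗ H.incl := rfl

theorem map_assoc {A B C A' B' C' : Type*} [AddCommGroup A] [Module K A]
    [AddCommGroup B] [Module K B] [AddCommGroup C] [Module K C] [AddCommGroup A'] [Module K A']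
    [AddCommGroup B'] [Module K B'] [AddCommGroup C'] [Module K C']
    (f : A →ₗ[K] A') (g : B →ₗ[K] B') (h : C →ₗ[K] C') (z : (A ⊗[K] B) ⊗[K] C) :
    TensorProduct.map f (TensorProduct.map g h) (TensorProduct.assoc K A B C z) =
      TensorProduct.assoc K A' B' C' (TensorProduct.map (TensorProduct.map f g) h z) :=
  LinearMap.congr_fun (TensorProduct.map_map_comp_assoc_eq f g h) z

theorem map_comp_left {A A' A'' B B' : Type*} [AddCommGroup A] [Module K A]
    [AddCommGroup A'] [Module K A'] [AddCommGroup A''] [Module K A''] [AddCommGroup B] [Module K B]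
    [AddCommGroup B'] [Module K B'] (f : A →ₗ[K] A') (f' : A' →ₗ[K] A'') (g : B →ₗ[K] B')
    (z : A ⊗[K] B) : TensorProduct.map (f' ∘ₗ f) g z =
      TensorProduct.map f' LinearMap.id (TensorProduct.map f g z) := by
  rw [map_map_apply, LinearMap.id_comp]

theorem map_comp_right {A A' B B' B'' : Type*} [AddCommGroup A] [Module K A]
    [AddCommGroup A'] [Module K A'] [AddCommGroup B''] [Module K B''] [AddCommGroup B] [Module K B]
    [AddCommGroup B'] [Module K B'] (f : A →ₗ[K] A') (g : B →ₗ[K] B') (g' : B' →ₗ[K] B'')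
    (z : A ⊗[K] B) : TensorProduct.map f (g' ∘ₗ g) z =
      TensorProduct.map LinearMap.id g' (TensorProduct.map f g z) := by
  rw [map_map_apply, LinearMap.id_comp]

theorem map_comp_left' {A A' A'' B B' : Type*} [AddCommGroup A] [Module K A]
    [AddCommGroup A'] [Module K A'] [AddCommGroup A''] [Module K A''] [AddCommGroup B] [Module K B]
    [AddCommGroup B'] [Module K B'] (f : A →ₗ[K] A') (f' : A' →ₗ[K] A'') (g : B →ₗ[K] B')
    (z : A ⊗[K] B) : TensorProduct.map (f' ∘ₗ f) g z =
      TensorProduct.map f' g (TensorProduct.map f LinearMap.id z) := by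
  rw [map_map_apply, LinearMap.comp_id]

theorem map_comp_right' {A A' B B' B'' : Type*} [AddCommGroup A] [Module K A]
    [AddCommGroup A'] [Module K A'] [AddCommGroup B''] [Module K B''] [AddCommGroup B] [Module K B]
    [AddCommGroup B'] [Module K B'] (f : A →ₗ[K] A') (g : B →ₗ[K] B') (g' : B' →ₗ[K] B'')
    (z : A ⊗[K] B) : TensorProduct.map f (g' ∘ₗ g) z =
      TensorProduct.map f g' (TensorProduct.map LinearMap.id g z) := by
  rw [map_map_apply, LinearMap.comp_id]

theorem lid_map {A B B' : Type*} [AddCommGroup A] [Module K A] [AddCommGroup B] [Module K B]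
    [AddCommGroup B'] [Module K B'] (f : A →ₗ[K] K) (g : B →ₗ[K] B') (z : A ⊗[K] B) :
    TensorProduct.lid K B' (TensorProduct.map f g z) =
      g (TensorProduct.lid K B (TensorProduct.map f LinearMap.id z)) := by
  induction z using TensorProduct.induction_on with
  | zero => simp
  | add a b ha hb => simp only [map_add, ha, hb]
  | tmul a b => simp

theorem rid_map {A A' B : Type*} [AddCommGroup A] [Module K A] [AddCommGroup B] [Module K B]
    [AddCommGroup A'] [Module K A'] (f : B →ₗ[K] K) (g : A →ₗ[K] A') (z : A ⊗[K] B) :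
    TensorProduct.rid K A' (TensorProduct.map g f z) =
      g (TensorProduct.rid K A (TensorProduct.map LinearMap.id f z)) := by
  induction z using TensorProduct.induction_on with
  | zero => simp
  | add a b ha hb => simp only [map_add, ha, hb]
  | tmul a b => simp

theorem lcounit_map {D : Type*} [AddCommGroup D] [Module K D] [Coalgebra K D] (x : D) :
    TensorProduct.lid K D (TensorProduct.map Coalgebra.counit LinearMap.id
      (Coalgebra.comul (R := K) x)) = x := by
  have := Coalgebra.rTensor_counit_comul (R := K) x
  rw [LinearMap.rTensor] at this
  rw [this]; simp

theorem rcounit_map {D : Type*} [AddCommGroup D] [Module K D] [Coalgebra K D] (x : D) :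
    TensorProduct.rid K D (TensorProduct.map LinearMap.id Coalgebra.counit
      (Coalgebra.comul (R := K) x)) = x := by
  have := Coalgebra.lTensor_counit_comul (R := K) x
  rw [LinearMap.lTensor] at this
  rw [this]; simp

theorem coassoc_map {D : Type*} [AddCommGroup D] [Module K D] [Coalgebra K D] (x : D) :
    TensorProduct.assoc K D D D (TensorProduct.map Coalgebra.comul LinearMap.id
      (Coalgebra.comul (R := K) x)) =
      TensorProduct.map LinearMap.id Coalgebra.comul (Coalgebra.comul (R := K) x) :=
  Coalgebra.coassoc_apply x

theorem Subbialgebra.comul_comp (H : Subbialgebra K E) :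
    TensorProduct.map H.incl H.incl ∘ₗ (Coalgebra.comul (R := K)) =
      Coalgebra.comul ∘ₗ H.incl := LinearMap.ext H.comul_spec

theorem Subbialgebra.grLco_comp (H : Subbialgebra K E) :
    TensorProduct.map H.incl (H.grIncl 1) ∘ₗ H.grLco = H.lcoQ ∘ₗ H.grIncl 1 :=
  LinearMap.ext H.grLco_spec

theorem Subbialgebra.grRco_comp (H : Subbialgebra K E) :
    TensorProduct.map (H.grIncl 1) H.incl ∘ₗ H.grRco = H.rcoQ ∘ₗ H.grIncl 1 :=
  LinearMap.ext H.grRco_spec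

set_option maxHeartbeats 1000000 in
/-- The `H`-Hopf bimodule `(H ∧_E H)/H`. (By definition its underlying space is
`gr^1_H E = H^{∧2}/H^{∧1}`, and `H^{∧1} = H`.) -/
noncomputable def Subbialgebra.grOne (H : Subbialgebra K E) :
    HopfBimodule K H.toSubalgebra (H.gr 1) where
  lact := H.grLact
  ract := H.grRact
  lcoact := H.grLco
  rcoact := H.grRco
  one_lact m := by
    obtain ⟨x, rfl⟩ := Submodule.mkQ_surjective _ m
    rw [H.grLact_cls]; congr 1; ext; exact one_mul _
  mul_lact h k m := by
    obtain ⟨x, rfl⟩ := Submodule.mkQ_surjective _ m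
    simp only [H.grLact_cls]; congr 1; ext; exact mul_assoc _ _ _
  ract_one m := by
    obtain ⟨x, rfl⟩ := Submodule.mkQ_surjective _ m
    rw [H.grRact_cls]; congr 1; ext; exact mul_one _
  ract_mul m h k := by
    obtain ⟨x, rfl⟩ := Submodule.mkQ_surjective _ m
    simp only [H.grRact_cls]; congr 1; ext; exact (mul_assoc _ _ _).symm
  lact_ract h m k := by
    obtain ⟨x, rfl⟩ := Submodule.mkQ_surjective _ m
    simp only [H.grLact_cls, H.grRact_cls]; congr 1; ext; exact mul_assoc _ _ _
  lcoassoc m := by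
    obtain ⟨x, rfl⟩ := Submodule.mkQ_surjective _ m
    apply map_injective H.incl_injective (map_injective H.incl_injective (H.grIncl_injective 1))
    rw [map_assoc, map_map_apply, map_map_apply, H.comul_comp, H.grLco_comp, LinearMap.comp_id,
      LinearMap.comp_id, map_comp_left, map_comp_right, H.grLco_cls, map_map_apply, map_map_apply,
      H.lcoQ_comp_mkQ, LinearMap.comp_id, LinearMap.id_comp, LinearMap.id_comp,
      map_comp_right', ← coassoc_map, map_assoc, map_map_apply, TensorProduct.map_id,
      LinearMap.id_comp, LinearMap.comp_id]
  lcounit m := by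
    obtain ⟨x, rfl⟩ := Submodule.mkQ_surjective _ m
    apply H.grIncl_injective 1
    rw [← lid_map, ← LinearMap.id_comp (H.grIncl 1)]
    have e : (Coalgebra.counit (R := K) (A := H.toSubalgebra)) = Coalgebra.counit ∘ₗ H.incl := rfl
    rw [e, ← map_map_apply, H.grLco_cls, map_map_apply, LinearMap.comp_id, LinearMap.id_comp,
      lid_map, lcounit_map]
    rfl
  rcoassoc m := by
    obtain ⟨x, rfl⟩ := Submodule.mkQ_surjective _ m
    apply map_injective (H.grIncl_injective 1) (map_injective H.incl_injective H.incl_injective)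
    rw [map_assoc, map_map_apply, map_map_apply, H.comul_comp, H.grRco_comp, LinearMap.comp_id,
      LinearMap.comp_id, map_comp_left, map_comp_right, H.grRco_cls, map_map_apply, map_map_apply,
      H.rcoQ_comp_mkQ, LinearMap.comp_id, LinearMap.comp_id, LinearMap.id_comp,
      map_comp_left', ← map_assoc, coassoc_map, map_map_apply, TensorProduct.map_id,
      LinearMap.id_comp, LinearMap.comp_id]
  rcounit m := by
    obtain ⟨x, rfl⟩ := Submodule.mkQ_surjective _ m
    apply H.grIncl_injective 1
    rw [← rid_map, ← LinearMap.id_comp (H.grIncl 1)]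
    have e : (Coalgebra.counit (R := K) (A := H.toSubalgebra)) = Coalgebra.counit ∘ₗ H.incl := rfl
    rw [e, ← map_map_apply, H.grRco_cls, map_map_apply, LinearMap.comp_id, LinearMap.id_comp,
      rid_map, rcounit_map]
    rfl
  bicoassoc m := by
    obtain ⟨x, rfl⟩ := Submodule.mkQ_surjective _ m
    apply map_injective H.incl_injective (map_injective (H.grIncl_injective 1) H.incl_injective)
    rw [map_assoc, map_map_apply, map_map_apply, H.grLco_comp, H.grRco_comp, LinearMap.comp_id,
      map_comp_left, map_comp_right, H.grRco_cls, H.grLco_cls, map_map_apply,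
      map_map_apply, H.rcoQ_comp_mkQ, H.lcoQ_comp_mkQ, LinearMap.comp_id,
      map_comp_left', map_comp_right', ← map_assoc, coassoc_map]
  lcoact_lact h m := by
    obtain ⟨x, rfl⟩ := Submodule.mkQ_surjective _ m
    apply map_injective H.incl_injective (H.grIncl_injective 1)
    rw [map_map₂ _ _ H.incl (H.grIncl 1) LinearMap.id (H.wp 1).mkQ
      ((LinearMap.mul K E) ∘ₗ H.incl) ((LinearMap.mul K E) ∘ₗ H.incl)
      ((LinearMap.mul K E) ∘ₗ H.incl) H.lmulQ H.incl_lmul H.grIncl_lact (fun _ => rfl)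
      (fun _ => rfl) _ _ _ (H.grLco_cls x), map₂_mul_left, H.comul_spec, ← Bialgebra.comul_mul]
    exact H.grLco_cls _
  lcoact_ract m h := by
    obtain ⟨x, rfl⟩ := Submodule.mkQ_surjective _ m
    apply map_injective H.incl_injective (H.grIncl_injective 1)
    rw [← map₂_flip, map_map₂ _ _ H.incl (H.grIncl 1) LinearMap.id (H.wp 1).mkQ
      ((LinearMap.mul K E).flip ∘ₗ H.incl) ((LinearMap.mul K E).flip ∘ₗ H.incl)
      ((LinearMap.mul K E).flip ∘ₗ H.incl) H.rmulQ H.incl_rmul H.grIncl_ract (fun _ => rfl)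
      (fun _ => rfl) _ _ _ (H.grLco_cls x), map₂_mul_right, H.comul_spec, ← Bialgebra.comul_mul]
    exact H.grLco_cls _
  rcoact_lact h m := by
    obtain ⟨x, rfl⟩ := Submodule.mkQ_surjective _ m
    apply map_injective (H.grIncl_injective 1) H.incl_injective
    rw [map_map₂ _ _ (H.grIncl 1) H.incl (H.wp 1).mkQ LinearMap.id
      ((LinearMap.mul K E) ∘ₗ H.incl) ((LinearMap.mul K E) ∘ₗ H.incl)
      H.lmulQ ((LinearMap.mul K E) ∘ₗ H.incl) H.grIncl_lact H.incl_lmul (fun _ => rfl)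
      (fun _ => rfl) _ _ _ (H.grRco_cls x), map₂_mul_left, H.comul_spec, ← Bialgebra.comul_mul]
    exact H.grRco_cls _
  rcoact_ract m h := by
    obtain ⟨x, rfl⟩ := Submodule.mkQ_surjective _ m
    apply map_injective (H.grIncl_injective 1) H.incl_injective
    rw [← map₂_flip, map_map₂ _ _ (H.grIncl 1) H.incl (H.wp 1).mkQ LinearMap.id
      ((LinearMap.mul K E).flip ∘ₗ H.incl) ((LinearMap.mul K E).flip ∘ₗ H.incl)
      H.rmulQ ((LinearMap.mul K E).flip ∘ₗ H.incl) H.grIncl_ract H.incl_rmul (fun _ => rfl)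
      (fun _ => rfl) _ _ _ (H.grRco_cls x), map₂_mul_right, H.comul_spec, ← Bialgebra.comul_mul]
    exact H.grRco_cls _

end GrOne

namespace HopfBimodule

section Ambient

variable {K : Type v} [Field K] {H : Type u} [Ring H] [Bialgebra K H]
  {M : Type u} [AddCommGroup M] [Module K M]

/-- The spaces `H ⊗ M ⊗ ⋯ ⊗ M` with `n` factors `M`. -/
noncomputable def amb (P : HopfBimodule K H M) : ℕ → ModuleCat.{u} K
  | 0 => ModuleCat.of K H
  | n + 1 => ModuleCat.of K (amb P n ⊗[K] M)

/-- The identification of `H` with the zeroth space. -/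
noncomputable def ambZero (P : HopfBimodule K H M) : H ≃ₗ[K] P.amb 0 := LinearEquiv.refl K H

/-- The identification of `(H ⊗ M^{⊗n}) ⊗ M` with `H ⊗ M^{⊗(n+1)}`. -/
noncomputable def ambSucc (P : HopfBimodule K H M) (n : ℕ) :
    (P.amb n ⊗[K] M) ≃ₗ[K] P.amb (n + 1) := LinearEquiv.refl K (P.amb n ⊗[K] M)

/-- The right coaction of `H` on `H ⊗ M^{⊗n}`: that of the last tensor factor. -/
noncomputable def ambRco (P : HopfBimodule K H M) : (n : ℕ) → P.amb n →ₗ[K] P.amb n ⊗[K] H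
  | 0 => TensorProduct.map P.ambZero.toLinearMap LinearMap.id ∘ₗ Coalgebra.comul ∘ₗ
      P.ambZero.symm.toLinearMap
  | n + 1 => TensorProduct.map (P.ambSucc n).toLinearMap LinearMap.id ∘ₗ
      (TensorProduct.assoc K (P.amb n) M H).symm.toLinearMap ∘ₗ
      TensorProduct.map LinearMap.id P.rcoact ∘ₗ (P.ambSucc n).symm.toLinearMap

/-- The cotensor powers of `M`: `M^{□0} = H` and `M^{□(n+1)} = M^{□n} □_H M`, the subspace of those
elements of `M^{□n} ⊗ M` on which the maps to `M^{□n} ⊗ H ⊗ M` induced by the right coaction of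
`M^{□n}` and by the left coaction of `M` agree. (Here `M^{□1} = H □_H M`, which is identified with
`M` by the left coaction.) -/
noncomputable def cot (P : HopfBimodule K H M) : (n : ℕ) → Submodule K (P.amb n)
  | 0 => ⊤
  | n + 1 => (LinearMap.range (TensorProduct.map (cot P n).subtype (LinearMap.id (M := M))) ⊓
      LinearMap.eqLocus (TensorProduct.map (P.ambRco n) (LinearMap.id (M := M)))
        ((TensorProduct.assoc K (P.amb n) H M).symm.toLinearMap ∘ₗ
          TensorProduct.map LinearMap.id P.lcoact)).map (P.ambSucc n).toLinearMap

/-- The direct sum of the spaces `H ⊗ M^{⊗n}`. It is a coalgebra, the cotensor coalgebra of the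
bicomodule `H ⊗ M`, where `H` coacts on the left by its comultiplication and on the right by the
right coaction of `M`. -/
def Amb (P : HopfBimodule K H M) : Type u := ⨁ n, P.amb n

noncomputable instance ambAddCommGroup (P : HopfBimodule K H M) : AddCommGroup P.Amb :=
  inferInstanceAs (AddCommGroup (⨁ n, P.amb n))

noncomputable instance ambModule (P : HopfBimodule K H M) : Module K P.Amb :=
  inferInstanceAs (Module K (⨁ n, P.amb n))

/-- The inclusion of the `n`-th summand. -/
noncomputable def ι (P : HopfBimodule K H M) (n : ℕ) : P.amb n →ₗ[K] P.Amb :=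
  DirectSum.lof K ℕ (fun n => P.amb n) n

/-- The projection onto the `n`-th summand. -/
noncomputable def π (P : HopfBimodule K H M) (n : ℕ) : P.Amb →ₗ[K] P.amb n :=
  DirectSum.component K ℕ (fun n => P.amb n) n

/-- Linear maps out of the direct sum. -/
noncomputable def desc (P : HopfBimodule K H M) {V : Type*} [AddCommGroup V] [Module K V]
    (f : (n : ℕ) → P.amb n →ₗ[K] V) : P.Amb →ₗ[K] V :=
  DirectSum.toModule K ℕ V f

@[simp]
theorem desc_ι (P : HopfBimodule K H M) {V : Type*} [AddCommGroup V] [Module K V]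
    (f : (n : ℕ) → P.amb n →ₗ[K] V) (n : ℕ) (x : P.amb n) : P.desc f (P.ι n x) = f n x :=
  DirectSum.toModule_lof (M := fun n => P.amb n) (φ := f) K n x

theorem π_ι (P : HopfBimodule K H M) (n : ℕ) (x : P.amb n) : P.π n (P.ι n x) = x :=
  DirectSum.component.lof_self K (M := fun n => P.amb n) n x

theorem π_ι_of_ne (P : HopfBimodule K H M) {n m : ℕ} (h : n ≠ m) (x : P.amb n) :
    P.π m (P.ι n x) = 0 := by
  have := DirectSum.component.of K (M := fun n => P.amb n) m n x
  rw [dif_neg h] at this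
  exact this

theorem ι_injective (P : HopfBimodule K H M) (n : ℕ) : Function.Injective (P.ι n) :=
  Function.LeftInverse.injective (P.π_ι n)

theorem Amb_ext (P : HopfBimodule K H M) {x y : P.Amb} (h : ∀ n, P.π n x = P.π n y) : x = y :=
  DirectSum.ext_component K h

theorem Amb_hom_ext (P : HopfBimodule K H M) {V : Type*} [AddCommGroup V] [Module K V]
    {f g : P.Amb →ₗ[K] V} (h : ∀ n x, f (P.ι n x) = g (P.ι n x)) : f = g :=
  DirectSum.linearMap_ext K fun n => LinearMap.ext (h n)

/-- The inclusion of `H` as the summand of degree zero. -/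
noncomputable def i0 (P : HopfBimodule K H M) : H →ₗ[K] P.Amb := P.ι 0 ∘ₗ P.ambZero.toLinearMap

/-- The maps `(H ⊗ M^{⊗n}) ⊗ M → H ⊗ M^{⊗(n+1)}` together. -/
noncomputable def app (P : HopfBimodule K H M) : P.Amb ⊗[K] M →ₗ[K] P.Amb :=
  TensorProduct.lift (P.desc fun n =>
    TensorProduct.curry (P.ι (n + 1) ∘ₗ (P.ambSucc n).toLinearMap))

@[simp]
theorem app_ι (P : HopfBimodule K H M) (n : ℕ) (x : P.amb n) (m : M) :
    P.app (P.ι n x ⊗ₜ m) = P.ι (n + 1) (P.ambSucc n (x ⊗ₜ m)) := by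
  simp [app]

theorem app_map_ι (P : HopfBimodule K H M) (n : ℕ) (y : P.amb n ⊗[K] M) :
    P.app (TensorProduct.map (P.ι n) LinearMap.id y) = P.ι (n + 1) (P.ambSucc n y) := by
  induction y using TensorProduct.induction_on with
  | zero => simp
  | add x y hx hy => simp only [map_add, hx, hy]
  | tmul x m => simp

/-- Every element is a sum of elements of `H` and of elements `w ⊗ m`. -/
theorem Amb_induction (P : HopfBimodule K H M) {p : P.Amb → Prop} (h0 : ∀ h, p (P.i0 h))
    (happ : ∀ w m, p w → p (P.app (w ⊗ₜ m))) (hadd : ∀ x y, p x → p y → p (x + y)) (w : P.Amb) :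
    p w := by
  have hz : p 0 := by simpa using h0 0
  have key : ∀ n (x : P.amb n), p (P.ι n x) := by
    intro n
    induction n with
    | zero =>
      intro x
      obtain ⟨h, rfl⟩ := P.ambZero.surjective x
      exact h0 h
    | succ n ih =>
      intro x
      obtain ⟨y, rfl⟩ := (P.ambSucc n).surjective x
      induction y using TensorProduct.induction_on with
      | zero => simpa using hz
      | add x y hx hy => simpa only [map_add] using hadd _ _ hx hy
      | tmul x m => rw [← P.app_ι]; exact happ _ _ (ih x)
  exact DirectSum.induction_on w hz (fun n x => key n x) hadd

/-- The right coaction on the direct sum. -/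
noncomputable def R (P : HopfBimodule K H M) : P.Amb →ₗ[K] P.Amb ⊗[K] H :=
  P.desc fun n => TensorProduct.map (P.ι n) LinearMap.id ∘ₗ P.ambRco n

@[simp]
theorem R_ι (P : HopfBimodule K H M) (n : ℕ) (x : P.amb n) :
    P.R (P.ι n x) = TensorProduct.map (P.ι n) LinearMap.id (P.ambRco n x) := by
  simp [R]

theorem R_i0 (P : HopfBimodule K H M) (h : H) :
    P.R (P.i0 h) = TensorProduct.map P.i0 LinearMap.id (Coalgebra.comul (R := K) h) := by
  simp [i0, ambRco, map_map_apply]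

theorem R_app (P : HopfBimodule K H M) (y : P.Amb ⊗[K] M) :
    P.R (P.app y) = TensorProduct.map P.app LinearMap.id ((TensorProduct.assoc K P.Amb M H).symm
      (TensorProduct.map LinearMap.id P.rcoact y)) := by
  induction y using TensorProduct.induction_on with
  | zero => simp
  | add x y hx hy => simp only [map_add, hx, hy]
  | tmul w m =>
    suffices h : P.R ∘ₗ P.app ∘ₗ (TensorProduct.mk K P.Amb M).flip m =
        TensorProduct.map P.app LinearMap.id ∘ₗ (TensorProduct.assoc K P.Amb M H).symm.toLinearMap ∘ₗ
          (TensorProduct.mk K P.Amb (M ⊗[K] H)).flip (P.rcoact m) from LinearMap.congr_fun h w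
    apply P.Amb_hom_ext
    intro n x
    simp only [LinearMap.comp_apply, LinearMap.flip_apply, TensorProduct.mk_apply, app_ι, R_ι,
      ambRco, LinearEquiv.coe_coe, LinearEquiv.symm_apply_apply, TensorProduct.map_tmul,
      LinearMap.id_apply]
    generalize P.rcoact m = t
    induction t using TensorProduct.induction_on with
    | zero => simp
    | add x y hx hy => simp only [map_add, TensorProduct.tmul_add, hx, hy]
    | tmul m h => simp

/-- The components of the comultiplication: on `H` it is the comultiplication of `H`, and
`Δ(w ⊗ m)` is the sum of `(w ⊗ m_{(0)}) ⊗ m_{(1)}` and `w_{(1)} ⊗ (w_{(2)} ⊗ m)`. -/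
noncomputable def ambComul (P : HopfBimodule K H M) :
    (n : ℕ) → P.amb n →ₗ[K] P.Amb ⊗[K] P.Amb
  | 0 => TensorProduct.map P.i0 P.i0 ∘ₗ Coalgebra.comul ∘ₗ P.ambZero.symm.toLinearMap
  | n + 1 => TensorProduct.map (P.ι (n + 1)) P.i0 ∘ₗ P.ambRco (n + 1) +
      TensorProduct.map LinearMap.id P.app ∘ₗ
        (TensorProduct.assoc K P.Amb P.Amb M).toLinearMap ∘ₗ
        TensorProduct.map (ambComul P n) LinearMap.id ∘ₗ (P.ambSucc n).symm.toLinearMap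

/-- The components of the counit: the counit of `H` in degree zero. -/
noncomputable def ambCounit (P : HopfBimodule K H M) : (n : ℕ) → P.amb n →ₗ[K] K
  | 0 => Coalgebra.counit ∘ₗ P.ambZero.symm.toLinearMap
  | _ + 1 => 0

noncomputable instance ambCoalgebraStruct (P : HopfBimodule K H M) : CoalgebraStruct K P.Amb where
  comul := P.desc P.ambComul
  counit := P.desc P.ambCounit

theorem comul_ι (P : HopfBimodule K H M) (n : ℕ) (x : P.amb n) :
    Coalgebra.comul (R := K) (P.ι n x) = P.ambComul n x := P.desc_ι _ n x

theorem counit_ι (P : HopfBimodule K H M) (n : ℕ) (x : P.amb n) :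
    Coalgebra.counit (R := K) (P.ι n x) = P.ambCounit n x := P.desc_ι _ n x

theorem comul_i0 (P : HopfBimodule K H M) (h : H) :
    Coalgebra.comul (R := K) (P.i0 h) =
      TensorProduct.map P.i0 P.i0 (Coalgebra.comul (R := K) h) := by
  rw [i0, LinearMap.comp_apply, comul_ι]
  simp [ambComul, i0]

theorem counit_i0 (P : HopfBimodule K H M) (h : H) :
    Coalgebra.counit (R := K) (P.i0 h) = Coalgebra.counit (R := K) h := by
  rw [i0, LinearMap.comp_apply, counit_ι]
  simp [ambCounit]

theorem comul_app (P : HopfBimodule K H M) (y : P.Amb ⊗[K] M) :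
    Coalgebra.comul (R := K) (P.app y) = TensorProduct.map LinearMap.id P.i0 (P.R (P.app y)) +
      TensorProduct.map LinearMap.id P.app (TensorProduct.assoc K P.Amb P.Amb M
        (TensorProduct.map Coalgebra.comul LinearMap.id y)) := by
  induction y using TensorProduct.induction_on with
  | zero => simp
  | add x y hx hy => simp only [map_add, hx, hy]; abel
  | tmul w m =>
    suffices h : Coalgebra.comul (R := K) ∘ₗ P.app ∘ₗ (TensorProduct.mk K P.Amb M).flip m =
        TensorProduct.map LinearMap.id P.i0 ∘ₗ P.R ∘ₗ P.app ∘ₗ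
          (TensorProduct.mk K P.Amb M).flip m + TensorProduct.map LinearMap.id P.app ∘ₗ
          (TensorProduct.assoc K P.Amb P.Amb M).toLinearMap ∘ₗ
          TensorProduct.map Coalgebra.comul LinearMap.id ∘ₗ (TensorProduct.mk K P.Amb M).flip m
      from LinearMap.congr_fun h w
    apply P.Amb_hom_ext
    intro n x
    simp only [LinearMap.comp_apply, LinearMap.flip_apply, TensorProduct.mk_apply, app_ι, R_ι,
      comul_ι, LinearMap.add_apply, ambComul, map_map_apply, LinearMap.id_comp, LinearMap.comp_id,
      LinearEquiv.coe_coe, LinearEquiv.symm_apply_apply, TensorProduct.map_tmul]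

theorem counit_app (P : HopfBimodule K H M) (y : P.Amb ⊗[K] M) :
    Coalgebra.counit (R := K) (P.app y) = 0 := by
  induction y using TensorProduct.induction_on with
  | zero => simp
  | add x y hx hy => simp only [map_add, hx, hy, add_zero]
  | tmul w m =>
    suffices h : Coalgebra.counit (R := K) ∘ₗ P.app ∘ₗ (TensorProduct.mk K P.Amb M).flip m = 0
      from LinearMap.congr_fun h w
    apply P.Amb_hom_ext
    intro n x
    simp [counit_ι, ambCounit]

/-- `w ↦ w ⊗ m`. -/
noncomputable abbrev appR (P : HopfBimodule K H M) (m : M) : P.Amb →ₗ[K] P.Amb :=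
  P.app ∘ₗ (TensorProduct.mk K P.Amb M).flip m

/-- `m ↦ w ⊗ m`. -/
noncomputable abbrev appL (P : HopfBimodule K H M) (w : P.Amb) : M →ₗ[K] P.Amb :=
  P.app ∘ₗ TensorProduct.mk K P.Amb M w

theorem comul_app_tmul (P : HopfBimodule K H M) (w : P.Amb) (m : M) :
    Coalgebra.comul (R := K) (P.app (w ⊗ₜ m)) = TensorProduct.map (P.appL w) P.i0 (P.rcoact m) +
      TensorProduct.map LinearMap.id (P.appR m) (Coalgebra.comul (R := K) w) := by
  rw [comul_app, R_app]
  congr 1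
  · simp only [TensorProduct.map_tmul, LinearMap.id_apply]
    generalize P.rcoact m = t
    induction t using TensorProduct.induction_on with
    | zero => simp
    | add x y hx hy => simp only [map_add, TensorProduct.tmul_add, hx, hy]
    | tmul m h => simp
  · simp only [TensorProduct.map_tmul, LinearMap.id_apply]
    generalize Coalgebra.comul (R := K) w = t
    induction t using TensorProduct.induction_on with
    | zero => simp
    | add x y hx hy => simp only [map_add, TensorProduct.add_tmul, hx, hy]
    | tmul m h => simp

theorem Amb_coassoc (P : HopfBimodule K H M) (w : P.Amb) :
    TensorProduct.assoc K P.Amb P.Amb P.Amb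
      (TensorProduct.map Coalgebra.comul LinearMap.id (Coalgebra.comul (R := K) w)) =
      TensorProduct.map LinearMap.id Coalgebra.comul (Coalgebra.comul (R := K) w) := by
  induction w using P.Amb_induction with
  | h0 h =>
    have e : Coalgebra.comul (R := K) ∘ₗ P.i0 = TensorProduct.map P.i0 P.i0 ∘ₗ Coalgebra.comul :=
      LinearMap.ext P.comul_i0
    rw [comul_i0, map_map_apply, map_map_apply, e, LinearMap.id_comp, map_comp_left',
      map_comp_right', ← map_assoc, coassoc_map]
  | hadd x y hx hy => simp only [map_add, hx, hy]
  | happ w m ih =>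
    have e : Coalgebra.comul (R := K) ∘ₗ P.i0 = TensorProduct.map P.i0 P.i0 ∘ₗ Coalgebra.comul :=
      LinearMap.ext P.comul_i0
    have mixed : ∀ (z : P.Amb ⊗[K] P.Amb) (t : M ⊗[K] H),
        TensorProduct.assoc K P.Amb P.Amb P.Amb (TensorProduct.map
          (LinearMap.flip (LinearMap.lTensorHom P.Amb ∘ₗ
            (TensorProduct.mk K P.Amb M).flip.compr₂ P.app) z) P.i0 t) =
        TensorProduct.map LinearMap.id (LinearMap.flip ((TensorProduct.mapBilinear (RingHom.id K)
          M H P.Amb P.Amb).flip P.i0 ∘ₗ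
          (TensorProduct.mk K P.Amb M).compr₂ P.app) t) z := by
      intro z t
      induction z using TensorProduct.induction_on with
      | zero => simp
      | add x y hx hy => 
        rw [map_add, map_add, TensorProduct.map_add_left, LinearMap.add_apply, map_add, hx, hy]
      | tmul a b =>
        induction t using TensorProduct.induction_on with
        | zero => simp
        | add x y hx hy => simp only [map_add, hx, hy, TensorProduct.map_add_right, LinearMap.add_apply]
        | tmul m h => simp
    have e1 : Coalgebra.comul (R := K) ∘ₗ P.appL w = 
      TensorProduct.map (P.appL w) P.i0 ∘ₗ P.rcoact + (LinearMap.flip (LinearMap.lTensorHom P.Amb ∘ₗ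
            (TensorProduct.mk K P.Amb M).flip.compr₂ P.app) (Coalgebra.comul (R := K) w)) := by
      ext m
      simp [comul_app_tmul]
      rfl
    have e2 : Coalgebra.comul (R := K) ∘ₗ P.appR m = 
        (LinearMap.flip ((TensorProduct.mapBilinear (RingHom.id K)
          M H P.Amb P.Amb).flip P.i0 ∘ₗ
          (TensorProduct.mk K P.Amb M).compr₂ P.app) (P.rcoact m)) + 
          TensorProduct.map LinearMap.id (P.appR m) ∘ₗ Coalgebra.comul := by
      ext w
      simp [comul_app_tmul]
      rfl
    rw [comul_app_tmul]
    simp only [map_add, map_map_apply, LinearMap.id_comp, LinearMap.comp_id]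
    rw [e1, e2, TensorProduct.map_add_left, TensorProduct.map_add_right, LinearMap.add_apply,
      LinearMap.add_apply, map_add, mixed, e, add_assoc]
    congr 1
    · rw [map_comp_left', ← map_assoc, P.rcoassoc, map_comp_right']
    · congr 1
      generalize P.appR m = f
      rw [map_comp_right', ← ih, map_assoc, map_map_apply, TensorProduct.map_id,
        LinearMap.id_comp, LinearMap.comp_id]

theorem Amb_lcounit (P : HopfBimodule K H M) (w : P.Amb) :
    TensorProduct.lid K P.Amb
      (TensorProduct.map Coalgebra.counit LinearMap.id (Coalgebra.comul (R := K) w)) = w := by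
  induction w using P.Amb_induction with
  | h0 h =>
    rw [comul_i0, map_map_apply, LinearMap.id_comp, lid_map]
    have e : Coalgebra.counit (R := K) ∘ₗ P.i0 = Coalgebra.counit := LinearMap.ext P.counit_i0
    rw [e, lcounit_map]
  | hadd x y hx hy => simp only [map_add, hx, hy]
  | happ w m ih =>
    have e : Coalgebra.counit (R := K) ∘ₗ P.appL w = 0 :=
      LinearMap.ext fun m => P.counit_app _
    rw [comul_app_tmul, map_add, map_map_apply, map_map_apply, e, TensorProduct.map_zero_left,
      LinearMap.zero_apply, zero_add, LinearMap.id_comp, LinearMap.comp_id, lid_map, ih]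
    rfl

theorem Amb_rcounit (P : HopfBimodule K H M) (w : P.Amb) :
    TensorProduct.rid K P.Amb
      (TensorProduct.map LinearMap.id Coalgebra.counit (Coalgebra.comul (R := K) w)) = w := by
  induction w using P.Amb_induction with
  | h0 h =>
    rw [comul_i0, map_map_apply, LinearMap.id_comp, rid_map]
    have e : Coalgebra.counit (R := K) ∘ₗ P.i0 = Coalgebra.counit := LinearMap.ext P.counit_i0
    rw [e, rcounit_map]
  | hadd x y hx hy => simp only [map_add, hx, hy]
  | happ w m ih =>
    have e : Coalgebra.counit (R := K) ∘ₗ P.appR m = 0 :=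
      LinearMap.ext fun m => P.counit_app _
    have e' : Coalgebra.counit (R := K) ∘ₗ P.i0 = Coalgebra.counit := LinearMap.ext P.counit_i0
    rw [comul_app_tmul, map_add, map_map_apply, map_map_apply, e, TensorProduct.map_zero_right,
      LinearMap.zero_apply, add_zero, LinearMap.id_comp, e', rid_map, P.rcounit]
    rfl

noncomputable instance ambCoalgebra (P : HopfBimodule K H M) : Coalgebra K P.Amb where
  coassoc := LinearMap.ext P.Amb_coassoc
  rTensor_counit_comp_comul := LinearMap.ext fun w => by
    apply (TensorProduct.lid K P.Amb).injective
    exact (P.Amb_lcounit w).trans (by simp)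
  lTensor_counit_comp_comul := LinearMap.ext fun w => by
    apply (TensorProduct.rid K P.Amb).injective
    exact (P.Amb_rcounit w).trans (by simp)

end Ambient

end HopfBimodule

namespace HopfBimodule

section CotensorCoalgebra

variable {K : Type v} [Field K] {H : Type u} [Ring H] [Bialgebra K H]
  {M : Type u} [AddCommGroup M] [Module K M]

/-- The subspace `⊕_n M^{□n}` of `⊕_n H ⊗ M^{⊗n}`. -/
noncomputable def cotensor (P : HopfBimodule K H M) : Submodule K P.Amb :=
  ⨅ n, (P.cot n).comap (P.π n)

theorem mem_cotensor (P : HopfBimodule K H M) {w : P.Amb} :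
    w ∈ P.cotensor ↔ ∀ n, P.π n w ∈ P.cot n := by
  simp [cotensor]

/-- The cotensor coalgebra `T^c_H(M) = ⊕_n M^{□n}`, as a type. -/
def Cot (P : HopfBimodule K H M) : Type u := P.cotensor

noncomputable instance cotAddCommGroup (P : HopfBimodule K H M) : AddCommGroup P.Cot :=
  inferInstanceAs (AddCommGroup P.cotensor)

noncomputable instance cotModule (P : HopfBimodule K H M) : Module K P.Cot :=
  inferInstanceAs (Module K P.cotensor)

/-- The inclusion into `⊕_n H ⊗ M^{⊗n}`. -/
noncomputable def val (P : HopfBimodule K H M) : P.Cot →ₗ[K] P.Amb := P.cotensor.subtype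

theorem val_injective (P : HopfBimodule K H M) : Function.Injective P.val :=
  Subtype.val_injective

theorem val_mem (P : HopfBimodule K H M) (t : P.Cot) : P.val t ∈ P.cotensor := t.2

/-- Linear maps into the cotensor coalgebra. -/
noncomputable def corestrict (P : HopfBimodule K H M) {V : Type*} [AddCommGroup V] [Module K V]
    (f : V →ₗ[K] P.Amb) (hf : ∀ v, f v ∈ P.cotensor) : V →ₗ[K] P.Cot :=
  f.codRestrict P.cotensor hf

@[simp]
theorem val_corestrict (P : HopfBimodule K H M) {V : Type*} [AddCommGroup V] [Module K V]
    (f : V →ₗ[K] P.Amb) (hf : ∀ v, f v ∈ P.cotensor) (v : V) : P.val (P.corestrict f hf v) = f v :=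
  rfl

theorem val_comp_corestrict (P : HopfBimodule K H M) {V : Type*} [AddCommGroup V] [Module K V]
    (f : V →ₗ[K] P.Amb) (hf : ∀ v, f v ∈ P.cotensor) : P.val ∘ₗ P.corestrict f hf = f :=
  rfl

theorem ι_mem (P : HopfBimodule K H M) {n : ℕ} {x : P.amb n} (hx : x ∈ P.cot n) :
    P.ι n x ∈ P.cotensor := by
  rw [mem_cotensor]
  intro m
  by_cases h : n = m
  · subst h; rwa [π_ι]
  · rw [P.π_ι_of_ne h]; exact zero_mem _

theorem cotensor_induction (P : HopfBimodule K H M) {p : P.Amb → Prop}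
    (h0 : p 0) (hι : ∀ n, ∀ x ∈ P.cot n, p (P.ι n x)) (hadd : ∀ x y, p x → p y → p (x + y))
    {w : P.Amb} (hw : w ∈ P.cotensor) : p w := by
  classical
  rw [mem_cotensor] at hw
  have e : w = ∑ n ∈ DFinsupp.support (β := fun n => P.amb n) w, P.ι n (P.π n w) :=
    (DirectSum.sum_support_of (β := fun n => P.amb n) w).symm
  rw [e]
  exact Finset.sum_induction _ p hadd h0 (fun n _ => hι n _ (hw n))

theorem i0_mem (P : HopfBimodule K H M) (h : H) : P.i0 h ∈ P.cotensor :=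
  P.ι_mem (n := 0) (by trivial)

/-- The condition defining the cotensor product. -/
def Bal (P : HopfBimodule K H M) (u : P.Amb ⊗[K] M) : Prop :=
  TensorProduct.map P.R LinearMap.id u =
    (TensorProduct.assoc K P.Amb H M).symm (TensorProduct.map LinearMap.id P.lcoact u)

/-- The difference of the two coactions defining the cotensor product. -/
noncomputable def bal (P : HopfBimodule K H M) : P.Amb ⊗[K] M →ₗ[K] (P.Amb ⊗[K] H) ⊗[K] M :=
  TensorProduct.map P.R LinearMap.id -
    (TensorProduct.assoc K P.Amb H M).symm.toLinearMap ∘ₗ TensorProduct.map LinearMap.id P.lcoact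

theorem bal_eq_zero (P : HopfBimodule K H M) {u : P.Amb ⊗[K] M} : P.bal u = 0 ↔ P.Bal u := by
  simp [bal, Bal, sub_eq_zero]

theorem mem_cot_succ (P : HopfBimodule K H M) {n : ℕ} {y : P.amb n ⊗[K] M} :
    P.ambSucc n y ∈ P.cot (n + 1) ↔
      y ∈ LinearMap.range (TensorProduct.map (P.cot n).subtype (LinearMap.id (M := M))) ∧
      TensorProduct.map (P.ambRco n) (LinearMap.id (M := M)) y =
        (TensorProduct.assoc K (P.amb n) H M).symm (TensorProduct.map LinearMap.id P.lcoact y) := by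
  constructor
  · rintro ⟨y', ⟨h1, h2⟩, h3⟩
    obtain rfl : y' = y := (P.ambSucc n).injective h3
    exact ⟨h1, h2⟩
  · rintro ⟨h1, h2⟩
    exact ⟨y, ⟨h1, h2⟩, rfl⟩

theorem assoc_symm_map {A B C A' B' C' : Type*} [AddCommGroup A] [Module K A]
    [AddCommGroup B] [Module K B] [AddCommGroup C] [Module K C] [AddCommGroup A'] [Module K A']
    [AddCommGroup B'] [Module K B'] [AddCommGroup C'] [Module K C']
    (f : A →ₗ[K] A') (g : B →ₗ[K] B') (h : C →ₗ[K] C') (z : A ⊗[K] (B ⊗[K] C)) :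
    (TensorProduct.assoc K A' B' C').symm (TensorProduct.map f (TensorProduct.map g h) z) =
      TensorProduct.map (TensorProduct.map f g) h ((TensorProduct.assoc K A B C).symm z) := by
  rw [LinearEquiv.symm_apply_eq, ← map_assoc, LinearEquiv.apply_symm_apply]

theorem π_succ_app (P : HopfBimodule K H M) (n : ℕ) (u : P.Amb ⊗[K] M) :
    P.π (n + 1) (P.app u) = P.ambSucc n (TensorProduct.map (P.π n) LinearMap.id u) := by
  induction u using TensorProduct.induction_on with
  | zero => simp
  | add x y hx hy => simp only [map_add, hx, hy]
  | tmul w m =>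
    suffices h : P.π (n + 1) ∘ₗ P.appR m =
        (P.ambSucc n).toLinearMap ∘ₗ (TensorProduct.mk K (P.amb n) M).flip m ∘ₗ P.π n from
      LinearMap.congr_fun h w
    apply P.Amb_hom_ext
    intro k x
    simp only [LinearMap.comp_apply, LinearMap.flip_apply, TensorProduct.mk_apply, app_ι,
      LinearEquiv.coe_coe]
    by_cases h : k = n
    · subst h; rw [π_ι, π_ι]
    · rw [P.π_ι_of_ne h, P.π_ι_of_ne (by omega)]; simp

theorem ambRco_π (P : HopfBimodule K H M) (n : ℕ) :
    P.ambRco n ∘ₗ P.π n = TensorProduct.map (P.π n) LinearMap.id ∘ₗ P.R := by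
  apply P.Amb_hom_ext
  intro k x
  simp only [LinearMap.comp_apply, R_ι, map_map_apply, LinearMap.comp_id]
  by_cases h : k = n
  · subst h
    have : P.π k ∘ₗ P.ι k = LinearMap.id := LinearMap.ext (P.π_ι k)
    rw [π_ι, this, TensorProduct.map_id, LinearMap.id_apply]
  · have : P.π n ∘ₗ P.ι k = 0 := LinearMap.ext (P.π_ι_of_ne h)
    rw [P.π_ι_of_ne h, this, map_zero, TensorProduct.map_zero_left, LinearMap.zero_apply]

theorem app_mem (P : HopfBimodule K H M) (u : P.Cot ⊗[K] M)
    (hu : P.Bal (TensorProduct.map P.val LinearMap.id u)) :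
    P.app (TensorProduct.map P.val LinearMap.id u) ∈ P.cotensor := by
  rw [mem_cotensor]
  rintro (_ | n)
  · trivial
  rw [π_succ_app, mem_cot_succ]
  constructor
  · let r : P.Cot →ₗ[K] P.cot n := (P.π n ∘ₗ P.val).codRestrict _
      (fun t => P.mem_cotensor.1 (P.val_mem t) n)
    refine ⟨TensorProduct.map r LinearMap.id u, ?_⟩
    rw [map_map_apply, map_map_apply]
    rfl
  · rw [map_map_apply (f := P.π n), ambRco_π, map_comp_left, LinearMap.comp_id, hu,
      ← assoc_symm_map, map_map_apply, map_map_apply (f := P.π n), TensorProduct.map_id,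
      LinearMap.id_comp, LinearMap.id_comp, LinearMap.comp_id, LinearMap.comp_id]


theorem map_sub_left {A B V W : Type*} [AddCommGroup A] [Module K A] [AddCommGroup B] [Module K B]
    [AddCommGroup V] [Module K V] [AddCommGroup W] [Module K W] (f g : A →ₗ[K] V) (h : B →ₗ[K] W)
    (z : A ⊗[K] B) :
    TensorProduct.map (f - g) h z = TensorProduct.map f h z - TensorProduct.map g h z := by
  rw [eq_sub_iff_add_eq, ← LinearMap.add_apply, ← TensorProduct.map_add_left, sub_add_cancel]

theorem map_sub_right {A B V W : Type*} [AddCommGroup A] [Module K A] [AddCommGroup B] [Module K B]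
    [AddCommGroup V] [Module K V] [AddCommGroup W] [Module K W] (h : A →ₗ[K] V) (f g : B →ₗ[K] W)
    (z : A ⊗[K] B) :
    TensorProduct.map h (f - g) z = TensorProduct.map h f z - TensorProduct.map h g z := by
  rw [eq_sub_iff_add_eq, ← LinearMap.add_apply, ← TensorProduct.map_add_right, sub_add_cancel]

theorem exists_ker_left {A B V : Type*} [AddCommGroup A] [Module K A] [AddCommGroup B] [Module K B]
    [AddCommGroup V] [Module K V] (f : A →ₗ[K] V) (z : A ⊗[K] B)
    (hz : TensorProduct.map f LinearMap.id z = 0) :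
    ∃ z', TensorProduct.map (LinearMap.ker f).subtype LinearMap.id z' = z :=
  (Module.Flat.rTensor_exact B (LinearMap.exact_subtype_ker_map f) z).1 hz

theorem exists_ker_right {A B V : Type*} [AddCommGroup A] [Module K A] [AddCommGroup B]
    [Module K B] [AddCommGroup V] [Module K V] (f : B →ₗ[K] V) (z : A ⊗[K] B)
    (hz : TensorProduct.map LinearMap.id f z = 0) :
    ∃ z', TensorProduct.map LinearMap.id (LinearMap.ker f).subtype z' = z :=
  (Module.Flat.lTensor_exact A (LinearMap.exact_subtype_ker_map f) z).1 hz

/-- `w ⊗ m` for the elements of the cotensor product of the cotensor coalgebra and `M`. -/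
noncomputable def appCot (P : HopfBimodule K H M) :
    LinearMap.ker (P.bal ∘ₗ TensorProduct.map P.val LinearMap.id) →ₗ[K] P.Cot :=
  P.corestrict (P.app ∘ₗ TensorProduct.map P.val LinearMap.id ∘ₗ Submodule.subtype _)
    (fun u => P.app_mem _ (P.bal_eq_zero.1 u.2))

theorem val_comp_appCot (P : HopfBimodule K H M) : P.val ∘ₗ P.appCot =
    (P.app ∘ₗ TensorProduct.map P.val LinearMap.id) ∘ₗ Submodule.subtype _ := rfl

/-- The inclusion of the cotensor powers. -/
noncomputable def ιCot (P : HopfBimodule K H M) (n : ℕ) : P.cot n →ₗ[K] P.Cot :=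
  P.corestrict (P.ι n ∘ₗ (P.cot n).subtype) (fun x => P.ι_mem x.2)

theorem val_ιCot (P : HopfBimodule K H M) (n : ℕ) (x : P.cot n) : P.val (P.ιCot n x) = P.ι n x :=
  rfl

theorem cot_succ_cases (P : HopfBimodule K H M) {n : ℕ} {x : P.amb (n + 1)}
    (hx : x ∈ P.cot (n + 1)) : ∃ y : P.cot n ⊗[K] M,
      P.ι (n + 1) x = P.app (TensorProduct.map P.val LinearMap.id
        (TensorProduct.map (P.ιCot n) LinearMap.id y)) ∧
      P.Bal (TensorProduct.map P.val LinearMap.id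
        (TensorProduct.map (P.ιCot n) LinearMap.id y)) := by
  obtain ⟨z, rfl⟩ := (P.ambSucc n).surjective x
  obtain ⟨⟨y, rfl⟩, h2⟩ := P.mem_cot_succ.1 hx
  have e : TensorProduct.map P.val LinearMap.id
        (TensorProduct.map (P.ιCot n) (LinearMap.id (M := M)) y) =
      TensorProduct.map (P.ι n) LinearMap.id
        (TensorProduct.map (P.cot n).subtype (LinearMap.id (M := M)) y) := by
    rw [map_map_apply, map_map_apply]; rfl
  refine ⟨y, ?_, ?_⟩
  · rw [e, app_map_ι]
  · rw [e]
    have e2 : P.R ∘ₗ P.ι n = TensorProduct.map (P.ι n) LinearMap.id ∘ₗ P.ambRco n :=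
      LinearMap.ext (P.R_ι n)
    rw [Bal, map_map_apply, e2, map_comp_left, LinearMap.comp_id, h2,
      ← assoc_symm_map, map_map_apply, map_map_apply (f := P.ι n), TensorProduct.map_id,
      LinearMap.id_comp, LinearMap.id_comp, LinearMap.comp_id, LinearMap.comp_id]

theorem bico (P : HopfBimodule K H M) (u : P.Amb ⊗[K] M) :
    (TensorProduct.assoc K (P.Amb ⊗[K] H) M H).symm (TensorProduct.map LinearMap.id P.rcoact
      ((TensorProduct.assoc K P.Amb H M).symm (TensorProduct.map LinearMap.id P.lcoact u))) =
    TensorProduct.map ((TensorProduct.assoc K P.Amb H M).symm.toLinearMap ∘ₗ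
      TensorProduct.map LinearMap.id P.lcoact) LinearMap.id
      ((TensorProduct.assoc K P.Amb M H).symm (TensorProduct.map LinearMap.id P.rcoact u)) := by
  induction u using TensorProduct.induction_on with
  | zero => simp
  | add x y hx hy => simp only [map_add, hx, hy]
  | tmul w m =>
    have h1 : ∀ t : H ⊗[K] M, (TensorProduct.assoc K (P.Amb ⊗[K] H) M H).symm
        (TensorProduct.map LinearMap.id P.rcoact
        ((TensorProduct.assoc K P.Amb H M).symm (w ⊗ₜ t))) =
        TensorProduct.map ((TensorProduct.assoc K P.Amb H M).symm.toLinearMap ∘ₗ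
          TensorProduct.mk K P.Amb (H ⊗[K] M) w) LinearMap.id
          ((TensorProduct.assoc K H M H).symm (TensorProduct.map LinearMap.id P.rcoact t)) := by
      intro t
      induction t using TensorProduct.induction_on with
      | zero => simp
      | add x y hx hy => simp only [map_add, TensorProduct.tmul_add, hx, hy]
      | tmul h m =>
        simp only [TensorProduct.assoc_symm_tmul, TensorProduct.map_tmul, LinearMap.id_apply]
        generalize P.rcoact m = s
        induction s using TensorProduct.induction_on with
        | zero => simp
        | add x y hx hy => simp only [map_add, TensorProduct.tmul_add, hx, hy]
        | tmul m k => simp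
    have h2 : ∀ t : M ⊗[K] H, TensorProduct.map
        ((TensorProduct.assoc K P.Amb H M).symm.toLinearMap ∘ₗ
          TensorProduct.map LinearMap.id P.lcoact) LinearMap.id
        ((TensorProduct.assoc K P.Amb M H).symm (w ⊗ₜ t)) =
        TensorProduct.map ((TensorProduct.assoc K P.Amb H M).symm.toLinearMap ∘ₗ
          TensorProduct.mk K P.Amb (H ⊗[K] M) w) LinearMap.id
          (TensorProduct.map P.lcoact LinearMap.id t) := by
      intro t
      induction t using TensorProduct.induction_on with
      | zero => simp
      | add x y hx hy => simp only [map_add, TensorProduct.tmul_add, hx, hy]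
      | tmul m k => simp
    rw [TensorProduct.map_tmul, TensorProduct.map_tmul, LinearMap.id_apply, h1, h2,
      ← P.bicoassoc, LinearEquiv.symm_apply_apply]

theorem R_app_mem (P : HopfBimodule K H M) (u : P.Cot ⊗[K] M)
    (hu : P.Bal (TensorProduct.map P.val LinearMap.id u)) :
    P.R (P.app (TensorProduct.map P.val LinearMap.id u)) ∈
      LinearMap.range (TensorProduct.map P.val (LinearMap.id (M := H))) := by
  have hz : TensorProduct.map (P.bal ∘ₗ TensorProduct.map P.val LinearMap.id) LinearMap.id
      ((TensorProduct.assoc K P.Cot M H).symm (TensorProduct.map LinearMap.id P.rcoact u)) = 0 := by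
    rw [map_comp_left, ← assoc_symm_map, TensorProduct.map_id, map_map_apply,
      LinearMap.comp_id, LinearMap.id_comp]
    have e : TensorProduct.map P.val P.rcoact u =
      TensorProduct.map LinearMap.id P.rcoact (TensorProduct.map P.val LinearMap.id u) := by
      rw [map_map_apply]; rfl
    rw [e, bal, map_sub_left, ← bico, ← hu, ← assoc_symm_map,
      TensorProduct.map_id, map_map_apply, map_map_apply (f := P.R)]
    simp only [LinearMap.comp_id, LinearMap.id_comp, sub_self]
  obtain ⟨z, hz⟩ := exists_ker_left _ _ hz
  refine ⟨TensorProduct.map P.appCot LinearMap.id z, ?_⟩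
  rw [map_map_apply, val_comp_appCot, map_comp_left', hz, R_app, map_comp_left, ← assoc_symm_map,
    LinearMap.comp_id, TensorProduct.map_id, map_map_apply, map_map_apply (f := P.val)]
  simp only [LinearMap.comp_id, LinearMap.id_comp]

theorem R_mem (P : HopfBimodule K H M) {w : P.Amb} (hw : w ∈ P.cotensor) :
    P.R w ∈ LinearMap.range (TensorProduct.map P.val (LinearMap.id (M := H))) := by
  refine P.cotensor_induction (p := fun w => P.R w ∈
      LinearMap.range (TensorProduct.map P.val (LinearMap.id (M := H)))) ?_ ?_ ?_ hw
  · rw [map_zero]; exact zero_mem _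
  · intro n x hx
    cases n with
    | zero =>
      obtain ⟨h, rfl⟩ := P.ambZero.surjective x
      change P.R (P.i0 h) ∈ _
      refine ⟨TensorProduct.map (P.corestrict P.i0 P.i0_mem) LinearMap.id
        (Coalgebra.comul (R := K) h), ?_⟩
      rw [map_map_apply, R_i0]; rfl
    | succ n =>
      obtain ⟨y, h1, h2⟩ := P.cot_succ_cases hx
      rw [h1]
      exact P.R_app_mem _ h2
  · intro x y hx hy
    rw [map_add]; exact add_mem hx hy

/-- The projection of the direct sum onto `H`. -/
noncomputable def p0 (P : HopfBimodule K H M) : P.Amb →ₗ[K] H :=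
  P.desc fun n => match n with
    | 0 => P.ambZero.symm.toLinearMap
    | _ + 1 => 0

/-- The projection onto the summand `H ⊗ M`, followed by the counit of `H`. On the cotensor
coalgebra, this is the projection onto `H □ M = M`. -/
noncomputable def p1 (P : HopfBimodule K H M) : P.Amb →ₗ[K] M :=
  P.desc fun n => match n with
    | 0 => 0
    | n + 1 => (TensorProduct.lid K M).toLinearMap ∘ₗ
        TensorProduct.map (P.ambCounit n) LinearMap.id ∘ₗ (P.ambSucc n).symm.toLinearMap

@[simp]
theorem p0_i0 (P : HopfBimodule K H M) (h : H) : P.p0 (P.i0 h) = h := by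
  simp [p0, i0]

@[simp]
theorem p1_i0 (P : HopfBimodule K H M) (h : H) : P.p1 (P.i0 h) = 0 := by
  simp [p1, i0]

theorem p0_comp_i0 (P : HopfBimodule K H M) : P.p0 ∘ₗ P.i0 = LinearMap.id :=
  LinearMap.ext P.p0_i0

theorem p1_comp_i0 (P : HopfBimodule K H M) : P.p1 ∘ₗ P.i0 = 0 :=
  LinearMap.ext P.p1_i0

theorem p0_comp_appR (P : HopfBimodule K H M) (m : M) : P.p0 ∘ₗ P.appR m = 0 := by
  apply P.Amb_hom_ext
  intro n x
  simp [p0]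

theorem p1_comp_appR (P : HopfBimodule K H M) (m : M) :
    P.p1 ∘ₗ P.appR m = LinearMap.toSpanSingleton K M m ∘ₗ Coalgebra.counit := by
  apply P.Amb_hom_ext
  intro n x
  simp [p1, counit_ι]

theorem p0_comp_appL (P : HopfBimodule K H M) (w : P.Amb) : P.p0 ∘ₗ P.appL w = 0 :=
  LinearMap.ext fun m => LinearMap.congr_fun (P.p0_comp_appR m) w

theorem p1_comp_appL (P : HopfBimodule K H M) (w : P.Amb) :
    P.p1 ∘ₗ P.appL w = Coalgebra.counit (R := K) w • LinearMap.id :=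
  LinearMap.ext fun m => LinearMap.congr_fun (P.p1_comp_appR m) w

theorem p0_app (P : HopfBimodule K H M) (y : P.Amb ⊗[K] M) : P.p0 (P.app y) = 0 := by
  induction y using TensorProduct.induction_on with
  | zero => simp
  | add x y hx hy => simp only [map_add, hx, hy, add_zero]
  | tmul w m => exact LinearMap.congr_fun (P.p0_comp_appR m) w

theorem p1_app (P : HopfBimodule K H M) (y : P.Amb ⊗[K] M) : P.p1 (P.app y) =
    TensorProduct.lid K M (TensorProduct.map Coalgebra.counit LinearMap.id y) := by
  induction y using TensorProduct.induction_on with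
  | zero => simp
  | add x y hx hy => simp only [map_add, hx, hy]
  | tmul w m => exact LinearMap.congr_fun (P.p1_comp_appR m) w

theorem counit_eq (P : HopfBimodule K H M) (w : P.Amb) :
    Coalgebra.counit (R := K) w = Coalgebra.counit (R := K) (P.p0 w) := by
  induction w using P.Amb_induction with
  | h0 h => rw [counit_i0, p0_i0]
  | hadd x y hx hy => simp only [map_add, hx, hy]
  | happ w m ih => rw [counit_app, p0_app, map_zero]

theorem R_eq (P : HopfBimodule K H M) (w : P.Amb) :
    P.R w = TensorProduct.map LinearMap.id P.p0 (Coalgebra.comul (R := K) w) := by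
  induction w using P.Amb_induction with
  | h0 h => rw [R_i0, comul_i0, map_map_apply, p0_comp_i0, LinearMap.id_comp]
  | hadd x y hx hy => simp only [map_add, hx, hy]
  | happ w m ih =>
    rw [comul_app, map_add, map_map_apply, map_map_apply, p0_comp_i0, LinearMap.id_comp,
      show P.p0 ∘ₗ P.app = 0 from LinearMap.ext P.p0_app, TensorProduct.map_zero_right,
      LinearMap.zero_apply, add_zero, TensorProduct.map_id, LinearMap.id_apply]

theorem map_p0_p0_comul (P : HopfBimodule K H M) (w : P.Amb) :
    TensorProduct.map P.p0 P.p0 (Coalgebra.comul (R := K) w) =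
      Coalgebra.comul (R := K) (P.p0 w) := by
  induction w using P.Amb_induction with
  | h0 h => rw [comul_i0, map_map_apply, p0_comp_i0, TensorProduct.map_id, p0_i0]; rfl
  | hadd x y hx hy => simp only [map_add, hx, hy]
  | happ w m ih =>
    rw [comul_app_tmul, map_add, map_map_apply, map_map_apply, p0_comp_appL, p0_comp_appR,
      TensorProduct.map_zero_left, TensorProduct.map_zero_right, p0_app]
    simp

theorem map_p1_p0_comul (P : HopfBimodule K H M) (w : P.Amb) :
    TensorProduct.map P.p1 P.p0 (Coalgebra.comul (R := K) w) = P.rcoact (P.p1 w) := by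
  induction w using P.Amb_induction with
  | h0 h =>
    rw [comul_i0, map_map_apply, p1_comp_i0, TensorProduct.map_zero_left, p1_i0, map_zero]; rfl
  | hadd x y hx hy => simp only [map_add, hx, hy]
  | happ w m ih =>
    rw [comul_app_tmul, map_add, map_map_apply, map_map_apply, p1_comp_appL, p0_comp_appR,
      p0_comp_i0, TensorProduct.map_zero_right, TensorProduct.map_smul_left, TensorProduct.map_id,
      p1_app]
    simp

theorem map_p1_comul_appR {V : Type*} [AddCommGroup V] [Module K V] (P : HopfBimodule K H M)
    (f : P.Amb →ₗ[K] V) (w : P.Amb) (m : M) :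
    TensorProduct.map f P.p1 (Coalgebra.comul (R := K) (P.app (w ⊗ₜ m))) = f w ⊗ₜ m := by
  rw [comul_app_tmul, map_add, map_map_apply, map_map_apply, p1_comp_i0, p1_comp_appR,
    TensorProduct.map_zero_right, LinearMap.zero_apply, zero_add, LinearMap.comp_id,
    map_comp_right]
  have h := Coalgebra.lTensor_counit_comul (R := K) w
  rw [LinearMap.lTensor] at h
  have h2 : TensorProduct.map f (Coalgebra.counit (R := K)) (Coalgebra.comul (R := K) w) =
      f w ⊗ₜ 1 := by
    rw [← LinearMap.comp_id f, ← LinearMap.id_comp (Coalgebra.counit (R := K) (A := P.Amb)),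
      ← map_map_apply, h]
    simp
  rw [h2]
  simp

theorem map_p1_comul_app {V : Type*} [AddCommGroup V] [Module K V] (P : HopfBimodule K H M)
    (f : P.Amb →ₗ[K] V) (y : P.Amb ⊗[K] M) :
    TensorProduct.map f P.p1 (Coalgebra.comul (R := K) (P.app y)) =
      TensorProduct.map f LinearMap.id y := by
  induction y using TensorProduct.induction_on with
  | zero => simp
  | add x y hx hy => simp only [map_add, hx, hy]
  | tmul w m => rw [map_p1_comul_appR]; rfl

theorem π_succ (P : HopfBimodule K H M) (n : ℕ) (w : P.Amb) : P.π (n + 1) w =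
    P.ambSucc n (TensorProduct.map (P.π n) P.p1 (Coalgebra.comul (R := K) w)) := by
  induction w using P.Amb_induction with
  | h0 h =>
    rw [comul_i0, map_map_apply, p1_comp_i0, TensorProduct.map_zero_right, LinearMap.zero_apply,
      map_zero]
    exact P.π_ι_of_ne (by omega) _
  | hadd x y hx hy => simp only [map_add, hx, hy]
  | happ w m ih => rw [map_p1_comul_app, π_succ_app]

theorem π_zero (P : HopfBimodule K H M) (w : P.Amb) : P.π 0 w = P.ambZero (P.p0 w) := by
  induction w using P.Amb_induction with
  | h0 h => rw [p0_i0]; exact P.π_ι 0 _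
  | hadd x y hx hy => simp only [map_add, hx, hy]
  | happ w m ih =>
    rw [p0_app, map_zero]
    suffices h : P.π 0 ∘ₗ P.appR m = 0 from LinearMap.congr_fun h w
    apply P.Amb_hom_ext
    intro n x
    simp only [LinearMap.comp_apply, LinearMap.flip_apply, TensorProduct.mk_apply, app_ι]
    exact P.π_ι_of_ne (by omega) _

theorem comul_R (P : HopfBimodule K H M) (w : P.Amb) :
    TensorProduct.map LinearMap.id P.R (Coalgebra.comul (R := K) w) =
      TensorProduct.assoc K P.Amb P.Amb H (TensorProduct.map Coalgebra.comul LinearMap.id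
        (P.R w)) := by
  have e : P.R = TensorProduct.map LinearMap.id P.p0 ∘ₗ Coalgebra.comul := LinearMap.ext P.R_eq
  rw [e, map_comp_right, ← coassoc_map, map_assoc, map_map_apply, LinearMap.comp_apply,
    map_map_apply, TensorProduct.map_id, LinearMap.id_comp, LinearMap.comp_id, LinearMap.comp_id,
    LinearMap.id_comp]

theorem comul_bico (P : HopfBimodule K H M) (u : P.Amb ⊗[K] M) :
    TensorProduct.assoc K P.Amb (P.Amb ⊗[K] H) M
      (TensorProduct.map ((TensorProduct.assoc K P.Amb P.Amb H).toLinearMap ∘ₗ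
        TensorProduct.map Coalgebra.comul LinearMap.id) LinearMap.id
        ((TensorProduct.assoc K P.Amb H M).symm (TensorProduct.map LinearMap.id P.lcoact u))) =
    TensorProduct.map LinearMap.id ((TensorProduct.assoc K P.Amb H M).symm.toLinearMap ∘ₗ
      TensorProduct.map LinearMap.id P.lcoact) (TensorProduct.assoc K P.Amb P.Amb M
        (TensorProduct.map Coalgebra.comul LinearMap.id u)) := by
  induction u using TensorProduct.induction_on with
  | zero => simp
  | add x y hx hy => simp only [map_add, hx, hy]
  | tmul w m =>
    simp only [TensorProduct.map_tmul, LinearMap.id_apply]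
    have h2 : ∀ (s : P.Amb ⊗[K] P.Amb) (t : H ⊗[K] M),
        TensorProduct.assoc K P.Amb (P.Amb ⊗[K] H) M (TensorProduct.map
          ((TensorProduct.assoc K P.Amb P.Amb H).toLinearMap ∘ₗ TensorProduct.mk K _ H s)
          LinearMap.id t) = 
        TensorProduct.map LinearMap.id ((TensorProduct.assoc K P.Amb H M).symm.toLinearMap ∘ₗ
          (TensorProduct.mk K P.Amb (H ⊗[K] M)).flip t) s := by
      intro s t
      induction t using TensorProduct.induction_on with
      | zero => simp
      | add x y hx hy =>
        rw [map_add, map_add, hx, hy, map_add, LinearMap.comp_add, TensorProduct.map_add_right,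
          LinearMap.add_apply]
      | tmul h m =>
        induction s using TensorProduct.induction_on with
        | zero => simp
        | add x y hx hy =>
          rw [map_add (TensorProduct.mk K (P.Amb ⊗[K] P.Amb) H), LinearMap.comp_add,
            TensorProduct.map_add_left, LinearMap.add_apply, map_add, hx, hy, map_add]
        | tmul a b => simp
    have h1 : ∀ t : H ⊗[K] M, TensorProduct.map ((TensorProduct.assoc K P.Amb P.Amb H).toLinearMap ∘ₗ
        TensorProduct.map Coalgebra.comul LinearMap.id) LinearMap.id
        ((TensorProduct.assoc K P.Amb H M).symm (w ⊗ₜ t)) =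
        TensorProduct.map ((TensorProduct.assoc K P.Amb P.Amb H).toLinearMap ∘ₗ
          TensorProduct.mk K _ H (Coalgebra.comul (R := K) w)) LinearMap.id t := by
      intro t
      induction t using TensorProduct.induction_on with
      | zero => simp
      | add x y hx hy => simp only [map_add, TensorProduct.tmul_add, hx, hy]
      | tmul h m => simp
    have h3 : ∀ s : P.Amb ⊗[K] P.Amb, TensorProduct.map LinearMap.id
        ((TensorProduct.assoc K P.Amb H M).symm.toLinearMap ∘ₗ
          TensorProduct.map LinearMap.id P.lcoact) (TensorProduct.assoc K P.Amb P.Amb M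
            (s ⊗ₜ m)) =
        TensorProduct.map LinearMap.id ((TensorProduct.assoc K P.Amb H M).symm.toLinearMap ∘ₗ
          (TensorProduct.mk K P.Amb (H ⊗[K] M)).flip (P.lcoact m)) s := by
      intro s
      induction s using TensorProduct.induction_on with
      | zero => simp
      | add x y hx hy => simp only [map_add, TensorProduct.add_tmul, hx, hy]
      | tmul a b => simp
    rw [h1, h2, h3]

theorem comul_bal (P : HopfBimodule K H M) (u : P.Amb ⊗[K] M) (hu : P.Bal u) :
    TensorProduct.map LinearMap.id P.bal (TensorProduct.assoc K P.Amb P.Amb M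
      (TensorProduct.map Coalgebra.comul LinearMap.id u)) = 0 := by
  have e : TensorProduct.map LinearMap.id P.R ∘ₗ Coalgebra.comul =
      ((TensorProduct.assoc K P.Amb P.Amb H).toLinearMap ∘ₗ
        TensorProduct.map Coalgebra.comul LinearMap.id) ∘ₗ P.R := LinearMap.ext P.comul_R
  rw [bal, map_sub_right, ← comul_bico, map_assoc, map_map_apply, e, map_comp_left',
    LinearMap.comp_id, hu, sub_self]

theorem comul_app_mem (P : HopfBimodule K H M) {n : ℕ} (y : P.cot n ⊗[K] M)
    (hy : P.Bal (TensorProduct.map P.val LinearMap.id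
      (TensorProduct.map (P.ιCot n) LinearMap.id y)))
    (ih : ∀ x : P.cot n, Coalgebra.comul (R := K) (P.ι n x) ∈
      LinearMap.range (TensorProduct.map P.val P.val)) :
    Coalgebra.comul (R := K) (P.app (TensorProduct.map P.val LinearMap.id
      (TensorProduct.map (P.ιCot n) LinearMap.id y))) ∈
      LinearMap.range (TensorProduct.map P.val P.val) := by
  rw [comul_app]
  refine add_mem ?_ ?_
  · obtain ⟨z, hz⟩ := P.R_app_mem _ hy
    rw [← hz]
    refine ⟨TensorProduct.map LinearMap.id (P.corestrict P.i0 P.i0_mem) z, ?_⟩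
    rw [map_map_apply, map_map_apply]; rfl
  · set D := factor (TensorProduct.map P.val P.val) (map_injective P.val_injective P.val_injective)
      (Coalgebra.comul ∘ₗ P.ι n ∘ₗ (P.cot n).subtype) ih with hD
    have hD' : Coalgebra.comul ∘ₗ P.val ∘ₗ P.ιCot n = TensorProduct.map P.val P.val ∘ₗ D :=
      LinearMap.ext fun x => (factor_spec _ (map_injective P.val_injective P.val_injective)
        (Coalgebra.comul ∘ₗ P.ι n ∘ₗ (P.cot n).subtype) ih x).symm
    have e : TensorProduct.map (Coalgebra.comul (R := K)) LinearMap.id (TensorProduct.map P.val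
        LinearMap.id (TensorProduct.map (P.ιCot n) (LinearMap.id (M := M)) y)) =
        TensorProduct.map (TensorProduct.map P.val P.val) LinearMap.id
          (TensorProduct.map D LinearMap.id y) := by
      rw [map_map_apply, map_map_apply, map_map_apply, ← hD']; rfl
    set z := TensorProduct.assoc K P.Cot P.Cot M (TensorProduct.map D LinearMap.id y) with hz
    have e2 : TensorProduct.assoc K P.Amb P.Amb M (TensorProduct.map (Coalgebra.comul (R := K))
        LinearMap.id (TensorProduct.map P.val
        LinearMap.id (TensorProduct.map (P.ιCot n) (LinearMap.id (M := M)) y))) =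
        TensorProduct.map P.val (TensorProduct.map P.val LinearMap.id) z := by
      rw [e, ← map_assoc]
    have hz0 : TensorProduct.map LinearMap.id (P.bal ∘ₗ TensorProduct.map P.val LinearMap.id) z
        = 0 := by
      apply map_injective P.val_injective (g := LinearMap.id) Function.injective_id
      rw [map_zero, map_map_apply, LinearMap.comp_id, LinearMap.id_comp, map_comp_right, ← e2]
      exact P.comul_bal _ hy
    obtain ⟨t, ht⟩ := exists_ker_right _ _ hz0
    rw [e2, ← ht]
    refine ⟨TensorProduct.map LinearMap.id P.appCot t, ?_⟩
    rw [map_map_apply, val_comp_appCot, map_map_apply, map_map_apply]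
    simp only [LinearMap.comp_id, LinearMap.id_comp]

theorem comul_mem (P : HopfBimodule K H M) {w : P.Amb} (hw : w ∈ P.cotensor) :
    Coalgebra.comul (R := K) w ∈ LinearMap.range (TensorProduct.map P.val P.val) := by
  refine P.cotensor_induction (p := fun w => Coalgebra.comul (R := K) w ∈
      LinearMap.range (TensorProduct.map P.val P.val)) ?_ ?_ ?_ hw
  · rw [map_zero]; exact zero_mem _
  · intro n
    induction n with
    | zero =>
      intro x _
      obtain ⟨h, rfl⟩ := P.ambZero.surjective x
      change Coalgebra.comul (R := K) (P.i0 h) ∈ _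
      refine ⟨TensorProduct.map (P.corestrict P.i0 P.i0_mem) (P.corestrict P.i0 P.i0_mem)
        (Coalgebra.comul (R := K) h), ?_⟩
      rw [map_map_apply, comul_i0]; rfl
    | succ n ih =>
      intro x hx
      obtain ⟨y, h1, h2⟩ := P.cot_succ_cases hx
      rw [h1]
      exact P.comul_app_mem y h2 fun x => ih x x.2
  · intro x y hx hy
    rw [map_add]; exact add_mem hx hy

noncomputable instance cotCoalgebra (P : HopfBimodule K H M) : Coalgebra K P.Cot :=
  subCoalgebra P.val P.val_injective (fun t => P.comul_mem (P.val_mem t))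

theorem Amb_induction_ι (P : HopfBimodule K H M) {p : P.Amb → Prop} (h0 : p 0)
    (hι : ∀ n x, p (P.ι n x)) (hadd : ∀ x y, p x → p y → p (x + y)) (w : P.Amb) : p w :=
  DirectSum.induction_on w h0 hι hadd

theorem eventually_sum_π (P : HopfBimodule K H M) {V : Type*} [AddCommGroup V] [Module K V]
    (z : P.Amb ⊗[K] V) : ∃ N, ∀ N' ≥ N, z = ∑ n ∈ Finset.range N',
      TensorProduct.map (P.ι n) LinearMap.id (TensorProduct.map (P.π n) LinearMap.id z) := by
  have key : ∀ (w : P.Amb), ∃ N, ∀ N' ≥ N, w = ∑ n ∈ Finset.range N', P.ι n (P.π n w) := by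
    intro w
    induction w using P.Amb_induction_ι with
    | h0 => exact ⟨0, fun N' _ => by simp⟩
    | hι n x =>
      refine ⟨n + 1, fun N' hN => ?_⟩
      rw [Finset.sum_eq_single n, π_ι]
      · intro k _ hk
        rw [P.π_ι_of_ne hk.symm, map_zero]
      · intro h
        exact absurd (Finset.mem_range.2 (by omega)) h
    | hadd x y hx hy =>
      obtain ⟨N, hN⟩ := hx
      obtain ⟨N2, hN2⟩ := hy
      refine ⟨max N N2, fun N' h => ?_⟩
      simp only [map_add, Finset.sum_add_distrib]
      rw [← hN N' (le_trans (le_max_left _ _) h), ← hN2 N' (le_trans (le_max_right _ _) h)]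
  induction z using TensorProduct.induction_on with
  | zero => exact ⟨0, fun N' _ => by simp⟩
  | tmul w v =>
    obtain ⟨N, hN⟩ := key w
    refine ⟨N, fun N' h => ?_⟩
    simp only [TensorProduct.map_tmul, LinearMap.id_apply]
    rw [← TensorProduct.sum_tmul, ← hN N' h]
  | add x y hx hy =>
    obtain ⟨N, hN⟩ := hx
    obtain ⟨N2, hN2⟩ := hy
    refine ⟨max N N2, fun N' h => ?_⟩
    simp only [map_add, Finset.sum_add_distrib]
    rw [← hN N' (le_trans (le_max_left _ _) h), ← hN2 N' (le_trans (le_max_right _ _) h)]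

theorem tensor_ext_left (P : HopfBimodule K H M) {V : Type*} [AddCommGroup V] [Module K V]
    {z z' : P.Amb ⊗[K] V} (h : ∀ n, TensorProduct.map (P.π n) LinearMap.id z =
      TensorProduct.map (P.π n) LinearMap.id z') : z = z' := by
  obtain ⟨N, hN⟩ := P.eventually_sum_π z
  obtain ⟨N2, hN2⟩ := P.eventually_sum_π z'
  rw [hN (max N N2) (le_max_left _ _), hN2 (max N N2) (le_max_right _ _)]
  simp only [h]

theorem tensor_ext_right (P : HopfBimodule K H M) {V : Type*} [AddCommGroup V] [Module K V]
    {z z' : V ⊗[K] P.Amb} (h : ∀ n, TensorProduct.map LinearMap.id (P.π n) z =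
      TensorProduct.map LinearMap.id (P.π n) z') : z = z' := by
  apply (TensorProduct.comm K V P.Amb).injective
  apply P.tensor_ext_left
  intro n
  rw [TensorProduct.map_comm, TensorProduct.map_comm, h]

section Lift

variable {D : Type*} [AddCommGroup D] [Module K D] [Coalgebra K D]

/-- The components of the map to the cotensor coalgebra induced by maps `f : D → H` and
`g : D → M`: the map `(f ⊗ g ⊗ ⋯ ⊗ g) Δ^n`. -/
noncomputable def L (P : HopfBimodule K H M) (f : D →ₗ[K] H) (g : D →ₗ[K] M) :
    (n : ℕ) → D →ₗ[K] P.amb n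
  | 0 => P.ambZero.toLinearMap ∘ₗ f
  | n + 1 => (P.ambSucc n).toLinearMap ∘ₗ TensorProduct.map (L P f g n) g ∘ₗ Coalgebra.comul

/-- The components, as maps to the direct sum. -/
noncomputable def La (P : HopfBimodule K H M) (f : D →ₗ[K] H) (g : D →ₗ[K] M) (n : ℕ) :
    D →ₗ[K] P.Amb := P.ι n ∘ₗ P.L f g n

theorem La_zero (P : HopfBimodule K H M) (f : D →ₗ[K] H) (g : D →ₗ[K] M) :
    P.La f g 0 = P.i0 ∘ₗ f := rfl

theorem La_succ (P : HopfBimodule K H M) (f : D →ₗ[K] H) (g : D →ₗ[K] M) (n : ℕ) (d : D) :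
    P.La f g (n + 1) d = P.app (TensorProduct.map (P.La f g n) g (Coalgebra.comul (R := K) d)) := by
  have e : TensorProduct.map (P.La f g n) g (Coalgebra.comul (R := K) d) =
      TensorProduct.map (P.ι n) LinearMap.id
        (TensorProduct.map (P.L f g n) g (Coalgebra.comul (R := K) d)) := by
    rw [map_map_apply]; rfl
  rw [e, app_map_ι]
  rfl

theorem coassoc_symm_map (x : D) :
    (TensorProduct.assoc K D D D).symm (TensorProduct.map LinearMap.id Coalgebra.comul
      (Coalgebra.comul (R := K) x)) =
      TensorProduct.map Coalgebra.comul LinearMap.id (Coalgebra.comul (R := K) x) := by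
  rw [← coassoc_map, LinearEquiv.symm_apply_apply]

/-- The hypotheses of the universal property of the cotensor coalgebra: `f` is a coalgebra
homomorphism, and `g` is a homomorphism of bicomodules, where `H` coacts on `D` through `f`. -/
structure LiftData (P : HopfBimodule K H M) (f : D →ₗ[K] H) (g : D →ₗ[K] M) : Prop where
  comul_f : Coalgebra.comul ∘ₗ f = TensorProduct.map f f ∘ₗ Coalgebra.comul
  counit_f : Coalgebra.counit ∘ₗ f = Coalgebra.counit
  lcoact_g : P.lcoact ∘ₗ g = TensorProduct.map f g ∘ₗ Coalgebra.comul
  rcoact_g : P.rcoact ∘ₗ g = TensorProduct.map g f ∘ₗ Coalgebra.comul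

theorem LiftData.R_La {P : HopfBimodule K H M} {f : D →ₗ[K] H} {g : D →ₗ[K] M}
    (h : P.LiftData f g) (n : ℕ) :
    P.R ∘ₗ P.La f g n = TensorProduct.map (P.La f g n) f ∘ₗ Coalgebra.comul := by
  ext d
  simp only [LinearMap.comp_apply]
  cases n with
  | zero =>
    rw [La_zero, LinearMap.comp_apply, R_i0]
    have := LinearMap.congr_fun h.comul_f d
    simp only [LinearMap.comp_apply] at this
    rw [this, map_map_apply, LinearMap.id_comp]
  | succ n =>
    have e : P.La f g (n + 1) = P.app ∘ₗ TensorProduct.map (P.La f g n) g ∘ₗ Coalgebra.comul :=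
      LinearMap.ext (P.La_succ f g n)
    rw [La_succ, R_app, map_map_apply, LinearMap.id_comp, h.rcoact_g, map_comp_right',
      assoc_symm_map, coassoc_symm_map, map_map_apply, map_map_apply, e, LinearMap.id_comp,
      LinearMap.comp_id, LinearMap.comp_assoc]

theorem LiftData.bal_La {P : HopfBimodule K H M} {f : D →ₗ[K] H} {g : D →ₗ[K] M}
    (h : P.LiftData f g) (n : ℕ) (d : D) :
    P.Bal (TensorProduct.map (P.La f g n) g (Coalgebra.comul (R := K) d)) := by
  rw [Bal, map_map_apply, map_map_apply, h.R_La, h.lcoact_g, LinearMap.id_comp, LinearMap.id_comp,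
    map_comp_right', assoc_symm_map, coassoc_symm_map, map_map_apply, LinearMap.comp_id]

theorem LiftData.La_mem {P : HopfBimodule K H M} {f : D →ₗ[K] H} {g : D →ₗ[K] M}
    (h : P.LiftData f g) (n : ℕ) (d : D) : P.La f g n d ∈ P.cotensor := by
  induction n generalizing d with
  | zero => exact P.i0_mem _
  | succ n ih =>
    have e : TensorProduct.map (P.La f g n) g (Coalgebra.comul (R := K) d) =
        TensorProduct.map P.val LinearMap.id (TensorProduct.map (P.corestrict (P.La f g n) ih) g
          (Coalgebra.comul (R := K) d)) := by
      rw [map_map_apply]; rfl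
    have hb := h.bal_La n d
    rw [La_succ]
    rw [e] at hb ⊢
    exact P.app_mem _ hb

/-- The map to the direct sum with given components. -/
theorem exists_of_components (P : HopfBimodule K H M) (f : D →ₗ[K] H) (g : D →ₗ[K] M) 
    (hfin : ∀ d, ∃ N, ∀ n ≥ N, P.L f g n d = 0) (d : D) :
    LinearMap.pi (P.L f g) d ∈ LinearMap.range (LinearMap.pi P.π) := by
  obtain ⟨N, hN⟩ := hfin d
  refine ⟨∑ k ∈ Finset.range N, P.ι k (P.L f g k d), ?_⟩
  ext n
  simp only [LinearMap.pi_apply, map_sum]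
  by_cases hn : n < N
  · rw [Finset.sum_eq_single n, π_ι]
    · intro k _ hk
      rw [P.π_ι_of_ne hk]
    · intro h
      exact absurd (Finset.mem_range.2 hn) h
  · rw [hN n (by omega)]
    refine Finset.sum_eq_zero fun k hk => P.π_ι_of_ne ?_ _
    have := Finset.mem_range.1 hk
    omega

theorem pi_π_injective (P : HopfBimodule K H M) : Function.Injective (LinearMap.pi P.π) := by
  intro x y h
  exact P.Amb_ext fun n => congrFun h n

/-- The map to the direct sum with components `L f g n`. -/
noncomputable def liftAmb (P : HopfBimodule K H M) (f : D →ₗ[K] H) (g : D →ₗ[K] M)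
    (hfin : ∀ d, ∃ N, ∀ n ≥ N, P.L f g n d = 0) : D →ₗ[K] P.Amb :=
  factor (LinearMap.pi P.π) P.pi_π_injective (LinearMap.pi (P.L f g))
    (P.exists_of_components f g hfin)

theorem π_liftAmb (P : HopfBimodule K H M) (f : D →ₗ[K] H) (g : D →ₗ[K] M)
    (hfin : ∀ d, ∃ N, ∀ n ≥ N, P.L f g n d = 0) (n : ℕ) :
    P.π n ∘ₗ P.liftAmb f g hfin = P.L f g n :=
  LinearMap.ext fun d => congrFun (factor_spec (LinearMap.pi P.π) P.pi_π_injective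
    (LinearMap.pi (P.L f g)) (P.exists_of_components f g hfin) d) n

theorem LiftData.liftAmb_mem {P : HopfBimodule K H M} {f : D →ₗ[K] H} {g : D →ₗ[K] M}
    (h : P.LiftData f g) (hfin : ∀ d, ∃ N, ∀ n ≥ N, P.L f g n d = 0) (d : D) :
    P.liftAmb f g hfin d ∈ P.cotensor := by
  rw [mem_cotensor]
  intro n
  have := P.mem_cotensor.1 (h.La_mem n d) n
  rw [La, LinearMap.comp_apply, π_ι] at this
  rw [← LinearMap.comp_apply, π_liftAmb]
  exact this

theorem p0_liftAmb (P : HopfBimodule K H M) (f : D →ₗ[K] H) (g : D →ₗ[K] M)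
    (hfin : ∀ d, ∃ N, ∀ n ≥ N, P.L f g n d = 0) : P.p0 ∘ₗ P.liftAmb f g hfin = f := by
  ext d
  apply P.ambZero.injective
  rw [LinearMap.comp_apply, ← π_zero]
  exact LinearMap.congr_fun (P.π_liftAmb f g hfin 0) d

theorem LiftData.comul_liftAmb_p0 {P : HopfBimodule K H M} {f : D →ₗ[K] H} {g : D →ₗ[K] M}
    (h : P.LiftData f g) (hfin : ∀ d, ∃ N, ∀ n ≥ N, P.L f g n d = 0) (d : D) :
    TensorProduct.map LinearMap.id P.p0 (Coalgebra.comul (R := K) (P.liftAmb f g hfin d)) =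
      TensorProduct.map (P.liftAmb f g hfin) f (Coalgebra.comul (R := K) d) := by
  rw [← R_eq]
  apply P.tensor_ext_left
  intro n
  have e := LinearMap.congr_fun (P.ambRco_π n) (P.liftAmb f g hfin d)
  have e2 := LinearMap.congr_fun (h.R_La n) d
  have e3 : P.L f g n = P.π n ∘ₗ P.La f g n := LinearMap.ext fun d => (P.π_ι n _).symm
  simp only [LinearMap.comp_apply] at e e2
  have e4 := LinearMap.congr_fun (P.ambRco_π n) (P.La f g n d)
  have e5 := LinearMap.congr_fun (P.π_liftAmb f g hfin n) d
  simp only [LinearMap.comp_apply] at e4 e5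
  rw [← e, map_map_apply, π_liftAmb, LinearMap.id_comp, e5, e3, LinearMap.comp_apply, e4, e2,
    map_map_apply, LinearMap.id_comp]

theorem comul_liftAmb_p1 (P : HopfBimodule K H M) (f : D →ₗ[K] H) (g : D →ₗ[K] M)
    (hfin : ∀ d, ∃ N, ∀ n ≥ N, P.L f g n d = 0) (d : D) :
    TensorProduct.map LinearMap.id P.p1 (Coalgebra.comul (R := K) (P.liftAmb f g hfin d)) =
      TensorProduct.map (P.liftAmb f g hfin) g (Coalgebra.comul (R := K) d) := by
  apply P.tensor_ext_left
  intro n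
  rw [map_map_apply, map_map_apply, π_liftAmb]
  apply (P.ambSucc n).injective
  simp only [LinearMap.comp_id, LinearMap.id_comp]
  rw [← π_succ]
  exact LinearMap.congr_fun (P.π_liftAmb f g hfin (n + 1)) d

theorem LiftData.comul_liftAmb {P : HopfBimodule K H M} {f : D →ₗ[K] H} {g : D →ₗ[K] M}
    (h : P.LiftData f g) (hfin : ∀ d, ∃ N, ∀ n ≥ N, P.L f g n d = 0) (d : D) :
    Coalgebra.comul (R := K) (P.liftAmb f g hfin d) =
      TensorProduct.map (P.liftAmb f g hfin) (P.liftAmb f g hfin) (Coalgebra.comul (R := K) d) := by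
  apply P.tensor_ext_right
  intro n
  induction n generalizing d with
  | zero =>
    have e : P.π 0 = P.ambZero.toLinearMap ∘ₗ P.p0 := LinearMap.ext P.π_zero
    have e2 := h.comul_liftAmb_p0 hfin d
    rw [e, map_comp_right, e2, map_map_apply, map_map_apply, LinearMap.id_comp,
      LinearMap.comp_assoc, p0_liftAmb]
  | succ n ih =>
    set ℓ := P.liftAmb f g hfin with hℓ
    have ih' : (TensorProduct.map LinearMap.id (P.π n) ∘ₗ Coalgebra.comul) ∘ₗ ℓ =
        TensorProduct.map ℓ (P.L f g n) ∘ₗ Coalgebra.comul := by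
      ext d
      simp only [LinearMap.comp_apply]
      rw [ih, map_map_apply, π_liftAmb, LinearMap.id_comp]
    have e : P.π (n + 1) = ((P.ambSucc n).toLinearMap ∘ₗ TensorProduct.map (P.π n) P.p1) ∘ₗ
      Coalgebra.comul := LinearMap.ext (P.π_succ n)
    have e1 := P.comul_liftAmb_p1 f g hfin d
    rw [map_map_apply, π_liftAmb, LinearMap.id_comp, e, map_comp_right', ← coassoc_map,
      map_comp_right, map_assoc, map_map_apply, LinearMap.comp_id]
    have e4 : TensorProduct.map (TensorProduct.map LinearMap.id (P.π n) ∘ₗ Coalgebra.comul) P.p1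
        (Coalgebra.comul (R := K) (ℓ d)) =
        TensorProduct.map (TensorProduct.map ℓ (P.L f g n)) g
          (TensorProduct.map Coalgebra.comul LinearMap.id (Coalgebra.comul (R := K) d)) := by
      rw [map_map_apply, ← ih', LinearMap.comp_id, ← LinearMap.comp_id (TensorProduct.map _ _ ∘ₗ _),
        ← LinearMap.id_comp P.p1, ← map_map_apply, e1, map_map_apply]
      rfl
    rw [e4, ← map_assoc, coassoc_map, map_map_apply, map_map_apply]
    rfl

/-- Naturality of the components. -/
theorem L_comp (P : HopfBimodule K H M) {C : Type*} [AddCommGroup C] [Module K C] [Coalgebra K C]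
    (f : D →ₗ[K] H) (g : D →ₗ[K] M) (φ : C →ₗ[K] D)
    (hφ : Coalgebra.comul ∘ₗ φ = TensorProduct.map φ φ ∘ₗ Coalgebra.comul) (n : ℕ) :
    P.L (f ∘ₗ φ) (g ∘ₗ φ) n = P.L f g n ∘ₗ φ := by
  induction n with
  | zero => rfl
  | succ n ih =>
    rw [L, L, ih]
    ext c
    have := LinearMap.congr_fun hφ c
    simp only [LinearMap.comp_apply] at this ⊢
    rw [this, map_map_apply]

theorem π_eq_L (P : HopfBimodule K H M) (F : D →ₗ[K] P.Amb)
    (hF : Coalgebra.comul ∘ₗ F = TensorProduct.map F F ∘ₗ Coalgebra.comul) (n : ℕ) :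
    P.π n ∘ₗ F = P.L (P.p0 ∘ₗ F) (P.p1 ∘ₗ F) n := by
  induction n with
  | zero => exact LinearMap.ext fun d => P.π_zero _
  | succ n ih =>
    rw [L, ← ih]
    ext d
    have := LinearMap.congr_fun hF d
    simp only [LinearMap.comp_apply] at this ⊢
    rw [π_succ, this, map_map_apply]
    rfl

/-- The first two components, on the cotensor coalgebra. -/
noncomputable def q0 (P : HopfBimodule K H M) : P.Cot →ₗ[K] H := P.p0 ∘ₗ P.val

/-- The projection of the cotensor coalgebra onto `M`. -/
noncomputable def q1 (P : HopfBimodule K H M) : P.Cot →ₗ[K] M := P.p1 ∘ₗ P.val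

theorem val_comul (P : HopfBimodule K H M) (t : P.Cot) :
    TensorProduct.map P.val P.val (Coalgebra.comul (R := K) t) =
      Coalgebra.comul (R := K) (P.val t) :=
  factor_spec _ (map_injective P.val_injective P.val_injective) (Coalgebra.comul ∘ₗ P.val)
    (fun t => P.comul_mem (P.val_mem t)) t

theorem val_counit (P : HopfBimodule K H M) (t : P.Cot) :
    Coalgebra.counit (R := K) t = Coalgebra.counit (R := K) (P.val t) := rfl

theorem lcoact_p1 (P : HopfBimodule K H M) {w : P.Amb} (hw : w ∈ P.cotensor) :
    P.lcoact (P.p1 w) = TensorProduct.map P.p0 P.p1 (Coalgebra.comul (R := K) w) := by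
  refine P.cotensor_induction (p := fun w => P.lcoact (P.p1 w) =
    TensorProduct.map P.p0 P.p1 (Coalgebra.comul (R := K) w)) ?_ ?_ ?_ hw
  · simp
  · intro n x hx
    cases n with
    | zero =>
      obtain ⟨h, rfl⟩ := P.ambZero.surjective x
      change P.lcoact (P.p1 (P.i0 h)) = TensorProduct.map _ _ (Coalgebra.comul (R := K) (P.i0 h))
      rw [comul_i0, map_map_apply, p1_comp_i0, p1_i0, TensorProduct.map_zero_right]
      simp
    | succ n =>
      obtain ⟨y, h1, h2⟩ := P.cot_succ_cases hx
      rw [h1, map_p1_comul_app, p1_app]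
      generalize TensorProduct.map P.val LinearMap.id
        (TensorProduct.map (P.ιCot n) (LinearMap.id (M := M)) y) = u at h2 ⊢
      have e := congrArg (TensorProduct.map ((TensorProduct.lid K H).toLinearMap ∘ₗ
        TensorProduct.map Coalgebra.counit LinearMap.id) (LinearMap.id (M := M))) h2
      have e1 : ((TensorProduct.lid K H).toLinearMap ∘ₗ
        TensorProduct.map Coalgebra.counit LinearMap.id) ∘ₗ P.R = P.p0 := by
        ext w
        simp only [LinearMap.comp_apply, LinearEquiv.coe_coe]
        rw [R_eq, map_map_apply, LinearMap.id_comp, LinearMap.comp_id, lid_map, Amb_lcounit]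
      rw [map_map_apply, e1, LinearMap.comp_id] at e
      rw [e]
      have key : ∀ u : P.Amb ⊗[K] M, P.lcoact (TensorProduct.lid K M
          (TensorProduct.map Coalgebra.counit LinearMap.id u)) =
          TensorProduct.map ((TensorProduct.lid K H).toLinearMap ∘ₗ
            TensorProduct.map Coalgebra.counit LinearMap.id) (LinearMap.id (M := M))
            ((TensorProduct.assoc K P.Amb H M).symm
              (TensorProduct.map LinearMap.id P.lcoact u)) := by
        intro u
        induction u using TensorProduct.induction_on with
        | zero => simp
        | add x y hx hy => simp only [map_add, hx, hy]
        | tmul w m =>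
          simp only [TensorProduct.map_tmul, LinearMap.id_apply, TensorProduct.lid_tmul,
            map_smul]
          generalize P.lcoact m = t
          induction t using TensorProduct.induction_on with
          | zero => simp
          | add x y hx hy => simp only [map_add, TensorProduct.tmul_add, smul_add, hx, hy]
          | tmul h m => simp [TensorProduct.smul_tmul']
      exact key u
  · intro x y hx hy
    simp only [map_add, hx, hy]

end Lift

/-- The homogeneous elements of degree `n` in the tensor square of the direct sum. -/
noncomputable def deg (P : HopfBimodule K H M) (n : ℕ) : Submodule K (P.Amb ⊗[K] P.Amb) :=
  Submodule.span K {z | ∃ a b u v, a + b = n ∧ z = P.ι a u ⊗ₜ P.ι b v}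

theorem comul_ι_mem_deg (P : HopfBimodule K H M) (n : ℕ) (x : P.amb n) :
    Coalgebra.comul (R := K) (P.ι n x) ∈ P.deg n := by
  induction n with
  | zero =>
    obtain ⟨h, rfl⟩ := P.ambZero.surjective x
    change Coalgebra.comul (R := K) (P.i0 h) ∈ _
    rw [comul_i0]
    generalize Coalgebra.comul (R := K) h = t
    induction t using TensorProduct.induction_on with
    | zero => rw [map_zero]; exact zero_mem _
    | add x y hx hy => rw [map_add]; exact add_mem hx hy
    | tmul h k => exact Submodule.subset_span ⟨0, 0, P.ambZero h, P.ambZero k, rfl, rfl⟩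
  | succ n ih =>
    obtain ⟨y, rfl⟩ := (P.ambSucc n).surjective x
    induction y using TensorProduct.induction_on with
    | zero => simp only [map_zero]; exact zero_mem _
    | add x y hx hy => simp only [map_add]; exact add_mem hx hy
    | tmul x m =>
      rw [← app_ι, comul_app_tmul]
      refine add_mem ?_ ?_
      · generalize P.rcoact m = t
        induction t using TensorProduct.induction_on with
        | zero => rw [map_zero]; exact zero_mem _
        | add x y hx hy => rw [map_add]; exact add_mem hx hy
        | tmul m k =>
          refine Submodule.subset_span ⟨n + 1, 0, P.ambSucc n (x ⊗ₜ m), P.ambZero k, rfl, ?_⟩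
          simp [i0]
      · have : P.deg n ≤ (P.deg (n + 1)).comap (TensorProduct.map LinearMap.id (P.appR m)) := by
          refine Submodule.span_le.2 ?_
          rintro _ ⟨a, b, u, v, hab, rfl⟩
          refine Submodule.subset_span ⟨a, b + 1, u, P.ambSucc b (v ⊗ₜ m), by omega, ?_⟩
          simp
        exact this (ih x)

/-- The product of the projections onto `H`. -/
noncomputable def f2 (P : HopfBimodule K H M) : P.Amb ⊗[K] P.Amb →ₗ[K] H :=
  LinearMap.mul' K H ∘ₗ TensorProduct.map P.p0 P.p0

/-- The map `x ⊗ y ↦ x_0 y_1 + x_1 y_0`, where the indices denote the projections onto `H`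
and `M`. -/
noncomputable def g2 (P : HopfBimodule K H M) : P.Amb ⊗[K] P.Amb →ₗ[K] M :=
  TensorProduct.lift P.lact ∘ₗ TensorProduct.map P.p0 P.p1 +
    TensorProduct.lift P.ract ∘ₗ TensorProduct.map P.p1 P.p0

theorem f2_tmul (P : HopfBimodule K H M) (x y : P.Amb) :
    P.f2 (x ⊗ₜ y) = P.p0 x * P.p0 y := by simp [f2]

theorem g2_tmul (P : HopfBimodule K H M) (x y : P.Amb) :
    P.g2 (x ⊗ₜ y) = P.lact (P.p0 x) (P.p1 y) + P.ract (P.p1 x) (P.p0 y) := by simp [g2]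

theorem L_f2_g2_eq_zero (P : HopfBimodule K H M) (n : ℕ) (i j : ℕ) (u : P.amb i) (v : P.amb j)
    (hij : i + j < n) : P.L P.f2 P.g2 n (P.ι i u ⊗ₜ P.ι j v) = 0 := by
  induction n generalizing i j with
  | zero => omega
  | succ n ih =>
    suffices h : ∀ s ∈ P.deg i, ∀ t ∈ P.deg j, TensorProduct.map (P.L P.f2 P.g2 n) P.g2
        (TensorProduct.AlgebraTensorModule.tensorTensorTensorComm K K K K _ _ _ _ (s ⊗ₜ t)) = 0 by
      rw [L, LinearMap.comp_apply, LinearMap.comp_apply, TensorProduct.comul_tmul,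
        h _ (P.comul_ι_mem_deg i u) _ (P.comul_ι_mem_deg j v), map_zero]
    intro s hs t ht
    induction hs using Submodule.span_induction with
    | zero => simp
    | add x y _ _ hx hy => simp only [TensorProduct.add_tmul, map_add, hx, hy, add_zero]
    | smul c x _ hx => simp only [← TensorProduct.smul_tmul', map_smul, hx, smul_zero]
    | mem x hx =>
      obtain ⟨a, c, p, q, hac, rfl⟩ := hx
      induction ht using Submodule.span_induction with
      | zero => simp
      | add x y _ _ hx hy => simp only [TensorProduct.tmul_add, map_add, hx, hy, add_zero]
      | smul c x _ hx => simp only [TensorProduct.tmul_smul, map_smul, hx, smul_zero]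
      | mem x hx =>
        obtain ⟨b, d, r, k, hbd, rfl⟩ := hx
        rw [TensorProduct.AlgebraTensorModule.tensorTensorTensorComm_tmul, TensorProduct.map_tmul]
        by_cases h : a + b < n
        · rw [ih _ _ _ _ h, TensorProduct.zero_tmul]
        · obtain rfl : c = 0 := by omega
          obtain rfl : d = 0 := by omega
          obtain ⟨q, rfl⟩ := P.ambZero.surjective q
          obtain ⟨k, rfl⟩ := P.ambZero.surjective k
          change _ ⊗ₜ P.g2 (P.i0 q ⊗ₜ P.i0 k) = 0
          rw [g2_tmul, p1_i0, p1_i0]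
          simp

theorem L_f2_g2_fin (P : HopfBimodule K H M) (z : P.Amb ⊗[K] P.Amb) :
    ∃ N, ∀ n ≥ N, P.L P.f2 P.g2 n z = 0 := by
  have hadd : ∀ x y : P.Amb ⊗[K] P.Amb, (∃ N, ∀ n ≥ N, P.L P.f2 P.g2 n x = 0) →
      (∃ N, ∀ n ≥ N, P.L P.f2 P.g2 n y = 0) → (∃ N, ∀ n ≥ N, P.L P.f2 P.g2 n (x + y) = 0) := by
    rintro x y ⟨N, hN⟩ ⟨N2, hN2⟩
    refine ⟨max N N2, fun n h => ?_⟩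
    rw [map_add, hN n (le_trans (le_max_left _ _) h), hN2 n (le_trans (le_max_right _ _) h),
      add_zero]
  induction z using TensorProduct.induction_on with
  | zero => exact ⟨0, fun n _ => map_zero _⟩
  | add x y hx hy => exact hadd x y hx hy
  | tmul w w' =>
    induction w using P.Amb_induction_ι with
    | h0 => exact ⟨0, fun n _ => by rw [TensorProduct.zero_tmul, map_zero]⟩
    | hadd x y hx hy => rw [TensorProduct.add_tmul]; exact hadd _ _ hx hy
    | hι i u =>
      induction w' using P.Amb_induction_ι with
      | h0 => exact ⟨0, fun n _ => by rw [TensorProduct.tmul_zero, map_zero]⟩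
      | hadd x y hx hy => rw [TensorProduct.tmul_add]; exact hadd _ _ hx hy
      | hι j v => exact ⟨i + j + 1, fun n h => P.L_f2_g2_eq_zero n i j u v (by omega)⟩

theorem comul_map_map {D D' C C' : Type*} [AddCommGroup D] [Module K D] [Coalgebra K D]
    [AddCommGroup D'] [Module K D'] [Coalgebra K D'] [AddCommGroup C] [Module K C] [Coalgebra K C]
    [AddCommGroup C'] [Module K C'] [Coalgebra K C'] (φ : C →ₗ[K] D) (ψ : C' →ₗ[K] D')
    (hφ : Coalgebra.comul ∘ₗ φ = TensorProduct.map φ φ ∘ₗ Coalgebra.comul)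
    (hψ : Coalgebra.comul ∘ₗ ψ = TensorProduct.map ψ ψ ∘ₗ Coalgebra.comul) :
    Coalgebra.comul ∘ₗ TensorProduct.map φ ψ = TensorProduct.map (TensorProduct.map φ ψ)
      (TensorProduct.map φ ψ) ∘ₗ Coalgebra.comul := by
  ext x y
  have h1 := LinearMap.congr_fun hφ x
  have h2 := LinearMap.congr_fun hψ y
  simp only [LinearMap.comp_apply] at h1 h2
  simp only [TensorProduct.AlgebraTensorModule.curry_apply, TensorProduct.curry_apply,
    LinearMap.coe_restrictScalars, LinearMap.comp_apply, TensorProduct.map_tmul,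
    TensorProduct.comul_tmul, h1, h2]
  generalize Coalgebra.comul (R := K) x = s
  generalize Coalgebra.comul (R := K) y = t
  induction s using TensorProduct.induction_on with
  | zero => simp
  | add x y hx hy => simp only [TensorProduct.add_tmul, map_add, hx, hy]
  | tmul a b =>
    induction t using TensorProduct.induction_on with
    | zero => simp
    | add x y hx hy => simp only [TensorProduct.tmul_add, map_add, hx, hy]
    | tmul c d => simp

theorem comul_comp_val (P : HopfBimodule K H M) :
    Coalgebra.comul ∘ₗ P.val = TensorProduct.map P.val P.val ∘ₗ Coalgebra.comul (R := K) :=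
  LinearMap.ext fun t => (P.val_comul t).symm

/-- The inclusion of the tensor square of the cotensor coalgebra. -/
noncomputable abbrev val2 (P : HopfBimodule K H M) : P.Cot ⊗[K] P.Cot →ₗ[K] P.Amb ⊗[K] P.Amb :=
  TensorProduct.map P.val P.val

theorem liftData_mul (P : HopfBimodule K H M) : P.LiftData (P.f2 ∘ₗ P.val2) (P.g2 ∘ₗ P.val2) where
  comul_f := by
    ext x y
    simp only [TensorProduct.AlgebraTensorModule.curry_apply, TensorProduct.curry_apply,
      LinearMap.coe_restrictScalars, LinearMap.comp_apply, TensorProduct.map_tmul,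
      TensorProduct.comul_tmul, f2_tmul, Bialgebra.comul_mul, ← map_p0_p0_comul, ← val_comul,
      map_map_apply]
    generalize Coalgebra.comul (R := K) x = s
    generalize Coalgebra.comul (R := K) y = t
    induction s using TensorProduct.induction_on with
    | zero => simp
    | add x y hx hy => simp only [TensorProduct.add_tmul, map_add, hx, hy, add_mul]
    | tmul a b =>
      induction t using TensorProduct.induction_on with
      | zero => simp
      | add x y hx hy => simp only [TensorProduct.tmul_add, map_add, hx, hy, mul_add]
      | tmul c d => simp [f2_tmul]
  counit_f := by
    ext x y
    simp [f2_tmul, val_counit, ← counit_eq, mul_comm]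
  lcoact_g := by
    ext x y
    simp only [TensorProduct.AlgebraTensorModule.curry_apply, TensorProduct.curry_apply,
      LinearMap.coe_restrictScalars, LinearMap.comp_apply, TensorProduct.map_tmul,
      TensorProduct.comul_tmul, g2_tmul, map_add, P.lcoact_lact, P.lcoact_ract,
      P.lcoact_p1 (P.val_mem _), ← map_p0_p0_comul, ← val_comul, map_map_apply]
    generalize Coalgebra.comul (R := K) x = s
    generalize Coalgebra.comul (R := K) y = t
    induction s using TensorProduct.induction_on with
    | zero => simp
    | add x y hx hy =>
      simp only [TensorProduct.add_tmul, map_add, ← hx, ← hy, LinearMap.add_apply]; abel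
    | tmul a b =>
      induction t using TensorProduct.induction_on with
      | zero => simp
      | add x y hx hy => simp only [TensorProduct.tmul_add, map_add, ← hx, ← hy]; abel
      | tmul c d => simp [f2_tmul, g2_tmul, TensorProduct.tmul_add]
  rcoact_g := by
    ext x y
    simp only [TensorProduct.AlgebraTensorModule.curry_apply, TensorProduct.curry_apply,
      LinearMap.coe_restrictScalars, LinearMap.comp_apply, TensorProduct.map_tmul,
      TensorProduct.comul_tmul, g2_tmul, map_add, P.rcoact_lact, P.rcoact_ract,
      ← map_p1_p0_comul, ← map_p0_p0_comul, ← val_comul, map_map_apply]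
    generalize Coalgebra.comul (R := K) x = s
    generalize Coalgebra.comul (R := K) y = t
    induction s using TensorProduct.induction_on with
    | zero => simp
    | add x y hx hy =>
      simp only [TensorProduct.add_tmul, map_add, ← hx, ← hy, LinearMap.add_apply]; abel
    | tmul a b =>
      induction t using TensorProduct.induction_on with
      | zero => simp
      | add x y hx hy => simp only [TensorProduct.tmul_add, map_add, ← hx, ← hy]; abel
      | tmul c d => simp [f2_tmul, g2_tmul, TensorProduct.add_tmul]

theorem L_mul_fin (P : HopfBimodule K H M) (z : P.Cot ⊗[K] P.Cot) :
    ∃ N, ∀ n ≥ N, P.L (P.f2 ∘ₗ P.val2) (P.g2 ∘ₗ P.val2) n z = 0 := by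
  obtain ⟨N, hN⟩ := P.L_f2_g2_fin (P.val2 z)
  refine ⟨N, fun n h => ?_⟩
  rw [P.L_comp _ _ _ (comul_map_map _ _ P.comul_comp_val P.comul_comp_val)]
  exact hN n h

/-- The multiplication of the cotensor coalgebra: the unique coalgebra homomorphism `x ⊗ y ↦ x y`
for which `(x y)_0 = x_0 y_0` and `(x y)_1 = x_0 y_1 + x_1 y_0`. -/
noncomputable def mulCot (P : HopfBimodule K H M) : P.Cot ⊗[K] P.Cot →ₗ[K] P.Cot :=
  P.corestrict (P.liftAmb (P.f2 ∘ₗ P.val2) (P.g2 ∘ₗ P.val2) P.L_mul_fin)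
    (P.liftData_mul.liftAmb_mem P.L_mul_fin)

theorem p1_liftAmb {D : Type*} [AddCommGroup D] [Module K D] [Coalgebra K D]
    (P : HopfBimodule K H M) {f : D →ₗ[K] H} {g : D →ₗ[K] M} (h : P.LiftData f g)
    (hfin : ∀ d, ∃ N, ∀ n ≥ N, P.L f g n d = 0) : P.p1 ∘ₗ P.liftAmb f g hfin = g := by
  have e : P.p1 = (TensorProduct.lid K M).toLinearMap ∘ₗ
      TensorProduct.map Coalgebra.counit P.p1 ∘ₗ Coalgebra.comul := by
    ext w
    simp only [LinearMap.comp_apply, LinearEquiv.coe_coe]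
    rw [lid_map, Amb_lcounit]
  ext d
  rw [e]
  simp only [LinearMap.comp_apply, LinearEquiv.coe_coe]
  have := P.comul_liftAmb_p1 f g hfin d
  have e2 : TensorProduct.map Coalgebra.counit P.p1
      (Coalgebra.comul (R := K) (P.liftAmb f g hfin d)) =
      TensorProduct.map Coalgebra.counit LinearMap.id (TensorProduct.map LinearMap.id P.p1
        (Coalgebra.comul (R := K) (P.liftAmb f g hfin d))) := by
    rw [map_map_apply]; rfl
  have e3 : Coalgebra.counit ∘ₗ P.liftAmb f g hfin = Coalgebra.counit (R := K) := by
    ext d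
    rw [LinearMap.comp_apply, counit_eq, ← LinearMap.comp_apply P.p0, p0_liftAmb]
    exact LinearMap.congr_fun h.counit_f d
  rw [e2, this, map_map_apply, e3, LinearMap.id_comp, lid_map, lcounit_map]

theorem q0_mulCot (P : HopfBimodule K H M) (x y : P.Cot) :
    P.q0 (P.mulCot (x ⊗ₜ y)) = P.q0 x * P.q0 y := by
  have := LinearMap.congr_fun (P.p0_liftAmb _ _ P.L_mul_fin) (x ⊗ₜ[K] y)
  exact this.trans (P.f2_tmul _ _)

theorem q1_mulCot (P : HopfBimodule K H M) (x y : P.Cot) :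
    P.q1 (P.mulCot (x ⊗ₜ y)) = P.lact (P.q0 x) (P.q1 y) + P.ract (P.q1 x) (P.q0 y) := by
  have := LinearMap.congr_fun (P.p1_liftAmb P.liftData_mul P.L_mul_fin) (x ⊗ₜ[K] y)
  exact this.trans (P.g2_tmul _ _)

theorem comul_mulCot (P : HopfBimodule K H M) :
    Coalgebra.comul ∘ₗ P.mulCot = TensorProduct.map P.mulCot P.mulCot ∘ₗ
      Coalgebra.comul (R := K) := by
  ext x y
  refine map_injective P.val_injective P.val_injective ?_
  have := P.liftData_mul.comul_liftAmb P.L_mul_fin (x ⊗ₜ[K] y)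
  simp only [TensorProduct.AlgebraTensorModule.curry_apply, TensorProduct.curry_apply,
      LinearMap.coe_restrictScalars, LinearMap.comp_apply]
  rw [val_comul, map_map_apply]
  exact this

theorem counit_eq_q0 (P : HopfBimodule K H M) (x : P.Cot) :
    Coalgebra.counit (R := K) x = Coalgebra.counit (R := K) (P.q0 x) :=
  P.counit_eq (P.val x)

/-- Coalgebra homomorphisms to the cotensor coalgebra are determined by their first two
components. -/
theorem cot_hom_ext {D : Type*} [AddCommGroup D] [Module K D] [Coalgebra K D]
    (P : HopfBimodule K H M) {F G : D →ₗ[K] P.Cot}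
    (hF : Coalgebra.comul ∘ₗ F = TensorProduct.map F F ∘ₗ Coalgebra.comul)
    (hG : Coalgebra.comul ∘ₗ G = TensorProduct.map G G ∘ₗ Coalgebra.comul)
    (h0 : P.q0 ∘ₗ F = P.q0 ∘ₗ G) (h1 : P.q1 ∘ₗ F = P.q1 ∘ₗ G) : F = G := by
  have key : ∀ F : D →ₗ[K] P.Cot,
      Coalgebra.comul ∘ₗ F = TensorProduct.map F F ∘ₗ Coalgebra.comul →
      ∀ n, P.π n ∘ₗ P.val ∘ₗ F = P.L (P.q0 ∘ₗ F) (P.q1 ∘ₗ F) n := by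
    intro F hF n
    refine P.π_eq_L (P.val ∘ₗ F) ?_ n
    rw [← LinearMap.comp_assoc, comul_comp_val, LinearMap.comp_assoc, hF, ← LinearMap.comp_assoc,
      ← TensorProduct.map_comp]
  ext d
  apply P.val_injective
  apply P.Amb_ext
  intro n
  have e : P.π n ∘ₗ P.val ∘ₗ F = P.π n ∘ₗ P.val ∘ₗ G := by rw [key F hF, key G hG, h0, h1]
  exact LinearMap.congr_fun e d

theorem comul_comp_comp {B C D : Type*} [AddCommGroup B] [Module K B] [Coalgebra K B]
    [AddCommGroup C] [Module K C] [Coalgebra K C] [AddCommGroup D] [Module K D] [Coalgebra K D]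
    {φ : C →ₗ[K] D} {ψ : B →ₗ[K] C}
    (hφ : Coalgebra.comul ∘ₗ φ = TensorProduct.map φ φ ∘ₗ Coalgebra.comul)
    (hψ : Coalgebra.comul ∘ₗ ψ = TensorProduct.map ψ ψ ∘ₗ Coalgebra.comul) :
    Coalgebra.comul ∘ₗ (φ ∘ₗ ψ) = TensorProduct.map (φ ∘ₗ ψ) (φ ∘ₗ ψ) ∘ₗ Coalgebra.comul := by
  rw [← LinearMap.comp_assoc, hφ, LinearMap.comp_assoc, hψ, ← LinearMap.comp_assoc,
    ← TensorProduct.map_comp]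

theorem comul_comp_id (D : Type*) [AddCommGroup D] [Module K D] [Coalgebra K D] :
    Coalgebra.comul ∘ₗ LinearMap.id = TensorProduct.map LinearMap.id LinearMap.id ∘ₗ
      Coalgebra.comul (R := K) (A := D) := by
  rw [TensorProduct.map_id]; rfl

/-- The inclusion of `H` in the cotensor coalgebra. -/
noncomputable def j0 (P : HopfBimodule K H M) : H →ₗ[K] P.Cot := P.corestrict P.i0 P.i0_mem

theorem q0_j0 (P : HopfBimodule K H M) (h : H) : P.q0 (P.j0 h) = h := P.p0_i0 h

theorem q1_j0 (P : HopfBimodule K H M) (h : H) : P.q1 (P.j0 h) = 0 := P.p1_i0 h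

theorem comul_j0 (P : HopfBimodule K H M) :
    Coalgebra.comul ∘ₗ P.j0 = TensorProduct.map P.j0 P.j0 ∘ₗ Coalgebra.comul (R := K) := by
  ext h
  refine map_injective P.val_injective P.val_injective ?_
  simp only [LinearMap.comp_apply]
  rw [val_comul, map_map_apply]
  exact P.comul_i0 h

theorem mulCot_assoc (P : HopfBimodule K H M) (x y z : P.Cot) :
    P.mulCot (P.mulCot (x ⊗ₜ y) ⊗ₜ z) = P.mulCot (x ⊗ₜ P.mulCot (y ⊗ₜ z)) := by
  have e : P.mulCot ∘ₗ TensorProduct.map P.mulCot LinearMap.id =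
      P.mulCot ∘ₗ TensorProduct.map LinearMap.id P.mulCot ∘ₗ
        (TensorProduct.assoc K P.Cot P.Cot P.Cot).toLinearMap := by
    refine P.cot_hom_ext ?_ ?_ ?_ ?_
    · exact comul_comp_comp P.comul_mulCot (comul_map_map _ _ P.comul_mulCot (comul_comp_id _))
    · refine comul_comp_comp P.comul_mulCot (comul_comp_comp
        (comul_map_map _ _ (comul_comp_id _) P.comul_mulCot) ?_)
      exact (Coalgebra.TensorProduct.assoc K K P.Cot P.Cot P.Cot).map_comp_comul.symm
    · ext x y z
      simp [q0_mulCot, mul_assoc]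
    · ext x y z
      simp [q0_mulCot, q1_mulCot, P.mul_lact, P.ract_mul, P.lact_ract, add_assoc]
  exact LinearMap.congr_fun e ((x ⊗ₜ y) ⊗ₜ z)

theorem comul_j0_one (P : HopfBimodule K H M) :
    Coalgebra.comul (R := K) (P.j0 1) = P.j0 1 ⊗ₜ P.j0 1 := by
  have := LinearMap.congr_fun P.comul_j0 1
  simp only [LinearMap.comp_apply, Bialgebra.comul_one] at this
  exact this

theorem comul_mul_apply (P : HopfBimodule K H M) (x y : P.Cot) :
    Coalgebra.comul (R := K) (P.mulCot (x ⊗ₜ y)) = TensorProduct.map P.mulCot P.mulCot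
      (TensorProduct.AlgebraTensorModule.tensorTensorTensorComm K K K K _ _ _ _
        (Coalgebra.comul x ⊗ₜ Coalgebra.comul y)) :=
  LinearMap.congr_fun P.comul_mulCot (x ⊗ₜ y)

theorem one_mulCot (P : HopfBimodule K H M) (x : P.Cot) : P.mulCot (P.j0 1 ⊗ₜ x) = x := by
  have e : P.mulCot ∘ₗ TensorProduct.mk K P.Cot P.Cot (P.j0 1) = LinearMap.id := by
    refine P.cot_hom_ext ?_ (comul_comp_id _) ?_ ?_
    · ext x
      simp only [LinearMap.comp_apply, TensorProduct.mk_apply]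
      rw [comul_mul_apply, comul_j0_one]
      generalize Coalgebra.comul (R := K) x = t
      induction t using TensorProduct.induction_on with
      | zero => simp
      | add x y hx hy => simp only [map_add, TensorProduct.tmul_add, hx, hy]
      | tmul a b => simp
    · ext x
      simp [q0_mulCot, q0_j0]
    · ext x
      simp [q1_mulCot, q0_j0, q1_j0, P.one_lact]
  exact LinearMap.congr_fun e x

theorem mulCot_one (P : HopfBimodule K H M) (x : P.Cot) : P.mulCot (x ⊗ₜ P.j0 1) = x := by
  have e : P.mulCot ∘ₗ (TensorProduct.mk K P.Cot P.Cot).flip (P.j0 1) = LinearMap.id := by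
    refine P.cot_hom_ext ?_ (comul_comp_id _) ?_ ?_
    · ext x
      simp only [LinearMap.comp_apply, TensorProduct.mk_apply, LinearMap.flip_apply]
      rw [comul_mul_apply, comul_j0_one]
      generalize Coalgebra.comul (R := K) x = t
      induction t using TensorProduct.induction_on with
      | zero => simp
      | add x y hx hy => simp only [map_add, TensorProduct.add_tmul, hx, hy]
      | tmul a b => simp
    · ext x
      simp [q0_mulCot, q0_j0]
    · ext x
      simp [q1_mulCot, q0_j0, q1_j0, P.ract_one]
  exact LinearMap.congr_fun e x

noncomputable instance cotMul (P : HopfBimodule K H M) : Mul P.Cot where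
  mul x y := P.mulCot (x ⊗ₜ y)

noncomputable instance cotOne (P : HopfBimodule K H M) : One P.Cot where
  one := P.j0 1

theorem mul_def (P : HopfBimodule K H M) (x y : P.Cot) : x * y = P.mulCot (x ⊗ₜ y) := rfl

theorem one_def (P : HopfBimodule K H M) : (1 : P.Cot) = P.j0 1 := rfl

noncomputable instance cotRing (P : HopfBimodule K H M) : Ring P.Cot where
  __ := (inferInstance : AddCommGroup P.Cot)
  __ := (inferInstance : Mul P.Cot)
  __ := (inferInstance : One P.Cot)
  zero_mul x := by rw [mul_def, TensorProduct.zero_tmul, map_zero]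
  mul_zero x := by rw [mul_def, TensorProduct.tmul_zero, map_zero]
  left_distrib x y z := by simp only [mul_def, TensorProduct.tmul_add, map_add]
  right_distrib x y z := by simp only [mul_def, TensorProduct.add_tmul, map_add]
  mul_assoc := P.mulCot_assoc
  one_mul := P.one_mulCot
  mul_one := P.mulCot_one

noncomputable instance cotAlgebra (P : HopfBimodule K H M) : Algebra K P.Cot :=
  Algebra.ofModule
    (fun c x y => by rw [mul_def, mul_def, ← TensorProduct.smul_tmul', map_smul])
    (fun c x y => by rw [mul_def, mul_def, TensorProduct.tmul_smul, map_smul])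

theorem map_mul_tensorComm {A : Type*} [Ring A] [Algebra K A] (μ : A ⊗[K] A →ₗ[K] A)
    (hμ : ∀ x y, μ (x ⊗ₜ y) = x * y) (s t : A ⊗[K] A) :
    TensorProduct.map μ μ (TensorProduct.AlgebraTensorModule.tensorTensorTensorComm K K K K _ _ _ _
      (s ⊗ₜ t)) = s * t := by
  induction s using TensorProduct.induction_on with
  | zero => simp
  | add x y hx hy => simp only [TensorProduct.add_tmul, map_add, hx, hy, add_mul]
  | tmul a b =>
    induction t using TensorProduct.induction_on with
    | zero => simp
    | add x y hx hy => simp only [TensorProduct.tmul_add, map_add, hx, hy, mul_add]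
    | tmul c d => simp [hμ]

/-- The bialgebra structure of the cotensor coalgebra. -/
noncomputable instance cotBialgebra (P : HopfBimodule K H M) : Bialgebra K P.Cot :=
  Bialgebra.mk' K P.Cot
    (by rw [counit_eq_q0, one_def, q0_j0, Bialgebra.counit_one])
    (fun {a b} => by
      rw [counit_eq_q0, mul_def, q0_mulCot, Bialgebra.counit_mul, ← counit_eq_q0, ← counit_eq_q0])
    (by rw [one_def, comul_j0_one]; rfl)
    (fun {a b} => by
      rw [mul_def, comul_mul_apply]
      exact map_mul_tensorComm P.mulCot (fun _ _ => rfl) _ _)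

theorem j0_mul (P : HopfBimodule K H M) (h k : H) : P.j0 (h * k) = P.j0 h * P.j0 k := by
  have e : P.j0 ∘ₗ LinearMap.mul' K H = P.mulCot ∘ₗ TensorProduct.map P.j0 P.j0 := by
    refine P.cot_hom_ext ?_ ?_ ?_ ?_
    · refine comul_comp_comp P.comul_j0 ?_
      ext x y
      simp only [TensorProduct.AlgebraTensorModule.curry_apply, TensorProduct.curry_apply,
        LinearMap.coe_restrictScalars, LinearMap.comp_apply, LinearMap.mul'_apply,
        Bialgebra.comul_mul, TensorProduct.comul_tmul]
      generalize Coalgebra.comul (R := K) x = s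
      generalize Coalgebra.comul (R := K) y = t
      induction s using TensorProduct.induction_on with
      | zero => simp
      | add x y hx hy => simp only [TensorProduct.add_tmul, map_add, hx, hy, add_mul]
      | tmul a b =>
        induction t using TensorProduct.induction_on with
        | zero => simp
        | add x y hx hy => simp only [TensorProduct.tmul_add, map_add, hx, hy, mul_add]
        | tmul c d => simp
    · exact comul_comp_comp P.comul_mulCot (comul_map_map _ _ P.comul_j0 P.comul_j0)
    · ext x y
      simp [q0_mulCot, q0_j0]
    · ext x y
      simp [q1_mulCot, q0_j0, q1_j0]
  exact LinearMap.congr_fun e (h ⊗ₜ k)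

theorem bal_i0_lcoact (P : HopfBimodule K H M) (m : M) :
    P.Bal (TensorProduct.map P.i0 LinearMap.id (P.lcoact m)) := by
  have e : P.R ∘ₗ P.i0 = TensorProduct.map P.i0 LinearMap.id ∘ₗ Coalgebra.comul :=
    LinearMap.ext P.R_i0
  have e2 : TensorProduct.map (LinearMap.id ∘ₗ P.i0) P.lcoact (P.lcoact m) =
      TensorProduct.map P.i0 LinearMap.id (TensorProduct.map LinearMap.id P.lcoact (P.lcoact m)) := by
    rw [map_map_apply]; rfl
  rw [Bal, map_map_apply, map_map_apply, e, map_comp_left', LinearMap.id_comp, LinearMap.comp_id,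
    e2, ← P.lcoassoc]
  have h := map_assoc P.i0 LinearMap.id LinearMap.id
    (TensorProduct.map Coalgebra.comul LinearMap.id (P.lcoact m))
  rw [TensorProduct.map_id] at h
  rw [h, LinearEquiv.symm_apply_apply]

theorem i1_mem (P : HopfBimodule K H M) (m : M) :
    P.app (TensorProduct.map P.i0 LinearMap.id (P.lcoact m)) ∈ P.cotensor := by
  have e : TensorProduct.map P.i0 LinearMap.id (P.lcoact m) =
      TensorProduct.map P.val LinearMap.id (TensorProduct.map P.j0 LinearMap.id (P.lcoact m)) := by
    rw [map_map_apply]; rfl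
  have hb := P.bal_i0_lcoact m
  rw [e] at hb ⊢
  exact P.app_mem _ hb

/-- The inclusion of `M = H □_H M` in the cotensor coalgebra. -/
noncomputable def j1 (P : HopfBimodule K H M) : M →ₗ[K] P.Cot :=
  P.corestrict (P.app ∘ₗ TensorProduct.map P.i0 LinearMap.id ∘ₗ P.lcoact) P.i1_mem

theorem q0_j1 (P : HopfBimodule K H M) (m : M) : P.q0 (P.j1 m) = 0 := P.p0_app _

theorem q1_j1 (P : HopfBimodule K H M) (m : M) : P.q1 (P.j1 m) = m := by
  refine (P.p1_app _).trans ?_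
  have e : Coalgebra.counit ∘ₗ P.i0 = Coalgebra.counit (R := K) := LinearMap.ext P.counit_i0
  rw [LinearMap.comp_apply, map_map_apply, e, LinearMap.id_comp, P.lcounit]

theorem comul_j1 (P : HopfBimodule K H M) (m : M) : Coalgebra.comul (R := K) (P.j1 m) =
    TensorProduct.map P.j1 P.j0 (P.rcoact m) + TensorProduct.map P.j0 P.j1 (P.lcoact m) := by
  refine map_injective P.val_injective P.val_injective ?_
  rw [val_comul, map_add, map_map_apply, map_map_apply]
  change Coalgebra.comul (R := K) (P.app (TensorProduct.map P.i0 LinearMap.id (P.lcoact m))) =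
    TensorProduct.map (P.app ∘ₗ TensorProduct.map P.i0 LinearMap.id ∘ₗ P.lcoact) P.i0 (P.rcoact m) +
    TensorProduct.map P.i0 (P.app ∘ₗ TensorProduct.map P.i0 LinearMap.id ∘ₗ P.lcoact) (P.lcoact m)
  rw [comul_app]
  congr 1
  · have h : TensorProduct.map LinearMap.id P.rcoact
        (TensorProduct.map P.i0 LinearMap.id (P.lcoact m)) =
        TensorProduct.map P.i0 (TensorProduct.map LinearMap.id LinearMap.id)
          (TensorProduct.map LinearMap.id P.rcoact (P.lcoact m)) := by
      rw [map_map_apply, map_map_apply, TensorProduct.map_id]; rfl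
    rw [R_app, h, assoc_symm_map, ← P.bicoassoc, LinearEquiv.symm_apply_apply, map_map_apply,
      map_map_apply, map_map_apply]
    rfl
  · have e : Coalgebra.comul ∘ₗ P.i0 = TensorProduct.map P.i0 P.i0 ∘ₗ Coalgebra.comul (R := K) :=
      LinearMap.ext P.comul_i0
    rw [map_map_apply, e, map_comp_left', ← map_assoc, LinearMap.comp_id, P.lcoassoc,
      map_map_apply, map_map_apply]
    rfl

theorem π_mul_eq_zero (P : HopfBimodule K H M) {x y : P.Cot} {i j : ℕ} {u : P.amb i} {v : P.amb j}
    (hx : P.val x = P.ι i u) (hy : P.val y = P.ι j v) {n : ℕ} (hn : i + j < n) :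
    P.π n (P.val (x * y)) = 0 := by
  have h := LinearMap.congr_fun (P.π_liftAmb (P.f2 ∘ₗ P.val2) (P.g2 ∘ₗ P.val2) P.L_mul_fin n)
    (x ⊗ₜ[K] y)
  refine h.trans ?_
  rw [P.L_comp _ _ _ (comul_map_map _ _ P.comul_comp_val P.comul_comp_val), LinearMap.comp_apply,
    TensorProduct.map_tmul, hx, hy]
  exact P.L_f2_g2_eq_zero n i j u v hn

theorem π_one (P : HopfBimodule K H M) (z : P.Cot) : P.π 1 (P.val z) =
    P.ambSucc 0 (TensorProduct.map P.ambZero.toLinearMap LinearMap.id (P.lcoact (P.q1 z))) := by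
  rw [π_succ, q1, LinearMap.comp_apply, P.lcoact_p1 (P.val_mem z), map_map_apply]
  have e : P.π 0 = P.ambZero.toLinearMap ∘ₗ P.p0 := LinearMap.ext P.π_zero
  rw [e]
  rfl

theorem val_j1 (P : HopfBimodule K H M) (m : M) : P.val (P.j1 m) = P.ι 1
    (P.ambSucc 0 (TensorProduct.map P.ambZero.toLinearMap LinearMap.id (P.lcoact m))) := by
  rw [← app_map_ι, map_map_apply]
  rfl

/-- An element of the cotensor coalgebra of degree one is determined by its image in `M`. -/
theorem eq_j1 (P : HopfBimodule K H M) {z : P.Cot} (h0 : P.q0 z = 0)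
    (h : ∀ n > 1, P.π n (P.val z) = 0) : z = P.j1 (P.q1 z) := by
  apply P.val_injective
  apply P.Amb_ext
  intro n
  rcases n with _ | _ | n
  · rw [π_zero, π_zero]
    exact congrArg P.ambZero (h0.trans (P.q0_j1 _).symm)
  · rw [π_one, π_one, q1_j1]
  · rw [h _ (by omega), val_j1, P.π_ι_of_ne (by omega)]

theorem j1_lact (P : HopfBimodule K H M) (h : H) (m : M) :
    P.j1 (P.lact h m) = P.j0 h * P.j1 m := by
  have e := P.eq_j1 (z := P.j0 h * P.j1 m)
    (by rw [mul_def, q0_mulCot, q0_j1, mul_zero])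
    (fun n hn => P.π_mul_eq_zero (i := 0) (j := 1) (u := P.ambZero h) rfl (P.val_j1 m) (by omega))
  rw [e, mul_def, q1_mulCot, q0_j0, q1_j0, q1_j1, map_zero, LinearMap.zero_apply, add_zero]

theorem j1_ract (P : HopfBimodule K H M) (m : M) (h : H) :
    P.j1 (P.ract m h) = P.j1 m * P.j0 h := by
  have e := P.eq_j1 (z := P.j1 m * P.j0 h)
    (by rw [mul_def, q0_mulCot, q0_j1, zero_mul])
    (fun n hn => P.π_mul_eq_zero (i := 1) (j := 0) (v := P.ambZero h) (P.val_j1 m) rfl (by omega))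
  rw [e, mul_def, q1_mulCot, q0_j0, q1_j0, q1_j1, map_zero, zero_add]

/-- The defining relations of the relative tensor algebra. -/
inductive TensorRel (P : HopfBimodule K H M) :
    TensorAlgebra K (H × M) → TensorAlgebra K (H × M) → Prop
  | one : TensorRel P (TensorAlgebra.ι K ((1, 0) : H × M)) 1
  | mul (h k : H) : TensorRel P (TensorAlgebra.ι K ((h, 0) : H × M) * TensorAlgebra.ι K (k, 0))
      (TensorAlgebra.ι K (h * k, 0))
  | lact (h : H) (m : M) : TensorRel P
      (TensorAlgebra.ι K ((h, 0) : H × M) * TensorAlgebra.ι K (0, m))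
      (TensorAlgebra.ι K (0, P.lact h m))
  | ract (m : M) (h : H) : TensorRel P
      (TensorAlgebra.ι K ((0, m) : H × M) * TensorAlgebra.ι K (h, 0))
      (TensorAlgebra.ι K (0, P.ract m h))

/-- The relative tensor algebra `T_H(M) = H ⊕ M ⊕ (M ⊗_H M) ⊕ ⋯`, as the universal `K`-algebra
with an algebra map from `H` and a map of `H`-bimodules from `M`. -/
abbrev RelTensorAlgebra (P : HopfBimodule K H M) : Type _ := RingQuot P.TensorRel

/-- The inclusion of `H` in the relative tensor algebra. -/
noncomputable def t0 (P : HopfBimodule K H M) : H →ₗ[K] P.RelTensorAlgebra :=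
  (RingQuot.mkAlgHom K P.TensorRel).toLinearMap ∘ₗ TensorAlgebra.ι K ∘ₗ LinearMap.inl K H M

/-- The inclusion of `M` in the relative tensor algebra. -/
noncomputable def t1 (P : HopfBimodule K H M) : M →ₗ[K] P.RelTensorAlgebra :=
  (RingQuot.mkAlgHom K P.TensorRel).toLinearMap ∘ₗ TensorAlgebra.ι K ∘ₗ LinearMap.inr K H M

theorem toCot_rel (P : HopfBimodule K H M) ⦃x y : TensorAlgebra K (H × M)⦄
    (h : P.TensorRel x y) : TensorAlgebra.lift K (P.j0.coprod P.j1) x =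
      TensorAlgebra.lift K (P.j0.coprod P.j1) y := by
  cases h with
  | one => simp [one_def]
  | mul h k => simp [j0_mul]
  | lact h m => simp [j1_lact]
  | ract m h => simp [j1_ract]

/-- The algebra homomorphism `T_H(M) → T^c_H(M)` which is the inclusion on `H` and on `M`. -/
noncomputable def toCot (P : HopfBimodule K H M) : P.RelTensorAlgebra →ₐ[K] P.Cot :=
  RingQuot.liftAlgHom K ⟨TensorAlgebra.lift K (P.j0.coprod P.j1), P.toCot_rel⟩

@[simp]
theorem toCot_t0 (P : HopfBimodule K H M) (h : H) : P.toCot (P.t0 h) = P.j0 h := by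
  simp [toCot, t0, RingQuot.liftAlgHom_mkAlgHom_apply]

@[simp]
theorem toCot_t1 (P : HopfBimodule K H M) (m : M) : P.toCot (P.t1 m) = P.j1 m := by
  simp [toCot, t1, RingQuot.liftAlgHom_mkAlgHom_apply]

theorem relTensorAlgebra_induction (P : HopfBimodule K H M) {p : P.RelTensorAlgebra → Prop}
    (h0 : ∀ h, p (P.t0 h)) (h1 : ∀ m, p (P.t1 m)) (hadd : ∀ x y, p x → p y → p (x + y))
    (hmul : ∀ x y, p x → p y → p (x * y)) (hK : ∀ c, p (algebraMap K _ c))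
    (x : P.RelTensorAlgebra) : p x := by
  obtain ⟨x, rfl⟩ := RingQuot.mkAlgHom_surjective K P.TensorRel x
  induction x using TensorAlgebra.induction with
  | algebraMap c => rw [AlgHom.commutes]; exact hK c
  | ι v =>
    obtain ⟨h, m⟩ := v
    have e : RingQuot.mkAlgHom K P.TensorRel (TensorAlgebra.ι K (h, m)) = P.t0 h + P.t1 m := by
      simp only [t0, t1, LinearMap.comp_apply, AlgHom.toLinearMap_apply, ← map_add,
        LinearMap.inl_apply, LinearMap.inr_apply, Prod.mk_add_mk, add_zero, zero_add]
    rw [e]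
    exact hadd _ _ (h0 h) (h1 m)
  | mul x y hx hy => rw [map_mul]; exact hmul _ _ hx hy
  | add x y hx hy => rw [map_add]; exact hadd _ _ hx hy

theorem toCot_comul_mem (P : HopfBimodule K H M) (x : P.RelTensorAlgebra) :
    Coalgebra.comul (R := K) (P.toCot x) ∈
      (Algebra.TensorProduct.map P.toCot.range.val P.toCot.range.val).range := by
  let s0 : H →ₗ[K] P.toCot.range := P.toCot.rangeRestrict.toLinearMap ∘ₗ P.t0
  let s1 : M →ₗ[K] P.toCot.range := P.toCot.rangeRestrict.toLinearMap ∘ₗ P.t1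
  have e0 : P.j0 = P.toCot.range.val.toLinearMap ∘ₗ s0 :=
    LinearMap.ext fun h => (P.toCot_t0 h).symm
  have e1 : P.j1 = P.toCot.range.val.toLinearMap ∘ₗ s1 :=
    LinearMap.ext fun m => (P.toCot_t1 m).symm
  induction x using P.relTensorAlgebra_induction with
  | h0 h =>
    rw [toCot_t0, ← LinearMap.comp_apply, comul_j0, LinearMap.comp_apply]
    refine ⟨TensorProduct.map s0 s0 (Coalgebra.comul (R := K) h), ?_⟩
    rw [e0]
    exact map_map_apply (f := s0) (g := s0) (f' := P.toCot.range.val.toLinearMap)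
      (g' := P.toCot.range.val.toLinearMap) _
  | h1 m =>
    rw [toCot_t1, comul_j1]
    refine ⟨TensorProduct.map s1 s0 (P.rcoact m) + TensorProduct.map s0 s1 (P.lcoact m), ?_⟩
    rw [e0, e1, map_add]
    exact congrArg₂ (· + ·) (map_map_apply (f := s1) (g := s0)
        (f' := P.toCot.range.val.toLinearMap) (g' := P.toCot.range.val.toLinearMap) _)
      (map_map_apply (f := s0) (g := s1) (f' := P.toCot.range.val.toLinearMap)
        (g' := P.toCot.range.val.toLinearMap) _)
  | hadd x y hx hy => rw [map_add, map_add]; exact add_mem hx hy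
  | hmul x y hx hy => rw [map_mul, Bialgebra.comul_mul]; exact mul_mem hx hy
  | hK c => rw [AlgHom.commutes, Bialgebra.comul_algebraMap]; exact Subalgebra.algebraMap_mem _ _

/-- The bialgebra of type one `H[M]`: the image of the homomorphism `T_H(M) → T^c_H(M)`. -/
noncomputable def typeOne (P : HopfBimodule K H M) : Subbialgebra K P.Cot where
  toSubalgebra := P.toCot.range
  comul_mem' := by
    rintro _ ⟨x, rfl⟩
    exact P.toCot_comul_mem x

/-- The inclusion of `H` in `H[M]`. -/
noncomputable def inl (P : HopfBimodule K H M) : H →ₗ[K] P.typeOne.toSubalgebra :=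
  P.toCot.rangeRestrict.toLinearMap ∘ₗ P.t0

/-- The inclusion of `M` in `H[M]`. -/
noncomputable def inr (P : HopfBimodule K H M) : M →ₗ[K] P.typeOne.toSubalgebra :=
  P.toCot.rangeRestrict.toLinearMap ∘ₗ P.t1

end CotensorCoalgebra

end HopfBimodule

section Inclusions

variable {K : Type v} [Field K] {E : Type u} [Ring E] [Bialgebra K E]

/-- The identification of `H` with the component `gr^0` of `gr_H E`, as a map to `gr_H E`. -/
noncomputable def Subbialgebra.grH (H : Subbialgebra K E) : H.toSubalgebra →ₗ[K] H.Gr :=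
  DirectSum.lof K ℕ H.gr 0 ∘ₗ H.cls 0 ∘ₗ
    LinearMap.codRestrict (H.wp (0 + 1)) H.incl (fun h => by
      rw [zero_add, H.mem_wp_one]; exact h.2)

/-- The inclusion of the component `gr^1 = (H ∧ H)/H` in `gr_H E`. -/
noncomputable def Subbialgebra.grM (H : Subbialgebra K E) : H.gr 1 →ₗ[K] H.Gr :=
  DirectSum.lof K ℕ H.gr 1

end Inclusions


end TypeOne

/-!
The subspace `H` is a subcoalgebra, so `H^{∧(a+b)} = H^{∧a} ∧ H^{∧b}`, which says that the
comultiplication of `E` induces injections `E / H^{∧(a+b)} → E / H^{∧a} ⊗ E / H^{∧b}`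
(`comulQ_injective`). The components of `gr_H E` embed in the quotients `E / H^{∧n}`, and the
embeddings carry the comultiplication of `gr_H E` to these injections (`grQ_comul`); coassociativity
and the counit laws of `gr_H E` are read off there.

For `x ∈ H^{∧(n+1)}`, the tensor `Δ x` lies in the sum of the `H^{∧(i+1)} ⊗ H^{∧(j+1)}` with
`i + j = n`, and replacing the factors by their classes turns it into `Δ [x]`
(`exists_symbol`, `comul_mem_symbols`). This replacement is compatible with products, hence
`gr_H E` is a bialgebra (`grBialgebra`).

The projections of `gr_H E` onto `H` and `(H ∧ H)/H` induce a coalgebra homomorphism to the cotensor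
coalgebra of `(H ∧ H)/H`. Its component of degree `n` is an iteration of the injections
above, so it is injective (`toCotLin_injective`). It is multiplicative, since coalgebra
homomorphisms to the cotensor coalgebra are determined by their components in `H` and `(H ∧ H)/H`
(`toCotLin_mul`). As the bialgebra of type one is the subalgebra generated by `H` and `(H ∧ H)/H`,
it is the image of `gr_H E` if and only if `gr_H E` is generated in degrees zero and one
(`exists_bialgEquiv`, `adjoin_eq_top_of_bialgEquiv`).

The remaining equivalences do not involve the comultiplication. A graded algebra generated in
degrees zero and one has `D 1 ^ n * D 0` as its component of degree `n` (`le_pow_mul_of_adjoin_eq_top`), and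
is therefore strongly graded. The algebra `gr_H E` is strongly graded if and only if
`H^{∧(i+j+1)} = H^{∧(i+1)} H^{∧(j+1)} + H^{∧(i+j)}`, and an induction on `i` removes the last term
(`isStronglyGraded_gr_iff_wp`).
-/

namespace TypeOne

/-! ### Jointly injective families and tensor products -/

section JointlyInjective

variable {K : Type*} [Field K]

/-- The case of `jointly_injective_map` in which the second family is the identity. -/
theorem jointly_injective_map_id {X V : Type*} [AddCommGroup X] [Module K X] [AddCommGroup V]
    [Module K V] {ι : Type*} {Y : ι → Type*} [∀ i, AddCommGroup (Y i)] [∀ i, Module K (Y i)]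
    {f : ∀ i, X →ₗ[K] Y i} (hf : ∀ x, (∀ i, f i x = 0) → x = 0) (z : X ⊗[K] V)
    (hz : ∀ i, TensorProduct.map (f i) LinearMap.id z = 0) : z = 0 := by
  classical
  let b := Module.Basis.ofVectorSpace K V
  -- In coordinates for `V`, the map `f i ⊗ V` is `f i` applied to each coordinate.
  have h : ∀ i (w : X ⊗[K] V) k, TensorProduct.equivFinsuppOfBasisRight b
      (TensorProduct.map (f i) LinearMap.id w) k =
        f i (TensorProduct.equivFinsuppOfBasisRight b w k) := by
    intro i w k
    induction w using TensorProduct.induction_on with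
    | zero => simp
    | add x y hx hy => simp only [map_add, Finsupp.add_apply, hx, hy]
    | tmul x y => simp
  apply (TensorProduct.equivFinsuppOfBasisRight b).injective
  ext k
  rw [map_zero, Finsupp.zero_apply]
  refine hf _ fun i => ?_
  rw [← h, hz, map_zero, Finsupp.zero_apply]

/-- Over a field, the tensor products of the maps of two jointly injective families are jointly
injective. -/
theorem jointly_injective_map {X V : Type*} [AddCommGroup X] [Module K X] [AddCommGroup V]
    [Module K V] {ι κ : Type*} {Y : ι → Type*} [∀ i, AddCommGroup (Y i)] [∀ i, Module K (Y i)]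
    {W : κ → Type*} [∀ i, AddCommGroup (W i)] [∀ i, Module K (W i)]
    {f : ∀ i, X →ₗ[K] Y i} (hf : ∀ x, (∀ i, f i x = 0) → x = 0)
    {g : ∀ j, V →ₗ[K] W j} (hg : ∀ x, (∀ j, g j x = 0) → x = 0) (z : X ⊗[K] V)
    (hz : ∀ i j, TensorProduct.map (f i) (g j) z = 0) : z = 0 := by
  refine jointly_injective_map_id hf z fun i => ?_
  apply (TensorProduct.comm K _ _).injective
  rw [map_zero]
  refine jointly_injective_map_id hg _ fun j => ?_
  have h : ∀ w, TensorProduct.map (g j) LinearMap.id (TensorProduct.comm K _ _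
      (TensorProduct.map (f i) LinearMap.id w)) =
        TensorProduct.comm K _ _ (TensorProduct.map (f i) (g j) w) := by
    intro w
    induction w using TensorProduct.induction_on with
    | zero => simp
    | add x y hx hy => simp only [map_add, hx, hy]
    | tmul x y => simp
  rw [h, hz, map_zero]

end JointlyInjective

/-! ### The coalgebra structure of the associated graded object -/

section GrCoalgebra

variable {K : Type v} [Field K] {E : Type u} [Ring E] [Bialgebra K E]

/-- The additive group of `gr^n_H E`, as a local instance for families indexed by `n`. -/
noncomputable abbrev Subbialgebra.grAddCommGroup (H : Subbialgebra K E) (n : ℕ) :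
    AddCommGroup (H.gr n) :=
  Submodule.Quotient.addCommGroup _

attribute [local instance] Subbialgebra.grAddCommGroup

/-- The algebra `gr_H E`. This is a copy of `Subbialgebra.Gr`, whose additive group and ring
structure are registered so that tensor products and bialgebra structures find them without unfolding the
direct sum. -/
def Subbialgebra.GrB (H : Subbialgebra K E) : Type u := H.Gr

noncomputable instance Subbialgebra.grRing (H : Subbialgebra K E) : Ring H.GrB :=
  { (inferInstanceAs (Semiring H.Gr) : Semiring H.GrB),
    (inferInstanceAs (AddCommGroup (⨁ n, H.gr n)) : AddCommGroup H.GrB) with }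

noncomputable instance Subbialgebra.grAlgebra (H : Subbialgebra K E) : Algebra K H.GrB :=
  inferInstanceAs (Algebra K H.Gr)

/-- The projection of `gr_H E` onto its component of degree `n`. -/
noncomputable def Subbialgebra.grProj (H : Subbialgebra K E) (n : ℕ) : H.GrB →ₗ[K] H.gr n :=
  DirectSum.component K ℕ H.gr n

/-- The inclusion of the component of degree `n` in `gr_H E`. -/
noncomputable def Subbialgebra.grLof (H : Subbialgebra K E) (n : ℕ) : H.gr n →ₗ[K] H.GrB :=
  DirectSum.lof K ℕ H.gr n

noncomputable instance Subbialgebra.grCS (H : Subbialgebra K E) : CoalgebraStruct K H.GrB :=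
  inferInstanceAs (CoalgebraStruct K H.Gr)

/-- The component of degree `n`, as an element of `E / H^{∧n}`. Quotients of `E` carry the maps
induced by the comultiplication of `E` itself, so identities in `gr_H E` are checked in them. -/
noncomputable def Subbialgebra.grQ (H : Subbialgebra K E) (n : ℕ) : H.GrB →ₗ[K] E ⧸ H.wp n :=
  H.grIncl n ∘ₗ H.grProj n

theorem Subbialgebra.grProj_grLof (H : Subbialgebra K E) (n : ℕ) (x : H.gr n) :
    H.grProj n (H.grLof n x) = x := DirectSum.component.lof_self K n x

theorem Subbialgebra.grProj_grLof_of_ne (H : Subbialgebra K E) {n m : ℕ} (h : n ≠ m)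
    (x : H.gr n) : H.grProj m (H.grLof n x) = 0 := by
  have := DirectSum.component.of K (M := H.gr) m n x
  rw [dif_neg h] at this
  exact this

theorem Subbialgebra.grQ_comp_grLof (H : Subbialgebra K E) (n : ℕ) :
    H.grQ n ∘ₗ H.grLof n = H.grIncl n :=
  LinearMap.ext fun x => congrArg (H.grIncl n) (H.grProj_grLof n x)

theorem Subbialgebra.grQ_comp_grLof_of_ne (H : Subbialgebra K E) {n m : ℕ} (h : n ≠ m) :
    H.grQ m ∘ₗ H.grLof n = 0 :=
  LinearMap.ext fun x => (congrArg (H.grIncl m) (H.grProj_grLof_of_ne h x)).trans (map_zero _)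

theorem Subbialgebra.grQ_eq_zero (H : Subbialgebra K E) {n : ℕ} {x : H.GrB} :
    H.grQ n x = 0 ↔ H.grProj n x = 0 :=
  map_eq_zero_iff _ (H.grIncl_injective n)

theorem Subbialgebra.grQ_ext (H : Subbialgebra K E) (x : H.GrB) (h : ∀ n, H.grQ n x = 0) :
    x = 0 :=
  DirectSum.ext_component K fun n => (H.grQ_eq_zero.1 (h n)).trans (map_zero _).symm

theorem Subbialgebra.grHom_ext (H : Subbialgebra K E) {V : Type*} [AddCommGroup V] [Module K V]
    {f g : H.GrB →ₗ[K] V} (h : ∀ n (x : H.wp (n + 1)), f (H.grLof n (H.cls n x)) =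
      g (H.grLof n (H.cls n x))) : f = g := by
  refine DirectSum.linearMap_ext K fun n => LinearMap.ext fun a => ?_
  obtain ⟨x, rfl⟩ := Submodule.mkQ_surjective _ a
  exact h n x

/-- An element of `gr_H E ⊗ gr_H E` is determined by its images in the `E / H^{∧a} ⊗ E / H^{∧b}`. -/
theorem Subbialgebra.grQ_tensor_ext (H : Subbialgebra K E) {z z' : H.GrB ⊗[K] H.GrB}
    (h : ∀ a b, TensorProduct.map (H.grQ a) (H.grQ b) z =
      TensorProduct.map (H.grQ a) (H.grQ b) z') :
    z = z' :=
  sub_eq_zero.1 <| jointly_injective_map H.grQ_ext H.grQ_ext _ fun a b => by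
    rw [map_sub, h, sub_self]

/-- The map `E / H^{∧(a+b)} → E / H^{∧a} ⊗ E / H^{∧b}` induced by the comultiplication of `E`. -/
noncomputable def Subbialgebra.comulQ (H : Subbialgebra K E) (a b n : ℕ) (h : a + b = n) :
    E ⧸ H.wp n →ₗ[K] (E ⧸ H.wp a) ⊗[K] (E ⧸ H.wp b) :=
  Submodule.liftQ _ (TensorProduct.map (H.wp a).mkQ (H.wp b).mkQ ∘ₗ Coalgebra.comul) (by
    rw [← h, H.wp_add]; exact le_rfl)

theorem Subbialgebra.comulQ_mkQ (H : Subbialgebra K E) (a b n : ℕ) (h : a + b = n) (x : E) :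
    H.comulQ a b n h ((H.wp n).mkQ x) =
      TensorProduct.map (H.wp a).mkQ (H.wp b).mkQ (Coalgebra.comul (R := K) x) := rfl

theorem Subbialgebra.comulQ_comp_mkQ (H : Subbialgebra K E) (a b n : ℕ) (h : a + b = n) :
    H.comulQ a b n h ∘ₗ (H.wp n).mkQ =
      TensorProduct.map (H.wp a).mkQ (H.wp b).mkQ ∘ₗ Coalgebra.comul := rfl

/-- The kernel of `E → E / H^{∧a} ⊗ E / H^{∧b}` is `H^{∧a} ∧ H^{∧b} = H^{∧(a+b)}`. -/
theorem Subbialgebra.comulQ_injective (H : Subbialgebra K E) (a b n : ℕ) (h : a + b = n) :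
    Function.Injective (H.comulQ a b n h) :=
  LinearMap.ker_eq_bot.1 (Submodule.ker_liftQ_eq_bot _ _ _ (by
    rw [← h, H.wp_add]; exact le_rfl))

theorem Subbialgebra.comul_grLof (H : Subbialgebra K E) (n : ℕ) (x : H.gr n) :
    CoalgebraStruct.comul (R := K) (H.grLof n x) =
      ∑ p : Finset.HasAntidiagonal.antidiagonal n,
        TensorProduct.map (H.grLof p.1.1) (H.grLof p.1.2)
          (H.grComul n p.1.1 p.1.2 (Finset.HasAntidiagonal.mem_antidiagonal.1 p.2) x) := by
  have h : CoalgebraStruct.comul (R := K) (DirectSum.lof K ℕ H.gr n x) =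
      ∑ p : Finset.HasAntidiagonal.antidiagonal n,
        TensorProduct.map (DirectSum.lof K ℕ H.gr p.1.1) (DirectSum.lof K ℕ H.gr p.1.2)
          (H.grComul n p.1.1 p.1.2 (Finset.HasAntidiagonal.mem_antidiagonal.1 p.2) x) := by
    refine (DirectSum.toModule_lof K n x).trans ?_
    rw [LinearMap.sum_apply]
    rfl
  exact h

theorem Subbialgebra.grQ_comul_of_ne (H : Subbialgebra K E) {a b n : ℕ} (h : a + b ≠ n)
    (x : H.gr n) : TensorProduct.map (H.grQ a) (H.grQ b)
      (CoalgebraStruct.comul (R := K) (H.grLof n x)) = 0 := by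
  rw [comul_grLof, map_sum]
  refine Finset.sum_eq_zero fun p _ => ?_
  have hp := Finset.HasAntidiagonal.mem_antidiagonal.1 p.2
  rw [map_map_apply]
  by_cases ha : p.1.1 = a
  · rw [H.grQ_comp_grLof_of_ne (n := p.1.2) (m := b) (by omega), TensorProduct.map_zero_right,
      LinearMap.zero_apply]
  · rw [H.grQ_comp_grLof_of_ne ha, TensorProduct.map_zero_left, LinearMap.zero_apply]

theorem Subbialgebra.grQ_comul_grLof (H : Subbialgebra K E) {a b n : ℕ} (h : a + b = n)
    (x : H.gr n) : TensorProduct.map (H.grQ a) (H.grQ b)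
      (CoalgebraStruct.comul (R := K) (H.grLof n x)) = H.comulQ a b n h (H.grIncl n x) := by
  rw [comul_grLof, map_sum, Finset.sum_eq_single
    ⟨(a, b), Finset.HasAntidiagonal.mem_antidiagonal.2 h⟩]
  · obtain ⟨x, rfl⟩ := Submodule.mkQ_surjective _ x
    rw [map_map_apply, grQ_comp_grLof, grQ_comp_grLof]
    exact H.grComul_spec n a b h x
  · intro p _ hp
    rw [map_map_apply]
    have hp' := Finset.HasAntidiagonal.mem_antidiagonal.1 p.2
    by_cases ha : p.1.1 = a
    · refine absurd (Subtype.ext (Prod.ext ha ?_)) hp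
      change p.1.2 = b
      omega
    · rw [H.grQ_comp_grLof_of_ne ha, TensorProduct.map_zero_left, LinearMap.zero_apply]
  · intro hp
    exact absurd (Finset.mem_univ _) hp

/-- The comultiplication of `gr_H E`, seen in the quotients of `E`, is induced by that of `E`. -/
theorem Subbialgebra.grQ_comul (H : Subbialgebra K E) {a b n : ℕ} (h : a + b = n) :
    TensorProduct.map (H.grQ a) (H.grQ b) ∘ₗ CoalgebraStruct.comul (R := K) =
      H.comulQ a b n h ∘ₗ H.grQ n := by
  refine H.grHom_ext fun m x => ?_
  by_cases hm : m = n
  · subst hm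
    refine (H.grQ_comul_grLof h _).trans (congrArg (H.comulQ a b m h) ?_)
    exact (LinearMap.congr_fun (H.grQ_comp_grLof m) _).symm
  · refine (H.grQ_comul_of_ne (by omega) _).trans ?_
    have := LinearMap.congr_fun (H.grQ_comp_grLof_of_ne hm) (H.cls m x)
    rw [LinearMap.comp_apply] at this
    rw [LinearMap.comp_apply, this]
    simp

theorem Subbialgebra.comulQ_coassoc (H : Subbialgebra K E) {a b c n m l : ℕ} (h1 : a + b = n)
    (h2 : n + c = l) (h3 : b + c = m) (h4 : a + m = l) (q : E ⧸ H.wp l) :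
    TensorProduct.assoc K _ _ _ (TensorProduct.map (H.comulQ a b n h1) LinearMap.id
      (H.comulQ n c l h2 q)) =
    TensorProduct.map LinearMap.id (H.comulQ b c m h3) (H.comulQ a m l h4 q) := by
  obtain ⟨x, rfl⟩ := Submodule.mkQ_surjective _ q
  rw [comulQ_mkQ, comulQ_mkQ, map_map_apply, map_map_apply, comulQ_comp_mkQ, comulQ_comp_mkQ,
    map_comp_left', ← map_assoc, LinearMap.id_comp, LinearMap.id_comp, coassoc_map,
    map_map_apply, LinearMap.comp_id]

theorem Subbialgebra.gr_coassoc (H : Subbialgebra K E) (x : H.GrB) :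
    TensorProduct.assoc K H.GrB H.GrB H.GrB (TensorProduct.map CoalgebraStruct.comul LinearMap.id
      (CoalgebraStruct.comul (R := K) x)) =
    TensorProduct.map LinearMap.id CoalgebraStruct.comul (CoalgebraStruct.comul (R := K) x) := by
  refine sub_eq_zero.1 (jointly_injective_map
    (W := fun p : ℕ × ℕ => (E ⧸ H.wp p.1) ⊗[K] (E ⧸ H.wp p.2))
    (g := fun p => TensorProduct.map (H.grQ p.1) (H.grQ p.2)) H.grQ_ext
    (fun z hz => jointly_injective_map H.grQ_ext H.grQ_ext z fun i j => hz (i, j)) _ ?_)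
  rintro a ⟨b, c⟩
  have e1 := LinearMap.congr_fun (H.grQ_comul (a := a + b) (b := c) rfl) x
  have e2 := LinearMap.congr_fun (H.grQ_comul (a := a) (b := b + c) (add_assoc a b c).symm) x
  simp only [LinearMap.comp_apply] at e1 e2
  have e3 := H.comulQ_coassoc (a := a) (b := b) rfl rfl rfl (add_assoc a b c).symm
    (H.grQ (a + b + c) x)
  rw [← e1, ← e2, map_map_apply, map_map_apply, ← H.grQ_comul, ← H.grQ_comul, LinearMap.id_comp,
    LinearMap.id_comp, map_comp_left', map_comp_right', ← map_assoc] at e3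
  rw [map_sub, e3, sub_self]

theorem Subbialgebra.grCounit_grLof_zero (H : Subbialgebra K E) (x : H.wp (0 + 1)) :
    CoalgebraStruct.counit (R := K) (H.grLof 0 (H.cls 0 x)) = Coalgebra.counit (R := K) (x : E) :=
  DirectSum.toModule_lof K 0 (H.cls 0 x)

theorem Subbialgebra.grCounit_grLof_succ (H : Subbialgebra K E) (n : ℕ) (x : H.gr (n + 1)) :
    CoalgebraStruct.counit (R := K) (H.grLof (n + 1) x) = 0 :=
  DirectSum.toModule_lof K (n + 1) x

/-- `E / H^{∧0} = E`. -/
noncomputable def Subbialgebra.unQ (H : Subbialgebra K E) : E ⧸ H.wp 0 →ₗ[K] E :=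
  Submodule.liftQ _ LinearMap.id (fun _ hx => hx)

theorem Subbialgebra.unQ_comp_mkQ (H : Subbialgebra K E) : H.unQ ∘ₗ (H.wp 0).mkQ = LinearMap.id :=
  rfl

theorem Subbialgebra.gr_counit (H : Subbialgebra K E) :
    CoalgebraStruct.counit (R := K) = Coalgebra.counit (R := K) ∘ₗ H.unQ ∘ₗ H.grQ 0 := by
  refine H.grHom_ext fun n x => ?_
  cases n with
  | zero =>
    rw [grCounit_grLof_zero]
    have := LinearMap.congr_fun (H.grQ_comp_grLof 0) (H.cls 0 x)
    simp only [LinearMap.comp_apply] at this ⊢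
    rw [this]
    rfl
  | succ n =>
    rw [grCounit_grLof_succ]
    have := LinearMap.congr_fun (H.grQ_comp_grLof_of_ne (Nat.succ_ne_zero n)) (H.cls (n + 1) x)
    simp only [LinearMap.comp_apply] at this ⊢
    rw [this]
    simp

theorem Subbialgebra.gr_lcounit (H : Subbialgebra K E) (x : H.GrB) :
    TensorProduct.lid K H.GrB (TensorProduct.map CoalgebraStruct.counit LinearMap.id
      (CoalgebraStruct.comul (R := K) x)) = x := by
  refine sub_eq_zero.1 (H.grQ_ext _ fun n => ?_)
  rw [map_sub, ← lid_map, gr_counit, ← LinearMap.comp_assoc, ← LinearMap.id_comp (H.grQ n),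
    ← map_map_apply, ← LinearMap.comp_apply (TensorProduct.map _ _) CoalgebraStruct.comul,
    H.grQ_comul (zero_add n), LinearMap.comp_apply]
  obtain ⟨y, hy⟩ := Submodule.mkQ_surjective _ (H.grQ n x)
  rw [← hy, comulQ_mkQ, map_map_apply, LinearMap.comp_assoc, unQ_comp_mkQ, LinearMap.comp_id,
    LinearMap.id_comp, lid_map, lcounit_map, LinearMap.id_comp, hy, sub_self]

theorem Subbialgebra.gr_rcounit (H : Subbialgebra K E) (x : H.GrB) :
    TensorProduct.rid K H.GrB (TensorProduct.map LinearMap.id CoalgebraStruct.counit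
      (CoalgebraStruct.comul (R := K) x)) = x := by
  refine sub_eq_zero.1 (H.grQ_ext _ fun n => ?_)
  rw [map_sub, ← rid_map, gr_counit, ← LinearMap.comp_assoc, ← LinearMap.id_comp (H.grQ n),
    ← map_map_apply, ← LinearMap.comp_apply (TensorProduct.map _ _) CoalgebraStruct.comul,
    H.grQ_comul (add_zero n), LinearMap.comp_apply]
  obtain ⟨y, hy⟩ := Submodule.mkQ_surjective _ (H.grQ n x)
  rw [← hy, comulQ_mkQ, map_map_apply, LinearMap.comp_assoc, unQ_comp_mkQ, LinearMap.comp_id,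
    LinearMap.id_comp, rid_map, rcounit_map, LinearMap.id_comp, hy, sub_self]

noncomputable instance Subbialgebra.grCoalgebra (H : Subbialgebra K E) : Coalgebra K H.GrB where
  __ := H.grCS
  coassoc := LinearMap.ext H.gr_coassoc
  rTensor_counit_comp_comul := LinearMap.ext fun w => by
    apply (TensorProduct.lid K H.GrB).injective
    exact (H.gr_lcounit w).trans (by simp)
  lTensor_counit_comp_comul := LinearMap.ext fun w => by
    apply (TensorProduct.rid K H.GrB).injective
    exact (H.gr_rcounit w).trans (by simp)

end GrCoalgebra

/-! ### Compatibility of the multiplication and the comultiplication -/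

section GrBialgebra

variable {K : Type v} [Field K] {E : Type u} [Ring E] [Bialgebra K E]

attribute [local instance] Subbialgebra.grAddCommGroup

/-- An element of `V ⊗ C` which vanishes in `V / A ⊗ W / B` lies in `A ⊗ C + V ⊗ B`. -/
theorem exists_add_of_map_mkQ_eq_zero {V W : Type*} [AddCommGroup V] [Module K V]
    [AddCommGroup W] [Module K W] (A : Submodule K V) {B C : Submodule K W} (hBC : B ≤ C)
    {t : V ⊗[K] W}
    (ht : t ∈ LinearMap.range (TensorProduct.map (LinearMap.id (M := V)) C.subtype))
    (h : TensorProduct.map A.mkQ B.mkQ t = 0) :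
    ∃ (s : A ⊗[K] C) (w : V ⊗[K] B), t = TensorProduct.map A.subtype C.subtype s +
      TensorProduct.map LinearMap.id B.subtype w := by
  obtain ⟨y, rfl⟩ := ht
  let i : B →ₗ[K] C := Submodule.inclusion hBC
  have hex : Function.Exact i (B.mkQ ∘ₗ C.subtype) := by
    intro s
    simp only [LinearMap.comp_apply, Submodule.mkQ_apply, Submodule.Quotient.mk_eq_zero,
      Submodule.subtype_apply]
    exact ⟨fun h => ⟨⟨s, h⟩, rfl⟩, by rintro ⟨t, rfl⟩; exact t.2⟩
  have h0 : TensorProduct.map LinearMap.id (B.mkQ ∘ₗ C.subtype)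
      (TensorProduct.map A.mkQ LinearMap.id y) = 0 := by
    rw [map_map_apply] at h ⊢
    exact h
  obtain ⟨w, hw⟩ := (Module.Flat.lTensor_exact (V ⧸ A) hex _).1 h0
  obtain ⟨w', rfl⟩ := LinearMap.rTensor_surjective B A.mkQ_surjective w
  have h2 : TensorProduct.map A.mkQ LinearMap.id (y - TensorProduct.map LinearMap.id i w') = 0 := by
    rw [map_sub, map_map_apply, sub_eq_zero, ← hw]
    simp only [LinearMap.rTensor, LinearMap.lTensor, map_map_apply, LinearMap.comp_id,
      LinearMap.id_comp]
  obtain ⟨t, ht⟩ := (Module.Flat.rTensor_exact C (LinearMap.exact_subtype_mkQ A) _).1 h2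
  refine ⟨t, w', ?_⟩
  have e : TensorProduct.map A.subtype C.subtype t =
      TensorProduct.map LinearMap.id C.subtype (y - TensorProduct.map LinearMap.id i w') := by
    rw [← ht, LinearMap.rTensor, map_map_apply]
    rfl
  rw [e, map_sub, map_map_apply]
  exact (sub_add_cancel _ _).symm

theorem Subbialgebra.gr_induction (H : Subbialgebra K E) {p : H.GrB → Prop}
    (hl : ∀ n (x : H.wp (n + 1)), p (H.grLof n (H.cls n x)))
    (hadd : ∀ x y, p x → p y → p (x + y)) (w : H.GrB) : p w := by
  refine DirectSum.induction_on (motive := p) w ?_ (fun n a => ?_) hadd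
  · have h := hl 0 0
    rwa [map_zero, map_zero] at h
  · obtain ⟨x, rfl⟩ := Submodule.mkQ_surjective _ a
    exact hl n x

theorem Subbialgebra.grLof_mul (H : Subbialgebra K E) {i j : ℕ} (x : H.gr i) (y : H.gr j) :
    H.grLof i x * H.grLof j y = H.grLof (i + j) (H.grMul i j x y) :=
  DirectSum.of_mul_of (A := H.gr) x y

/-- The span of the pairs `(x ⊗ y, [x] ⊗ [y])` with `x ∈ H^{∧(i+1)}`, `y ∈ H^{∧(j+1)}` and
`i + j = n`. It is the graph of the passage from `∑ H^{∧(i+1)} ⊗ H^{∧(j+1)}` to the part of degree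
`n` of `gr_H E ⊗ gr_H E`, which is well defined by `symbols_unique`. -/
noncomputable def Subbialgebra.symbols (H : Subbialgebra K E) (n : ℕ) :
    Submodule K ((E ⊗[K] E) × (H.GrB ⊗[K] H.GrB)) :=
  Submodule.span K {p | ∃ (i j : ℕ) (x : H.wp (i + 1)) (y : H.wp (j + 1)), i + j = n ∧
    p = ((x : E) ⊗ₜ (y : E), H.grLof i (H.cls i x) ⊗ₜ H.grLof j (H.cls j y))}

theorem Subbialgebra.tmul_mem_symbols (H : Subbialgebra K E) (i j : ℕ) (x : H.wp (i + 1))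
    (y : H.wp (j + 1)) : (((x : E) ⊗ₜ (y : E), H.grLof i (H.cls i x) ⊗ₜ H.grLof j (H.cls j y)) :
      (E ⊗[K] E) × (H.GrB ⊗[K] H.GrB)) ∈ H.symbols (i + j) :=
  Submodule.subset_span ⟨i, j, x, y, rfl, rfl⟩

theorem Subbialgebra.mul_mem_symbols (H : Subbialgebra K E) {n m : ℕ}
    {p q : (E ⊗[K] E) × (H.GrB ⊗[K] H.GrB)} (hp : p ∈ H.symbols n) (hq : q ∈ H.symbols m) :
    p * q ∈ H.symbols (n + m) := by
  have h := Submodule.mul_mem_mul hp hq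
  rw [symbols, symbols, Submodule.span_mul_span] at h
  refine Submodule.span_le.2 ?_ h
  rintro _ ⟨_, ⟨i, j, x, y, rfl, rfl⟩, _, ⟨k, l, z, w, rfl, rfl⟩, rfl⟩
  have := H.tmul_mem_symbols (i + k) (j + l) ⟨(x : E) * z, H.mul_mem_wp x.2 z.2⟩
    ⟨(y : E) * w, H.mul_mem_wp y.2 w.2⟩
  rw [show i + j + (k + l) = i + k + (j + l) by omega]
  rw [SetLike.mem_coe]
  simpa only [Prod.mk_mul_mk, Algebra.TensorProduct.tmul_mul_tmul, grLof_mul, grMul_cls] using this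

/-- In `E / H^{∧a} ⊗ E / H^{∧b}` with `a + b = n`, the two components of an element of `symbols n`
agree: a pair `(x ⊗ y, [x] ⊗ [y])` of another bidegree has image zero there. -/
theorem Subbialgebra.symbols_eq (H : Subbialgebra K E) {n a b : ℕ} (h : a + b = n)
    {p : (E ⊗[K] E) × (H.GrB ⊗[K] H.GrB)} (hp : p ∈ H.symbols n) :
    TensorProduct.map (H.grQ a) (H.grQ b) p.2 =
      TensorProduct.map (H.wp a).mkQ (H.wp b).mkQ p.1 := by
  induction hp using Submodule.span_induction with
  | zero => simp
  | add x y _ _ hx hy => simp only [Prod.fst_add, Prod.snd_add, map_add, hx, hy]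
  | smul c x _ hx => simp only [Prod.smul_fst, Prod.smul_snd, map_smul, hx]
  | mem p hp =>
    obtain ⟨i, j, x, y, rfl, rfl⟩ := hp
    rw [TensorProduct.map_tmul, TensorProduct.map_tmul]
    have e1 := LinearMap.congr_fun (H.grQ_comp_grLof i) (H.cls i x)
    have e2 := LinearMap.congr_fun (H.grQ_comp_grLof j) (H.cls j y)
    simp only [LinearMap.comp_apply, grIncl_cls] at e1 e2
    rcases lt_trichotomy a i with hl | rfl | hl
    · -- Here `j < b`, so that `y` vanishes in `E / H^{∧b}`.
      have e3 := LinearMap.congr_fun (H.grQ_comp_grLof_of_ne (n := j) (m := b) (by omega))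
        (H.cls j y)
      rw [LinearMap.comp_apply, LinearMap.zero_apply] at e3
      have e4 : (H.wp b).mkQ (y : E) = 0 :=
        (Submodule.Quotient.mk_eq_zero _).2 (H.wp_mono (by omega) y.2)
      rw [e3, e4, TensorProduct.tmul_zero, TensorProduct.tmul_zero]
    · obtain rfl : b = j := by omega
      rw [e1, e2]
    · have e3 := LinearMap.congr_fun (H.grQ_comp_grLof_of_ne (n := i) (m := a) (by omega))
        (H.cls i x)
      rw [LinearMap.comp_apply, LinearMap.zero_apply] at e3
      have e4 : (H.wp a).mkQ (x : E) = 0 :=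
        (Submodule.Quotient.mk_eq_zero _).2 (H.wp_mono (by omega) x.2)
      rw [e3, e4, TensorProduct.zero_tmul, TensorProduct.zero_tmul]

theorem Subbialgebra.symbols_eq_zero (H : Subbialgebra K E) {n a b : ℕ} (h : a + b ≠ n)
    {p : (E ⊗[K] E) × (H.GrB ⊗[K] H.GrB)} (hp : p ∈ H.symbols n) :
    TensorProduct.map (H.grQ a) (H.grQ b) p.2 = 0 := by
  induction hp using Submodule.span_induction with
  | zero => simp
  | add x y _ _ hx hy => simp only [Prod.snd_add, map_add, hx, hy, add_zero]
  | smul c x _ hx => simp only [Prod.smul_snd, map_smul, hx, smul_zero]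
  | mem p hp =>
    obtain ⟨i, j, x, y, rfl, rfl⟩ := hp
    rw [TensorProduct.map_tmul]
    by_cases ha : i = a
    · have e3 := LinearMap.congr_fun (H.grQ_comp_grLof_of_ne (n := j) (m := b) (by omega))
        (H.cls j y)
      rw [LinearMap.comp_apply, LinearMap.zero_apply] at e3
      rw [e3, TensorProduct.tmul_zero]
    · have e3 := LinearMap.congr_fun (H.grQ_comp_grLof_of_ne ha) (H.cls i x)
      rw [LinearMap.comp_apply, LinearMap.zero_apply] at e3
      rw [e3, TensorProduct.zero_tmul]

/-- The second component of an element of `symbols n` is determined by the first. -/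
theorem Subbialgebra.symbols_unique (H : Subbialgebra K E) {n : ℕ} {s : E ⊗[K] E}
    {t t' : H.GrB ⊗[K] H.GrB} (h : (s, t) ∈ H.symbols n) (h' : (s, t') ∈ H.symbols n) : t = t' := by
  refine H.grQ_tensor_ext fun a b => ?_
  by_cases hab : a + b = n
  · exact (H.symbols_eq hab h).trans (H.symbols_eq hab h').symm
  · exact (H.symbols_eq_zero hab h).trans (H.symbols_eq_zero hab h').symm

theorem Subbialgebra.map_mem_symbols (H : Subbialgebra K E) (i j : ℕ)
    (s : H.wp (i + 1) ⊗[K] H.wp (j + 1)) :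
    (TensorProduct.map (H.wp (i + 1)).subtype (H.wp (j + 1)).subtype s,
      TensorProduct.map (H.grLof i ∘ₗ H.cls i) (H.grLof j ∘ₗ H.cls j) s) ∈ H.symbols (i + j) := by
  induction s using TensorProduct.induction_on with
  | zero => simp only [map_zero]; exact zero_mem _
  | add x y hx hy => simp only [map_add]; exact add_mem hx hy
  | tmul x y => exact H.tmul_mem_symbols i j x y

/-- The comultiplication maps `H^{∧(n+1)}` to the sum of the `H^{∧(i+1)} ⊗ H^{∧(j+1)}` with
`i + j = n`. The terms are split off one after the other: by `Δ x ∈ H^{∧(k+1)} ⊗ E + E ⊗ H^{∧m}`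
for `k + m = n`, a remainder in `E ⊗ H^{∧(m+1)}` is in `H^{∧(k+1)} ⊗ H^{∧(m+1)} + E ⊗ H^{∧m}`. -/
theorem Subbialgebra.exists_symbol (H : Subbialgebra K E) {n : ℕ} (x : H.wp (n + 1)) :
    ∃ t, (Coalgebra.comul (R := K) (x : E), t) ∈ H.symbols n := by
  have key : ∀ k m, k + m = n + 1 → ∃ p ∈ H.symbols n, ∃ w : E ⊗[K] H.wp m,
      Coalgebra.comul (R := K) (x : E) = p.1 + TensorProduct.map LinearMap.id (H.wp m).subtype w ∧
      TensorProduct.map (H.wp k).mkQ LinearMap.id p.1 = 0 := by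
    intro k
    induction k with
    | zero =>
      intro m hm
      obtain rfl : m = n + 1 := by omega
      obtain ⟨w, hw⟩ := (Module.Flat.lTensor_exact E (LinearMap.exact_subtype_mkQ (H.wp (n + 1)))
        _).1 (wedgePow_left H.isSubcoalg (n + 1) x.2)
      exact ⟨0, zero_mem _, w, by rw [Prod.fst_zero, zero_add]; exact hw.symm, map_zero _⟩
    | succ k ih =>
      intro m hm
      obtain ⟨p, hp, w, hw, h0⟩ := ih (m + 1) (by omega)
      have hle : H.wp k ≤ H.wp (k + 1) := H.wp_mono (Nat.le_succ k)
      have h1 : TensorProduct.map (H.wp (k + 1)).mkQ LinearMap.id p.1 = 0 := by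
        have e : (H.wp (k + 1)).mkQ = Submodule.factor hle ∘ₗ (H.wp k).mkQ := rfl
        rw [e, map_comp_left, h0, map_zero]
      have hx : TensorProduct.map (H.wp (k + 1)).mkQ (H.wp m).mkQ
          (Coalgebra.comul (R := K) (x : E)) = 0 := by
        have hx' : (x : E) ∈ H.wp (k + 1 + m) := by rw [hm]; exact x.2
        rwa [H.wp_add] at hx'
      have h2 : TensorProduct.map (H.wp (k + 1)).mkQ (H.wp m).mkQ p.1 = 0 := by
        rw [← LinearMap.comp_id (H.wp m).mkQ, map_comp_right, h1, map_zero]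
      rw [hw, map_add, h2, zero_add] at hx
      obtain ⟨s, w', hs⟩ := exists_add_of_map_mkQ_eq_zero (H.wp (k + 1))
        (H.wp_mono (Nat.le_succ m)) ⟨w, rfl⟩ hx
      refine ⟨p + _, add_mem hp (by
        obtain rfl : k + m = n := by omega
        exact H.map_mem_symbols k m s), w', ?_, ?_⟩
      · rw [hw, hs, Prod.fst_add, add_assoc]
      · have e : (H.wp (k + 1)).mkQ ∘ₗ (H.wp (k + 1)).subtype = 0 := by ext; simp
        rw [Prod.fst_add, map_add, h1, map_map_apply, e, TensorProduct.map_zero_left,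
          LinearMap.zero_apply, zero_add]
  obtain ⟨p, hp, w, hw, -⟩ := key (n + 1) 0 rfl
  refine ⟨p.2, ?_⟩
  have e : (H.wp 0).subtype = 0 := LinearMap.ext fun x => x.2
  rw [hw, e, TensorProduct.map_zero_right, LinearMap.zero_apply, add_zero]
  exact hp

/-- The comultiplication of `gr_H E` is the passage to symbols of the comultiplication of `E`. As
the symbols are compatible with products, so is therefore the comultiplication of `gr_H E`. -/
theorem Subbialgebra.comul_mem_symbols (H : Subbialgebra K E) {n : ℕ} (x : H.wp (n + 1)) :
    (Coalgebra.comul (R := K) (x : E), CoalgebraStruct.comul (R := K) (H.grLof n (H.cls n x))) ∈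
      H.symbols n := by
  obtain ⟨t, ht⟩ := H.exists_symbol x
  suffices h : t = CoalgebraStruct.comul (R := K) (H.grLof n (H.cls n x)) by rwa [← h]
  refine H.grQ_tensor_ext fun a b => ?_
  by_cases hab : a + b = n
  · exact (H.symbols_eq hab ht).trans (H.grQ_comul_grLof hab (H.cls n x)).symm
  · exact (H.symbols_eq_zero hab ht).trans (H.grQ_comul_of_ne hab _).symm

theorem Subbialgebra.gr_comul_mul (H : Subbialgebra K E) (x y : H.GrB) :
    Coalgebra.comul (R := K) (x * y) = Coalgebra.comul (R := K) x * Coalgebra.comul (R := K) y := by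
  induction x using H.gr_induction with
  | hadd x x' h h' => rw [add_mul, map_add, map_add, add_mul, h, h']
  | hl i x =>
    induction y using H.gr_induction with
    | hadd y y' h h' => rw [mul_add, map_add, map_add, mul_add, h, h']
    | hl j y =>
      rw [grLof_mul, grMul_cls]
      refine H.symbols_unique (H.comul_mem_symbols (n := i + j) _) ?_
      have := H.mul_mem_symbols (H.comul_mem_symbols x) (H.comul_mem_symbols y)
      rwa [Prod.mk_mul_mk, ← Bialgebra.comul_mul] at this

theorem Subbialgebra.gr_comul_one (H : Subbialgebra K E) :
    Coalgebra.comul (R := K) (1 : H.GrB) = 1 := by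
  have h := H.comul_mem_symbols (n := 0) ⟨1, H.one_mem_wp⟩
  rw [Bialgebra.comul_one] at h
  exact H.symbols_unique h (H.tmul_mem_symbols 0 0 ⟨1, H.one_mem_wp⟩ ⟨1, H.one_mem_wp⟩)

theorem Subbialgebra.counit_grLof_of_ne (H : Subbialgebra K E) {n : ℕ} (hn : n ≠ 0) (x : H.gr n) :
    Coalgebra.counit (R := K) (H.grLof n x) = 0 := by
  obtain ⟨n, rfl⟩ := Nat.exists_eq_succ_of_ne_zero hn
  exact H.grCounit_grLof_succ n x

theorem Subbialgebra.gr_counit_mul (H : Subbialgebra K E) (x y : H.GrB) :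
    Coalgebra.counit (R := K) (x * y) =
      Coalgebra.counit (R := K) x * Coalgebra.counit (R := K) y := by
  induction x using H.gr_induction with
  | hadd x x' h h' => rw [add_mul, map_add, map_add, add_mul, h, h']
  | hl i x =>
    induction y using H.gr_induction with
    | hadd y y' h h' => rw [mul_add, map_add, map_add, mul_add, h, h']
    | hl j y =>
      rw [grLof_mul]
      by_cases hi : i = 0
      · by_cases hj : j = 0
        · subst hi hj
          refine (H.grCounit_grLof_zero _).trans ?_
          refine (Bialgebra.counit_mul (R := K) (x : E) (y : E)).trans ?_
          exact congrArg₂ (· * ·) (H.grCounit_grLof_zero x).symm (H.grCounit_grLof_zero y).symm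
        · rw [H.counit_grLof_of_ne (by omega), H.counit_grLof_of_ne hj, mul_zero]
      · rw [H.counit_grLof_of_ne (by omega), H.counit_grLof_of_ne hi, zero_mul]

noncomputable instance Subbialgebra.grBialgebra (H : Subbialgebra K E) : Bialgebra K H.GrB :=
  Bialgebra.mk' K H.GrB
    ((H.grCounit_grLof_zero ⟨1, H.one_mem_wp⟩).trans Bialgebra.counit_one)
    (fun {a b} => H.gr_counit_mul a b)
    H.gr_comul_one
    (fun {a b} => H.gr_comul_mul a b)

end GrBialgebra

/-! ### The homomorphism to the cotensor coalgebra -/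

section GrToCot

variable {K : Type v} [Field K] {E : Type u} [Ring E] [Bialgebra K E]

attribute [local instance] Subbialgebra.grAddCommGroup

/-- The projection of `gr_H E` onto its component `H` of degree zero. -/
noncomputable def Subbialgebra.grFst (H : Subbialgebra K E) : H.GrB →ₗ[K] H.toSubalgebra :=
  factor H.incl H.incl_injective (H.unQ ∘ₗ H.grQ 0) (fun x => by
    obtain ⟨y, hy⟩ := Submodule.mkQ_surjective _ (H.grProj 0 x)
    have e : H.unQ (H.grQ 0 x) = y := by
      rw [grQ, LinearMap.comp_apply, ← hy]
      rfl
    rw [LinearMap.comp_apply, e]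
    exact ⟨⟨y, H.mem_wp_one.1 y.2⟩, rfl⟩)

theorem Subbialgebra.incl_comp_grFst (H : Subbialgebra K E) :
    H.incl ∘ₗ H.grFst = H.unQ ∘ₗ H.grQ 0 :=
  LinearMap.ext fun x => factor_spec H.incl H.incl_injective _ _ x

theorem Subbialgebra.grFst_grLof_zero (H : Subbialgebra K E) (x : H.wp (0 + 1)) :
    H.grFst (H.grLof 0 (H.cls 0 x)) = ⟨x, H.mem_wp_one.1 x.2⟩ := by
  apply H.incl_injective
  refine (LinearMap.congr_fun H.incl_comp_grFst _).trans ?_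
  exact congrArg H.unQ (LinearMap.congr_fun (H.grQ_comp_grLof 0) (H.cls 0 x))

theorem Subbialgebra.grFst_grLof_of_ne (H : Subbialgebra K E) {n : ℕ} (hn : n ≠ 0) (x : H.gr n) :
    H.grFst (H.grLof n x) = 0 := by
  apply H.incl_injective
  refine (LinearMap.congr_fun H.incl_comp_grFst _).trans ?_
  rw [map_zero]
  exact (congrArg H.unQ (LinearMap.congr_fun (H.grQ_comp_grLof_of_ne hn) x)).trans (map_zero _)

theorem Subbialgebra.incl_comp_grProj (H : Subbialgebra K E) :
    H.grIncl 1 ∘ₗ H.grProj 1 = H.grQ 1 := rfl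

theorem Subbialgebra.map_unQ_comulQ (H : Subbialgebra K E) (q : E ⧸ H.wp 0) :
    TensorProduct.map H.unQ H.unQ (H.comulQ 0 0 0 rfl q) = Coalgebra.comul (R := K) (H.unQ q) := by
  obtain ⟨x, rfl⟩ := Submodule.mkQ_surjective _ q
  rw [comulQ_mkQ, map_map_apply, unQ_comp_mkQ, TensorProduct.map_id]
  rfl

theorem Subbialgebra.map_unQ_comulQ_left (H : Subbialgebra K E) (q : E ⧸ H.wp 1) :
    TensorProduct.map H.unQ LinearMap.id (H.comulQ 0 1 1 rfl q) = H.lcoQ q := by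
  obtain ⟨x, rfl⟩ := Submodule.mkQ_surjective _ q
  rw [comulQ_mkQ, map_map_apply, unQ_comp_mkQ]
  rfl

theorem Subbialgebra.map_unQ_comulQ_right (H : Subbialgebra K E) (q : E ⧸ H.wp 1) :
    TensorProduct.map LinearMap.id H.unQ (H.comulQ 1 0 1 rfl q) = H.rcoQ q := by
  obtain ⟨x, rfl⟩ := Submodule.mkQ_surjective _ q
  rw [comulQ_mkQ, map_map_apply, unQ_comp_mkQ]
  rfl

theorem Subbialgebra.grQ_comul_apply (H : Subbialgebra K E) {a b n : ℕ} (h : a + b = n)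
    (x : H.GrB) : TensorProduct.map (H.grQ a) (H.grQ b) (Coalgebra.comul (R := K) x) =
      H.comulQ a b n h (H.grQ n x) := LinearMap.congr_fun (H.grQ_comul h) x

/-- The projections of `gr_H E` onto `H` and `(H ∧ H)/H` satisfy the hypotheses of the universal
property of the cotensor coalgebra. -/
theorem Subbialgebra.liftData_gr (H : Subbialgebra K E) :
    H.grOne.LiftData H.grFst (H.grProj 1) where
  comul_f := by
    ext x
    apply map_injective H.incl_injective H.incl_injective
    rw [LinearMap.comp_apply, LinearMap.comp_apply, H.comul_spec, map_map_apply, incl_comp_grFst,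
      ← map_map_apply, H.grQ_comul_apply rfl, map_unQ_comulQ]
    exact congrArg _ (LinearMap.congr_fun H.incl_comp_grFst x)
  counit_f := by
    have e : Coalgebra.counit (R := K) (A := H.toSubalgebra) = Coalgebra.counit ∘ₗ H.incl := rfl
    rw [e, LinearMap.comp_assoc, incl_comp_grFst]
    exact H.gr_counit.symm
  lcoact_g := by
    ext x
    apply map_injective H.incl_injective (H.grIncl_injective 1)
    refine (H.grLco_spec _).trans ?_
    rw [LinearMap.comp_apply, map_map_apply, incl_comp_grFst, incl_comp_grProj,
      ← LinearMap.id_comp (H.grQ 1), ← map_map_apply, H.grQ_comul_apply rfl, map_unQ_comulQ_left]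
    rfl
  rcoact_g := by
    ext x
    apply map_injective (H.grIncl_injective 1) H.incl_injective
    refine (H.grRco_spec _).trans ?_
    rw [LinearMap.comp_apply, map_map_apply, incl_comp_grFst, incl_comp_grProj,
      ← LinearMap.id_comp (H.grQ 1), ← map_map_apply, H.grQ_comul_apply rfl, map_unQ_comulQ_right]
    rfl

/-- The component of degree `n` of the map from `gr_H E` to the cotensor coalgebra is injective on
the component of degree `n`, and vanishes on the others: it is an iteration of the injective maps
`E / H^{∧(n+1)} → E / H^{∧n} ⊗ E / H`. -/
theorem Subbialgebra.L_eq_zero (H : Subbialgebra K E) (n : ℕ) (x : H.GrB) :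
    H.grOne.L H.grFst (H.grProj 1) n x = 0 ↔ H.grQ n x = 0 := by
  induction n generalizing x with
  | zero =>
    have e : H.grOne.L H.grFst (H.grProj 1) 0 x = H.grOne.ambZero (H.grFst x) := rfl
    have hu : Function.Injective H.unQ :=
      LinearMap.ker_eq_bot.1 (Submodule.ker_liftQ_eq_bot _ _ _ (fun _ hx => hx))
    rw [e, LinearEquiv.map_eq_zero_iff, ← map_eq_zero_iff _ hu,
      ← map_eq_zero_iff _ H.incl_injective]
    exact iff_of_eq (congrArg (· = 0) (LinearMap.congr_fun H.incl_comp_grFst x))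
  | succ n ih =>
    have e : H.grOne.L H.grFst (H.grProj 1) (n + 1) x = H.grOne.ambSucc n (TensorProduct.map
      (H.grOne.L H.grFst (H.grProj 1) n) (H.grProj 1) (Coalgebra.comul (R := K) x)) := rfl
    have hk : LinearMap.ker (H.grOne.L H.grFst (H.grProj 1) n) = LinearMap.ker (H.grQ n) :=
      Submodule.ext ih
    rw [e, LinearEquiv.map_eq_zero_iff, ← map_mkQ_ker_left, hk, map_mkQ_ker_left,
      ← map_eq_zero_iff _ (map_injective (f := LinearMap.id) Function.injective_id
        (H.grIncl_injective 1)), ← map_comp_right, incl_comp_grProj, H.grQ_comul_apply rfl,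
      map_eq_zero_iff _ (H.comulQ_injective _ _ _ _)]

theorem Subbialgebra.grQ_grLof_of_ne (H : Subbialgebra K E) {n m : ℕ} (h : n ≠ m) (x : H.gr n) :
    H.grQ m (H.grLof n x) = 0 := LinearMap.congr_fun (H.grQ_comp_grLof_of_ne h) x

theorem Subbialgebra.L_fin (H : Subbialgebra K E) (x : H.GrB) :
    ∃ N, ∀ n ≥ N, H.grOne.L H.grFst (H.grProj 1) n x = 0 := by
  induction x using H.gr_induction with
  | hl m x => exact ⟨m + 1, fun n hn => (H.L_eq_zero n _).2 (H.grQ_grLof_of_ne (by omega) _)⟩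
  | hadd x y hx hy =>
    obtain ⟨N, hN⟩ := hx
    obtain ⟨N', hN'⟩ := hy
    refine ⟨max N N', fun n hn => ?_⟩
    rw [map_add, hN n (le_trans (le_max_left _ _) hn), hN' n (le_trans (le_max_right _ _) hn),
      add_zero]

/-- The coalgebra homomorphism from `gr_H E` to the cotensor coalgebra of `(H ∧ H)/H` which is
induced by the projections of `gr_H E` onto `H` and `(H ∧ H)/H`. -/
noncomputable def Subbialgebra.toCotLin (H : Subbialgebra K E) : H.GrB →ₗ[K] H.grOne.Cot :=
  H.grOne.corestrict (H.grOne.liftAmb H.grFst (H.grProj 1) H.L_fin)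
    (H.liftData_gr.liftAmb_mem H.L_fin)

theorem Subbialgebra.π_toCotLin (H : Subbialgebra K E) (n : ℕ) (x : H.GrB) :
    H.grOne.π n (H.grOne.val (H.toCotLin x)) = H.grOne.L H.grFst (H.grProj 1) n x :=
  LinearMap.congr_fun (H.grOne.π_liftAmb H.grFst (H.grProj 1) H.L_fin n) x

theorem Subbialgebra.toCotLin_injective (H : Subbialgebra K E) :
    Function.Injective H.toCotLin := by
  rw [injective_iff_map_eq_zero]
  intro x hx
  refine H.grQ_ext x fun n => (H.L_eq_zero n x).1 ?_
  rw [← H.π_toCotLin, hx, map_zero, map_zero]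

theorem Subbialgebra.comul_comp_toCotLin (H : Subbialgebra K E) :
    Coalgebra.comul ∘ₗ H.toCotLin =
      TensorProduct.map H.toCotLin H.toCotLin ∘ₗ Coalgebra.comul (R := K) := by
  ext x
  refine map_injective H.grOne.val_injective H.grOne.val_injective ?_
  have := H.liftData_gr.comul_liftAmb H.L_fin x
  rw [LinearMap.comp_apply, LinearMap.comp_apply, HopfBimodule.val_comul, map_map_apply]
  exact this

theorem Subbialgebra.q0_comp_toCotLin (H : Subbialgebra K E) :
    H.grOne.q0 ∘ₗ H.toCotLin = H.grFst :=
  H.grOne.p0_liftAmb H.grFst (H.grProj 1) H.L_fin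

theorem Subbialgebra.q1_comp_toCotLin (H : Subbialgebra K E) :
    H.grOne.q1 ∘ₗ H.toCotLin = H.grProj 1 :=
  H.grOne.p1_liftAmb H.liftData_gr H.L_fin

/-- An element of the cotensor coalgebra of degree zero is determined by its image in `H`. -/
theorem HopfBimodule.eq_j0 {A : Type u} [Ring A] [Bialgebra K A] {M : Type u} [AddCommGroup M]
    [Module K M] (P : HopfBimodule K A M) {z : P.Cot}
    (h : ∀ n > 0, P.π n (P.val z) = 0) : z = P.j0 (P.q0 z) := by
  apply P.val_injective
  apply P.Amb_ext
  intro n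
  cases n with
  | zero =>
    rw [P.π_zero, P.π_zero]
    exact congrArg P.ambZero (P.q0_j0 (P.q0 z)).symm
  | succ n =>
    rw [h _ (Nat.succ_pos n)]
    exact (P.π_ι_of_ne (Nat.succ_ne_zero n).symm _).symm

theorem Subbialgebra.toCotLin_grLof_zero (H : Subbialgebra K E) (x : H.wp (0 + 1)) :
    H.toCotLin (H.grLof 0 (H.cls 0 x)) = H.grOne.j0 ⟨x, H.mem_wp_one.1 x.2⟩ := by
  refine (H.grOne.eq_j0 fun n hn => ?_).trans (congrArg H.grOne.j0 ?_)
  · rw [π_toCotLin, L_eq_zero, H.grQ_grLof_of_ne (by omega)]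
  · exact (LinearMap.congr_fun H.q0_comp_toCotLin _).trans (H.grFst_grLof_zero x)

theorem Subbialgebra.toCotLin_grLof_one (H : Subbialgebra K E) (m : H.gr 1) :
    H.toCotLin (H.grLof 1 m) = H.grOne.j1 m := by
  refine (H.grOne.eq_j1 ?_ fun n hn => ?_).trans (congrArg H.grOne.j1 ?_)
  · exact (LinearMap.congr_fun H.q0_comp_toCotLin _).trans (H.grFst_grLof_of_ne one_ne_zero m)
  · rw [π_toCotLin, L_eq_zero, H.grQ_grLof_of_ne (by omega)]
  · exact (LinearMap.congr_fun H.q1_comp_toCotLin _).trans (H.grProj_grLof 1 m)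

theorem comul_comp_mul' (A : Type*) [Ring A] [Bialgebra K A] :
    Coalgebra.comul ∘ₗ LinearMap.mul' K A =
      TensorProduct.map (LinearMap.mul' K A) (LinearMap.mul' K A) ∘ₗ Coalgebra.comul (R := K) := by
  ext x y
  exact (Bialgebra.comul_mul x y).trans (HopfBimodule.map_mul_tensorComm (LinearMap.mul' K A)
    (fun x y => LinearMap.mul'_apply) _ _).symm

theorem Subbialgebra.grLof_cls_mul (H : Subbialgebra K E) {i j n : ℕ} (h : i + j = n)
    (x : H.wp (i + 1)) (y : H.wp (j + 1)) : H.grLof i (H.cls i x) * H.grLof j (H.cls j y) =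
      H.grLof n (H.cls n ⟨(x : E) * y, h ▸ H.mul_mem_wp x.2 y.2⟩) := by
  subst h
  exact H.grLof_mul _ _

theorem Subbialgebra.grFst_mul (H : Subbialgebra K E) (x y : H.GrB) :
    H.grFst (x * y) = H.grFst x * H.grFst y := by
  induction x using H.gr_induction with
  | hadd x x' h h' => rw [add_mul, map_add, map_add, add_mul, h, h']
  | hl i x =>
    induction y using H.gr_induction with
    | hadd y y' h h' => rw [mul_add, map_add, map_add, mul_add, h, h']
    | hl j y =>
      by_cases hi : i = 0
      · by_cases hj : j = 0
        · subst hi hj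
          rw [H.grLof_cls_mul (zero_add 0), grFst_grLof_zero, grFst_grLof_zero, grFst_grLof_zero]
          rfl
        · rw [grLof_mul, H.grFst_grLof_of_ne (by omega), H.grFst_grLof_of_ne hj, mul_zero]
      · rw [grLof_mul, H.grFst_grLof_of_ne (by omega), H.grFst_grLof_of_ne hi, zero_mul]

theorem Subbialgebra.grProj_one_mul (H : Subbialgebra K E) (x y : H.GrB) :
    H.grProj 1 (x * y) = H.grLact (H.grFst x) (H.grProj 1 y) +
      H.grRact (H.grProj 1 x) (H.grFst y) := by
  induction x using H.gr_induction with
  | hadd x x' h h' =>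
    simp only [add_mul, map_add, LinearMap.add_apply, h, h']
    abel
  | hl i x =>
    induction y using H.gr_induction with
    | hadd y y' h h' =>
      simp only [mul_add, map_add, h, h']
      abel
    | hl j y =>
      by_cases hij : i + j = 1
      · rw [H.grLof_cls_mul hij, grProj_grLof]
        obtain ⟨rfl, rfl⟩ | ⟨rfl, rfl⟩ : (i = 0 ∧ j = 1) ∨ (i = 1 ∧ j = 0) := by omega
        · rw [H.grProj_grLof_of_ne zero_ne_one, map_zero, LinearMap.zero_apply, add_zero,
            grFst_grLof_zero, grProj_grLof, grLact_cls]
        · rw [H.grFst_grLof_of_ne one_ne_zero, map_zero, LinearMap.zero_apply,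
            H.grFst_grLof_zero y, H.grProj_grLof 1 (H.cls 1 x), grRact_cls]
          exact (zero_add _).symm
      · rw [grLof_mul, H.grProj_grLof_of_ne hij]
        by_cases hi : i = 0
        · rw [H.grProj_grLof_of_ne (n := i) (by omega), H.grProj_grLof_of_ne (n := j) (by omega)]
          simp
        · rw [H.grFst_grLof_of_ne hi]
          by_cases hj : j = 0
          · rw [H.grProj_grLof_of_ne (n := i) (by omega)]
            simp
          · rw [H.grFst_grLof_of_ne hj]
            simp

/-- Both sides are values of coalgebra homomorphisms from `gr_H E ⊗ gr_H E` to the cotensor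
coalgebra, and these agree because their components in `H` and `(H ∧ H)/H` do. -/
theorem Subbialgebra.toCotLin_mul (H : Subbialgebra K E) (x y : H.GrB) :
    H.toCotLin (x * y) = H.toCotLin x * H.toCotLin y := by
  have e : H.toCotLin ∘ₗ LinearMap.mul' K H.GrB =
      H.grOne.mulCot ∘ₗ TensorProduct.map H.toCotLin H.toCotLin := by
    have e0 := fun x => LinearMap.congr_fun H.q0_comp_toCotLin x
    have e1 := fun x => LinearMap.congr_fun H.q1_comp_toCotLin x
    simp only [LinearMap.comp_apply] at e0 e1
    refine H.grOne.cot_hom_ext ?_ ?_ ?_ ?_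
    · exact HopfBimodule.comul_comp_comp H.comul_comp_toCotLin (comul_comp_mul' H.GrB)
    · exact HopfBimodule.comul_comp_comp H.grOne.comul_mulCot
        (HopfBimodule.comul_map_map _ _ H.comul_comp_toCotLin H.comul_comp_toCotLin)
    · ext x y : 3
      simp [e0, HopfBimodule.q0_mulCot, grFst_mul]
    · ext x y : 3
      simp only [TensorProduct.AlgebraTensorModule.curry_apply, TensorProduct.curry_apply,
        LinearMap.coe_restrictScalars, LinearMap.comp_apply, LinearMap.mul'_apply, e1,
        TensorProduct.map_tmul, HopfBimodule.q1_mulCot, e0, grProj_one_mul]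
      rfl
  exact LinearMap.congr_fun e (x ⊗ₜ y)

/-- The map from `gr_H E` to the cotensor coalgebra, as an algebra homomorphism. -/
noncomputable def Subbialgebra.toCotAlg (H : Subbialgebra K E) : H.GrB →ₐ[K] H.grOne.Cot :=
  AlgHom.ofLinearMap H.toCotLin (H.toCotLin_grLof_zero ⟨1, H.one_mem_wp⟩) H.toCotLin_mul

theorem HopfBimodule.adjoin_t0_t1 {A : Type u} [Ring A] [Bialgebra K A] {M : Type u}
    [AddCommGroup M] [Module K M] (P : HopfBimodule K A M) :
    Algebra.adjoin K (Set.range P.t0 ∪ Set.range P.t1) = ⊤ := by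
  refine eq_top_iff.2 fun x hx => ?_
  clear hx
  induction x using P.relTensorAlgebra_induction with
  | h0 h => exact Algebra.subset_adjoin (Or.inl ⟨h, rfl⟩)
  | h1 m => exact Algebra.subset_adjoin (Or.inr ⟨m, rfl⟩)
  | hadd x y hx hy => exact add_mem hx hy
  | hmul x y hx hy => exact mul_mem hx hy
  | hK c => exact Subalgebra.algebraMap_mem _ c

theorem HopfBimodule.toCot_range {A : Type u} [Ring A] [Bialgebra K A] {M : Type u}
    [AddCommGroup M] [Module K M] (P : HopfBimodule K A M) :
    P.toCot.range = Algebra.adjoin K (Set.range P.j0 ∪ Set.range P.j1) := by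
  rw [← Algebra.map_top, ← P.adjoin_t0_t1, AlgHom.map_adjoin, Set.image_union, ← Set.range_comp,
    ← Set.range_comp]
  congr 3
  · exact funext P.toCot_t0
  · exact funext P.toCot_t1

theorem HopfBimodule.adjoin_inl_inr {A : Type u} [Ring A] [Bialgebra K A] {M : Type u}
    [AddCommGroup M] [Module K M] (P : HopfBimodule K A M) :
    Algebra.adjoin K (Set.range P.inl ∪ Set.range P.inr) = ⊤ := by
  have h : (⊤ : Subalgebra K P.RelTensorAlgebra).map P.toCot.rangeRestrict = ⊤ := by
    rw [Algebra.map_top, AlgHom.range_eq_top]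
    exact P.toCot.rangeRestrict_surjective
  rw [← P.adjoin_t0_t1, AlgHom.map_adjoin, Set.image_union, ← Set.range_comp,
    ← Set.range_comp] at h
  exact h

theorem adjoin_range_eq_top_of_algEquiv {A B : Type*} [Ring A] [Algebra K A] [Ring B] [Algebra K B]
    (φ : A ≃ₐ[K] B) {X Y : Type*} {f : X → A} {g : Y → A} {f' : X → B} {g' : Y → B}
    (hf : ∀ x, φ (f x) = f' x) (hg : ∀ y, φ (g y) = g' y)
    (h : Algebra.adjoin K (Set.range f' ∪ Set.range g') = ⊤) :
    Algebra.adjoin K (Set.range f ∪ Set.range g) = ⊤ := by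
  obtain rfl : φ ∘ f = f' := funext hf
  obtain rfl : φ ∘ g = g' := funext hg
  rw [Set.range_comp, Set.range_comp, ← Set.image_union] at h
  refine Subalgebra.map_injective (f := φ.toAlgHom) φ.injective ?_
  rw [AlgHom.map_adjoin]
  refine h.trans ?_
  rw [Algebra.map_top, eq_comm, AlgHom.range_eq_top]
  exact φ.surjective

theorem Subbialgebra.counit_comp_toCotLin (H : Subbialgebra K E) :
    Coalgebra.counit (R := K) ∘ₗ H.toCotLin = Coalgebra.counit :=
  LinearMap.ext fun x => (HopfBimodule.counit_eq_q0 _ _).trans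
    ((congrArg _ (LinearMap.congr_fun H.q0_comp_toCotLin x)).trans
      (LinearMap.congr_fun H.liftData_gr.counit_f x))

/-- The inclusion `Subbialgebra.grH` of `H` in `gr_H E`, with values in `Subbialgebra.GrB`. -/
noncomputable def Subbialgebra.grInl (H : Subbialgebra K E) : H.toSubalgebra →ₗ[K] H.GrB := H.grH

theorem Subbialgebra.toCotAlg_grInl (H : Subbialgebra K E) (h : H.toSubalgebra) :
    H.toCotAlg (H.grInl h) = H.grOne.j0 h :=
  H.toCotLin_grLof_zero _

theorem Subbialgebra.toCotAlg_grLof_one (H : Subbialgebra K E) (m : H.gr 1) :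
    H.toCotAlg (H.grLof 1 m) = H.grOne.j1 m :=
  H.toCotLin_grLof_one m

theorem Subbialgebra.toCotAlg_range (H : Subbialgebra K E)
    (h : Algebra.adjoin K (Set.range H.grInl ∪ Set.range (H.grLof 1)) = ⊤) :
    H.toCotAlg.range = H.grOne.toCot.range := by
  rw [← Algebra.map_top, ← h, AlgHom.map_adjoin, Set.image_union, ← Set.range_comp,
    ← Set.range_comp, HopfBimodule.toCot_range]
  congr 3
  · exact funext H.toCotAlg_grInl
  · exact funext H.toCotAlg_grLof_one

/-- An injective homomorphism of bialgebras is an isomorphism onto its image. -/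
theorem Subbialgebra.exists_bialgEquiv_of_range_eq {A C : Type*} [Ring A] [Bialgebra K A] [Ring C]
    [Bialgebra K C] (S : Subbialgebra K C) (f : A →ₐ[K] C) (hf : Function.Injective f)
    (hS : f.range = S.toSubalgebra)
    (h0 : Coalgebra.counit (R := K) ∘ₗ f.toLinearMap = Coalgebra.counit)
    (h1 : Coalgebra.comul (R := K) ∘ₗ f.toLinearMap =
      TensorProduct.map f.toLinearMap f.toLinearMap ∘ₗ Coalgebra.comul) :
    ∃ e : A ≃ₐc[K] S.toSubalgebra, ∀ x, (e x : C) = f x := by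
  let φ : A ≃ₐ[K] S.toSubalgebra :=
    (AlgEquiv.ofInjective f hf).trans (Subalgebra.equivOfEq _ _ hS)
  have hφ : S.toSubalgebra.val.toLinearMap ∘ₗ φ.toLinearMap = f.toLinearMap := rfl
  refine ⟨BialgEquiv.ofAlgEquiv φ (AlgHom.ext fun x => ?_) (AlgHom.ext fun x => ?_), fun x => rfl⟩
  · exact LinearMap.congr_fun h0 x
  · apply S.val_injective
    have e := map_map_apply (f := φ.toLinearMap) (g := φ.toLinearMap)
      (f' := S.toSubalgebra.val.toLinearMap) (g' := S.toSubalgebra.val.toLinearMap)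
      (Coalgebra.comul (R := K) x)
    rw [hφ] at e
    exact e.trans ((LinearMap.congr_fun h1 x).symm.trans (S.comul_spec (φ x)).symm)

/-- If `gr_H E` is generated by `H` and `(H ∧ H)/H`, the injective homomorphism to the cotensor
coalgebra has the bialgebra of type one as its image. -/
theorem Subbialgebra.exists_bialgEquiv (H : Subbialgebra K E)
    (h : Algebra.adjoin K (Set.range H.grInl ∪ Set.range (H.grLof 1)) = ⊤) :
    ∃ e : H.GrB ≃ₐc[K] H.grOne.typeOne.toSubalgebra,
      (∀ h : H.toSubalgebra, e (H.grInl h) = H.grOne.inl h) ∧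
      (∀ m : H.gr 1, e (H.grLof 1 m) = H.grOne.inr m) := by
  obtain ⟨e, he⟩ := H.grOne.typeOne.exists_bialgEquiv_of_range_eq H.toCotAlg H.toCotLin_injective
    (H.toCotAlg_range h) H.counit_comp_toCotLin H.comul_comp_toCotLin
  refine ⟨e, fun h => Subtype.ext ?_, fun m => Subtype.ext ?_⟩
  · exact (he _).trans ((H.toCotAlg_grInl h).trans (H.grOne.toCot_t0 h).symm)
  · exact (he _).trans ((H.toCotAlg_grLof_one m).trans (H.grOne.toCot_t1 m).symm)

theorem Subbialgebra.adjoin_eq_top_of_bialgEquiv (H : Subbialgebra K E)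
    (e : H.GrB ≃ₐc[K] H.grOne.typeOne.toSubalgebra)
    (h0 : ∀ h : H.toSubalgebra, e (H.grInl h) = H.grOne.inl h)
    (h1 : ∀ m : H.gr 1, e (H.grLof 1 m) = H.grOne.inr m) :
    Algebra.adjoin K (Set.range H.grInl ∪ Set.range (H.grLof 1)) = ⊤ :=
  adjoin_range_eq_top_of_algEquiv (e : H.GrB ≃ₐ[K] H.grOne.typeOne.toSubalgebra) h0 h1
    H.grOne.adjoin_inl_inr

end GrToCot

/-! ### Strongly graded algebras -/

section StronglyGraded

variable {K : Type*} [Field K]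

/-- Strong gradedness read off inside an algebra which contains all the components. -/
theorem isStronglyGraded_iff {A : ℕ → Type*} [∀ n, AddCommGroup (A n)] [∀ n, Module K (A n)]
    [DirectSum.GSemiring A] [DirectSum.GAlgebra K A] {R : Type*} [Ring R] [Algebra K R]
    (f : ∀ n, A n →ₗ[K] R) (hf : ∀ n, Function.Injective (f n))
    (hmul : ∀ i j (a : A i) (b : A j), f (i + j) (GradedMonoid.GMul.mul a b) = f i a * f j b) :
    IsStronglyGraded K A ↔ ∀ i j,
      LinearMap.range (f (i + j)) ≤ LinearMap.range (f i) * LinearMap.range (f j) := by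
  refine forall₂_congr fun i j => ?_
  have e : LinearMap.range (f (i + j) ∘ₗ TensorProduct.lift
      (DirectSum.gMulLHom K A : A i →ₗ[K] A j →ₗ[K] A (i + j))) =
        LinearMap.range (f i) * LinearMap.range (f j) := by
    apply le_antisymm
    · rintro _ ⟨t, rfl⟩
      induction t using TensorProduct.induction_on with
      | zero => rw [map_zero]; exact zero_mem _
      | add s t hs ht => rw [map_add]; exact add_mem hs ht
      | tmul a b =>
        rw [LinearMap.comp_apply, TensorProduct.lift.tmul, DirectSum.gMulLHom_apply_apply, hmul]
        exact Submodule.mul_mem_mul ⟨a, rfl⟩ ⟨b, rfl⟩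
    · refine Submodule.mul_le.2 ?_
      rintro _ ⟨a, rfl⟩ _ ⟨b, rfl⟩
      exact ⟨a ⊗ₜ b, (congrArg _ (TensorProduct.lift.tmul _ _)).trans (hmul i j a b)⟩
  rw [← e]
  constructor
  · rintro h _ ⟨x, rfl⟩
    obtain ⟨t, rfl⟩ := h x
    exact ⟨t, rfl⟩
  · intro h x
    obtain ⟨t, ht⟩ := h ⟨x, rfl⟩
    exact ⟨t, hf _ ht⟩

variable {R : Type*} [Ring R] [Algebra K R]

theorem pow_le_of_mul_le {D : ℕ → Submodule K R} (hone : 1 ∈ D 0)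
    (hmul : ∀ i j, D i * D j ≤ D (i + j)) (n : ℕ) : D 1 ^ n ≤ D n := by
  induction n with
  | zero => rw [pow_zero, Submodule.one_le]; exact hone
  | succ n ih => rw [pow_succ]; exact (mul_le_mul' ih le_rfl).trans (hmul n 1)

theorem le_adjoin_of_le_mul {D : ℕ → Submodule K R} (hD : ∀ i j, D (i + j) ≤ D i * D j) (n : ℕ) :
    D n ≤ Subalgebra.toSubmodule (Algebra.adjoin K ((D 0 : Set R) ∪ D 1)) := by
  induction n with
  | zero => exact fun x hx => Algebra.subset_adjoin (Or.inl hx)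
  | succ n ih =>
    refine (hD n 1).trans (Submodule.mul_le.2 fun x hx y hy => ?_)
    exact Subalgebra.mul_mem _ (ih hx) (Algebra.subset_adjoin (Or.inr hy))

/-- If a graded algebra is generated by its components of degrees zero and one, its component of
degree `n` is `D 1 ^ n * D 0`. -/
theorem le_pow_mul_of_adjoin_eq_top {D : ℕ → Submodule K R} (hone : 1 ∈ D 0)
    (hmul : ∀ i j, D i * D j ≤ D (i + j)) (p : ℕ → R →ₗ[K] R) (hp : ∀ n, ∀ x ∈ D n, p n x = x)
    (hp' : ∀ m n, m ≠ n → ∀ x ∈ D m, p n x = 0)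
    (h : Algebra.adjoin K ((D 0 : Set R) ∪ D 1) = ⊤) (n : ℕ) : D n ≤ D 1 ^ n * D 0 := by
  have h0 : ∀ n, D 0 * (D 1 ^ n * D 0) ≤ D 1 ^ n * D 0 := by
    intro n
    cases n with
    | zero => simpa using hmul 0 0
    | succ n =>
      rw [pow_succ', ← mul_assoc, ← mul_assoc]
      exact mul_le_mul' (mul_le_mul' (hmul 0 1) le_rfl) le_rfl
  have hle : ∀ n, D 1 ^ n * D 0 ≤ D n := fun n =>
    (mul_le_mul' (pow_le_of_mul_le hone hmul n) le_rfl).trans (hmul n 0)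
  have htop : ∀ x : R, ∀ w ∈ ⨆ n, D 1 ^ n * D 0, x * w ∈ ⨆ n, D 1 ^ n * D 0 := by
    intro x
    have hx : x ∈ Algebra.adjoin K ((D 0 : Set R) ∪ D 1) := h ▸ Algebra.mem_top
    induction hx using Algebra.adjoin_induction with
    | mem x hx =>
      intro w hw
      induction hw using Submodule.iSup_induction' with
      | zero => rw [mul_zero]; exact zero_mem _
      | add y z _ _ hy hz => rw [mul_add]; exact add_mem hy hz
      | mem n y hy =>
        rcases hx with hx | hx
        · exact Submodule.mem_iSup_of_mem n (h0 n (Submodule.mul_mem_mul hx hy))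
        · refine Submodule.mem_iSup_of_mem (n + 1) ?_
          rw [pow_succ', mul_assoc]
          exact Submodule.mul_mem_mul hx hy
    | algebraMap c =>
      intro w hw
      rw [← Algebra.smul_def]
      exact Submodule.smul_mem _ c hw
    | add x y _ _ hx hy => intro w hw; rw [add_mul]; exact add_mem (hx w hw) (hy w hw)
    | mul x y _ _ hx hy => intro w hw; rw [mul_assoc]; exact hx _ (hy w hw)
  have hproj : ⨆ m, D 1 ^ m * D 0 ≤ (D 1 ^ n * D 0).comap (p n) := by
    refine iSup_le fun m x hx => ?_
    rw [Submodule.mem_comap]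
    by_cases hm : m = n
    · subst hm
      rwa [hp m x (hle m hx)]
    · rw [hp' m n hm x (hle m hx)]
      exact zero_mem _
  intro x hx
  have := htop x 1 (Submodule.mem_iSup_of_mem 0 (by simpa using hone))
  rw [mul_one] at this
  have := hproj this
  rwa [Submodule.mem_comap, hp n x hx] at this

theorem le_mul_of_le_pow_mul {D : ℕ → Submodule K R} (hone : 1 ∈ D 0)
    (hmul : ∀ i j, D i * D j ≤ D (i + j)) (h : ∀ n, D n ≤ D 1 ^ n * D 0) (i j : ℕ) :
    D (i + j) ≤ D i * D j := by
  refine (h _).trans ?_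
  rw [pow_add, mul_assoc]
  have hle := pow_le_of_mul_le hone hmul
  exact mul_le_mul' (hle i) ((mul_le_mul' (hle j) le_rfl).trans (hmul j 0))

/-- For a multiplicative filtration, products of components are components if and only if each
component from the second on is a power of the first. -/
theorem le_mul_iff_eq_pow {D : ℕ → Submodule K R} (hone : 1 ∈ D 0)
    (hmul : ∀ i j, D i * D j ≤ D (i + j)) :
    (∀ i j, D (i + j) ≤ D i * D j) ↔ ∀ n, 2 ≤ n → D n = D 1 ^ n := by
  have hle := pow_le_of_mul_le hone hmul
  constructor
  · intro h n hn
    refine le_antisymm ?_ (hle n)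
    induction n, (one_le_two.trans hn : 1 ≤ n) using Nat.le_induction with
    | base => rw [pow_one]
    | succ n hn' ih =>
      rw [pow_succ]
      refine (h n 1).trans (mul_le_mul' ?_ le_rfl)
      obtain rfl | hn' := hn'.eq_or_lt
      · rw [pow_one]
      · exact ih hn'
  · intro h i j
    obtain rfl | hi := Nat.eq_zero_or_pos i
    · rw [zero_add]
      exact fun x hx => one_mul x ▸ Submodule.mul_mem_mul hone hx
    obtain rfl | hj := Nat.eq_zero_or_pos j
    · rw [add_zero]
      exact fun x hx => mul_one x ▸ Submodule.mul_mem_mul hx hone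
    rw [h (i + j) (by omega), pow_add]
    exact mul_le_mul' (hle i) (hle j)

end StronglyGraded

/-! ### The associated graded algebra and the filtration -/

section Filtration

variable {K : Type v} [Field K] {E : Type u} [Ring E] [Bialgebra K E]

attribute [local instance] Subbialgebra.grAddCommGroup

theorem Subbialgebra.grLof_injective (H : Subbialgebra K E) (n : ℕ) :
    Function.Injective (H.grLof n) :=
  Function.LeftInverse.injective (H.grProj_grLof n)

theorem Subbialgebra.isStronglyGraded_gr_iff (H : Subbialgebra K E) :
    IsStronglyGraded K H.gr ↔ ∀ i j, LinearMap.range (H.grLof (i + j)) ≤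
      LinearMap.range (H.grLof i) * LinearMap.range (H.grLof j) :=
  isStronglyGraded_iff H.grLof H.grLof_injective fun _ _ a b => (H.grLof_mul a b).symm

theorem Subbialgebra.isStronglyGraded_wp_iff (H : Subbialgebra K E) :
    IsStronglyGraded K (fun n => ↥(H.wp (n + 1))) ↔
      ∀ i j, H.wp (i + j + 1) ≤ H.wp (i + 1) * H.wp (j + 1) := by
  refine (isStronglyGraded_iff (fun n => (H.wp (n + 1)).subtype)
    (fun n => Subtype.val_injective) fun i j a b => rfl).trans ?_
  simp only [Submodule.range_subtype]

theorem Subbialgebra.range_grInl (H : Subbialgebra K E) :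
    Set.range H.grInl = LinearMap.range (H.grLof 0) := by
  ext x
  constructor
  · rintro ⟨h, rfl⟩
    exact ⟨_, rfl⟩
  · rintro ⟨a, rfl⟩
    obtain ⟨y, rfl⟩ := Submodule.mkQ_surjective _ a
    exact ⟨⟨y, H.mem_wp_one.1 y.2⟩, rfl⟩

theorem Subbialgebra.isStronglyGraded_gr_iff_adjoin (H : Subbialgebra K E) :
    IsStronglyGraded K H.gr ↔
      Algebra.adjoin K (Set.range H.grInl ∪ Set.range (H.grLof 1)) = ⊤ := by
  rw [isStronglyGraded_gr_iff, range_grInl, ← LinearMap.coe_range (H.grLof 1)]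
  have hone : (1 : H.GrB) ∈ LinearMap.range (H.grLof 0) := ⟨H.cls 0 ⟨1, H.one_mem_wp⟩, rfl⟩
  have hmul : ∀ i j, LinearMap.range (H.grLof i) * LinearMap.range (H.grLof j) ≤
      LinearMap.range (H.grLof (i + j)) := by
    refine fun i j => Submodule.mul_le.2 ?_
    rintro _ ⟨a, rfl⟩ _ ⟨b, rfl⟩
    exact ⟨_, (H.grLof_mul a b).symm⟩
  constructor
  · intro h
    refine eq_top_iff.2 fun x hx => ?_
    clear hx
    induction x using H.gr_induction with
    | hl n a => exact le_adjoin_of_le_mul (D := fun n => LinearMap.range (H.grLof n)) h n ⟨_, rfl⟩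
    | hadd x y hx hy => exact add_mem hx hy
  · intro h
    refine le_mul_of_le_pow_mul (D := fun n => LinearMap.range (H.grLof n)) hone hmul
      (le_pow_mul_of_adjoin_eq_top hone hmul (fun n => H.grLof n ∘ₗ H.grProj n) ?_ ?_ h)
    · rintro n _ ⟨a, rfl⟩
      exact congrArg (H.grLof n) (H.grProj_grLof n a)
    · rintro m n hmn _ ⟨a, rfl⟩
      exact (congrArg (H.grLof n) (H.grProj_grLof_of_ne hmn a)).trans (map_zero _)

/-- Surjectivity of the multiplication of `gr_H E` means that the multiplication of the filtration
is surjective up to terms of lower degree. -/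
theorem Subbialgebra.isStronglyGraded_gr_iff_sup (H : Subbialgebra K E) :
    IsStronglyGraded K H.gr ↔
      ∀ i j, H.wp (i + j + 1) ≤ H.wp (i + 1) * H.wp (j + 1) ⊔ H.wp (i + j) := by
  rw [isStronglyGraded_gr_iff]
  refine forall₂_congr fun i j => ?_
  have key : ∀ x : H.wp (i + j + 1), H.grLof (i + j) (H.cls (i + j) x) ∈
      LinearMap.range (H.grLof i) * LinearMap.range (H.grLof j) ↔
        (x : E) ∈ H.wp (i + 1) * H.wp (j + 1) ⊔ H.wp (i + j) := by
    intro x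
    constructor
    · have : ∀ z ∈ LinearMap.range (H.grLof i) * LinearMap.range (H.grLof j),
          ∃ y : H.wp (i + j + 1), (y : E) ∈ H.wp (i + 1) * H.wp (j + 1) ∧
            H.grLof (i + j) (H.cls (i + j) y) = z := by
        intro z hz
        induction hz using Submodule.mul_induction_on' with
        | mem_mul_mem a ha b hb =>
          obtain ⟨a, rfl⟩ := ha
          obtain ⟨b, rfl⟩ := hb
          obtain ⟨a, rfl⟩ := Submodule.mkQ_surjective _ a
          obtain ⟨b, rfl⟩ := Submodule.mkQ_surjective _ b
          exact ⟨⟨(a : E) * b, H.mul_mem_wp a.2 b.2⟩, Submodule.mul_mem_mul a.2 b.2,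
            (H.grLof_mul (H.cls i a) (H.cls j b)).symm⟩
        | add y _ z _ hy hz =>
          obtain ⟨y, hy, rfl⟩ := hy
          obtain ⟨z, hz, rfl⟩ := hz
          exact ⟨y + z, add_mem hy hz, by rw [map_add, map_add]⟩
      intro h
      obtain ⟨y, hy, e⟩ := this _ h
      have e' : H.cls (i + j) (x - y) = 0 := by
        rw [map_sub, sub_eq_zero]
        exact (H.grLof_injective _ e).symm
      have := H.cls_eq_zero.1 e'
      rw [← add_sub_cancel (y : E) x]
      exact add_mem (Submodule.mem_sup_left hy) (Submodule.mem_sup_right this)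
    · intro h
      obtain ⟨s, hs, w, hw, e⟩ := Submodule.mem_sup.1 h
      have : ∀ s ∈ H.wp (i + 1) * H.wp (j + 1), ∃ hs : s ∈ H.wp (i + j + 1),
          H.grLof (i + j) (H.cls (i + j) ⟨s, hs⟩) ∈
            LinearMap.range (H.grLof i) * LinearMap.range (H.grLof j) := by
        intro s hs
        induction hs using Submodule.mul_induction_on' with
        | mem_mul_mem a ha b hb =>
          refine ⟨H.mul_mem_wp ha hb, ?_⟩
          have e := H.grLof_mul (H.cls i ⟨a, ha⟩) (H.cls j ⟨b, hb⟩)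
          refine (congrArg (· ∈ _) e).mp ?_
          exact Submodule.mul_mem_mul ⟨_, rfl⟩ ⟨_, rfl⟩
        | add y _ z _ hy hz =>
          obtain ⟨hy, hy'⟩ := hy
          obtain ⟨hz, hz'⟩ := hz
          refine ⟨add_mem hy hz, ?_⟩
          have := add_mem hy' hz'
          rw [← map_add, ← map_add] at this
          exact this
      obtain ⟨hs, hs'⟩ := this s hs
      have e' : H.cls (i + j) x = H.cls (i + j) ⟨s, hs⟩ := by
        rw [← sub_eq_zero, ← map_sub, H.cls_eq_zero]
        change (x : E) - s ∈ _
        rwa [← e, add_sub_cancel_left]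
      rwa [e']
  constructor
  · intro h x hx
    exact (key ⟨x, hx⟩).1 (h ⟨_, rfl⟩)
  · rintro h _ ⟨a, rfl⟩
    obtain ⟨x, rfl⟩ := Submodule.mkQ_surjective _ a
    exact (key x).2 (h x.2)

/-- The terms of lower degree are absorbed by induction on the degree of the left factor. -/
theorem Subbialgebra.isStronglyGraded_gr_iff_wp (H : Subbialgebra K E) :
    IsStronglyGraded K H.gr ↔ IsStronglyGraded K (fun n => ↥(H.wp (n + 1))) := by
  rw [isStronglyGraded_gr_iff_sup, isStronglyGraded_wp_iff]
  refine ⟨fun h i => ?_, fun h i j => (h i j).trans le_sup_left⟩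
  induction i with
  | zero =>
    intro j
    rw [zero_add j]
    exact fun x hx => one_mul x ▸ Submodule.mul_mem_mul H.one_mem_wp hx
  | succ i ih =>
    intro j
    refine (h (i + 1) j).trans (sup_le le_rfl ?_)
    rw [Nat.add_right_comm]
    exact (ih j).trans (mul_le_mul' (H.wp_mono (Nat.le_succ _)) le_rfl)

theorem Subbialgebra.isStronglyGraded_wp_iff_eq_pow (H : Subbialgebra K E) :
    IsStronglyGraded K (fun n => ↥(H.wp (n + 1))) ↔ ∀ n, 2 ≤ n → H.wp (n + 1) =
      wedge (Subalgebra.toSubmodule H.toSubalgebra)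
        (Subalgebra.toSubmodule H.toSubalgebra) ^ n := by
  rw [isStronglyGraded_wp_iff, ← H.wp_one, ← H.wp_add]
  exact le_mul_iff_eq_pow (D := fun n => H.wp (n + 1)) H.one_mem_wp
    fun i j => Submodule.mul_le.2 fun x hx y hy => H.mul_mem_wp hx hy

end Filtration

end TypeOne

theorem mainTheorem5 {K : Type v} [Field K] {E : Type u} [Ring E] [Bialgebra K E]
    (H : TypeOne.Subbialgebra K E) :
    List.TFAE [
      -- `gr_H E` is the bialgebra of type one associated to `H` and `(H ∧ H)/H`
      ∃ e : H.Gr ≃ₐc[K] H.grOne.typeOne.toSubalgebra,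
        (∀ h : H.toSubalgebra, e (H.grH h) = H.grOne.inl h) ∧
        (∀ m : H.gr 1, e (H.grM m) = H.grOne.inr m),
      -- `gr_H E` is strongly graded as an algebra
      TypeOne.IsStronglyGraded K H.gr,
      -- `gr_H E` is generated as an algebra by `H` and `(H ∧ H)/H`
      Algebra.adjoin K (Set.range H.grH ∪ Set.range H.grM) = ⊤,
      -- `⊕ H^{∧(n+1)}` is strongly graded as an algebra
      TypeOne.IsStronglyGraded K (fun n => ↥(H.wp (n + 1))),
      -- `H^{∧(n+1)} = (H ∧ H)^n` for all `n ≥ 2`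
      ∀ n : ℕ, 2 ≤ n → H.wp (n + 1) =
        TypeOne.wedge (Subalgebra.toSubmodule H.toSubalgebra)
          (Subalgebra.toSubmodule H.toSubalgebra) ^ n] := by
  tfae_have 1 → 3 := fun ⟨e, h0, h1⟩ => H.adjoin_eq_top_of_bialgEquiv e h0 h1
  tfae_have 3 → 1 := H.exists_bialgEquiv
  tfae_have 2 ↔ 3 := H.isStronglyGraded_gr_iff_adjoin
  tfae_have 2 ↔ 4 := H.isStronglyGraded_gr_iff_wp
  tfae_have 4 ↔ 5 := H.isStronglyGraded_wp_iff_eq_pow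
  tfae_finish
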